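/- **Conventions.** A closed curve is a continuous map $C:[0,1]\to\mathbb R^2$ with $C(0)=C(1)$; it is *regular* if it is $C^1$ with nowhere vanishing derivative and $C'(0)=C'(1)$, and *piecewise regular* if $[0,1]$ has a finite subdivision such that $C$ is $C^1$ with nowhere vanishing (one-sided at end points) derivative on each closed piece. A piecewise regular closed curve is *normal* if $C(t)\neq C(0)$ for $0<t<1$ and it has only finitely many self-intersection points, each of which is a transverse double point. For $p_0\in\mathbb R^2$ let $\mathfrak C_{p_0}$ be the set of normal curves starting at $p_0$, together with the constant curve at $p_0$. A regular normal curve $C$ is *self-overlapping* if there are a ($C^1$) immersion $F:D^2\to\mathbb R^2$ of the closed unit disk and a homeomorphism $\varphi$ of $S^1$ with $C(t)=F(\varphi(e^{2\pi i t}))$ for all $t\in[0,1]$; a curve that is not a regular normal curve is self-overlapping if it is a uniform limit of self-overlapping regular normal curves. The *winding area* of $C$ is $W(C)=\int_{\mathbb R^2}|wn(x,C)|\,dx$, where $wn(x,C)$ is the winding number of $C$ around $x$ ($0$ if $x$ is on $C$). For a continuous $H:[0,1]^2\to\mathbb R^2$ let $E_H(x)\in\mathbb N\cup\{\infty\}$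 be the number of connected components of $H^{-1}(x)$ and $\mathrm{Area}(H)=\int_{\mathbb R^2}E_H(x)\,dx$. The *minimum homotopy area* $\sigma(C)$ of $C\in\mathfrak C_{p_0}$ is the infimum of $\mathrm{Area}(H)$ over all continuous, piecewise differentiable $H$ (that is, $[0,1]^2$ is a union of finitely many closed sets on each of which $H$ is differentiable) with $H(0,t)=C(t)$, $H(1,t)=p_0$ and $H(s,0)=H(s,1)=p_0$ for all $s,t\in[0,1]$. **Theorem (Winding Area Equality for Self-Overlapping Curves).** Let $C\in\mathfrak C_{p_0}$ be a self-overlapping curve. Then $W(C)<\infty$ and $\sigma(C)=W(C)$. Moreover, for every $C^1$ immersion $F:D^2\to\mathbb R^2$ and every homeomorphism $\varphi$ of $S^1$ with $C(t)=F(\varphi(e^{2\pi i t}))$ for all $t\in[0,1]$, the linear contraction $$H(s,t)=F\bigl((1-s)\,\varphi(e^{2\pi i t})+s\,\varphi(1)\bigr)$$ is a piecewise differentiable homotopy, with fixed base point $p_0$, from $C$ to the constant curve $p_0$, and $\mathrm{Area}(H)=W(C)$. -/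

import Mathlib

open Set MeasureTheory

/-! The plane is `ℂ` with its Euclidean metric and Lebesgue measure `volume`.  Curves and homotopies
are total functions on `ℝ` and `ℝ × ℝ`; only their values on `[0,1]` and `[0,1]²` ever matter. -/

namespace HomotopyArea

/-- A closed curve: a continuous map on `[0,1]` with `C 0 = C 1`. -/
def IsClosedCurve (C : ℝ → ℂ) : Prop :=
  ContinuousOn C (Icc 0 1) ∧ C 0 = C 1

/-- A regular closed curve, i.e. an immersion of the circle: `C` is continuously differentiable on
`[0,1]`, its derivative never vanishes and is itself a closed curve. -/
def IsRegularCurve (C : ℝ → ℂ) : Prop :=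
  IsClosedCurve C ∧ ContDiffOn ℝ 1 C (Icc 0 1) ∧
    (∀ t ∈ Icc (0 : ℝ) 1, derivWithin C (Icc 0 1) t ≠ 0) ∧
    derivWithin C (Icc 0 1) 0 = derivWithin C (Icc 0 1) 1

/-- A piecewise regular closed curve: there is a partition `0 = τ 0 < τ 1 < ⋯ < τ n = 1` such that
`C` is continuously differentiable with nowhere vanishing derivative on each closed piece (at the
end points of a piece the derivative is one-sided). -/
def IsPiecewiseRegularCurve (C : ℝ → ℂ) : Prop :=
  IsClosedCurve C ∧ ∃ (n : ℕ) (τ : ℕ → ℝ), τ 0 = 0 ∧ τ n = 1 ∧ ∀ i < n,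
    τ i < τ (i + 1) ∧ ContDiffOn ℝ 1 C (Icc (τ i) (τ (i + 1))) ∧
      ∀ t ∈ Icc (τ i) (τ (i + 1)), derivWithin C (Icc (τ i) (τ (i + 1))) t ≠ 0

/-- The parameters at which the curve passes through `p`; since `0` and `1` are the same point of
the circle, only `[0,1)` is used. -/
def fiber (C : ℝ → ℂ) (p : ℂ) : Set ℝ := {t | t ∈ Ico (0 : ℝ) 1 ∧ C t = p}

/-- A point that the curve passes more than once. -/
def IsIntersectionPoint (C : ℝ → ℂ) (p : ℂ) : Prop := (fiber C p).Nontrivial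

/-- A simple crossing point: a transverse double point. -/
def IsSimpleCrossing (C : ℝ → ℂ) (p : ℂ) : Prop :=
  ∃ t₁ t₂ : ℝ, t₁ ≠ t₂ ∧ fiber C p = {t₁, t₂} ∧
    ∃ v₁ v₂ : ℂ, HasDerivAt C v₁ t₁ ∧ HasDerivAt C v₂ t₂ ∧ LinearIndependent ℝ ![v₁, v₂]

/-- A normal curve: a piecewise regular closed curve that does not return to its start point
before the end and has only finitely many intersection points, all of them simple crossings. -/
def IsNormalCurve (C : ℝ → ℂ) : Prop :=
  IsPiecewiseRegularCurve C ∧ (∀ t ∈ Ioo (0 : ℝ) 1, C t ≠ C 0) ∧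
    {p | IsIntersectionPoint C p}.Finite ∧ ∀ p, IsIntersectionPoint C p → IsSimpleCrossing C p

/-- The set of all normal curves with start point `p₀`, including the constant curve at `p₀`. -/
def normalCurves (p₀ : ℂ) : Set (ℝ → ℂ) :=
  {C | (IsNormalCurve C ∧ C 0 = p₀) ∨ ∀ t ∈ Icc (0 : ℝ) 1, C t = p₀}

/-- `C` winds `n` times around `x`: there is a continuous logarithm `L` of `C - x` along `[0,1]`,
and it increases by `2πi n`.  (This forces `x` to lie off the curve.) -/
def HasWindingNumber (C : ℝ → ℂ) (x : ℂ) (n : ℤ) : Prop :=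
  ∃ L : ℝ → ℂ, ContinuousOn L (Icc 0 1) ∧ (∀ t ∈ Icc (0 : ℝ) 1, Complex.exp (L t) = C t - x) ∧
    L 1 - L 0 = n * (2 * Real.pi * Complex.I)

open Classical in
/-- The winding number of a closed curve around `x`; it is `0` when `x` lies on the curve. -/
noncomputable def windingNumber (C : ℝ → ℂ) (x : ℂ) : ℤ :=
  if h : ∃ n : ℤ, HasWindingNumber C x n then h.choose else 0

/-- The winding area `∫ |wn(x, C)| dx`. -/
noncomputable def windingArea (C : ℝ → ℂ) : ENNReal :=
  ∫⁻ x : ℂ, ((windingNumber C x).natAbs : ENNReal)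

/-- The parameter square `[0,1]²` of a homotopy. -/
def square : Set (ℝ × ℝ) := Icc 0 1 ×ˢ Icc 0 1

/-- `H` is a homotopy from `C₁` to `C₂` through closed curves based at `p₀`. -/
def IsHomotopy (p₀ : ℂ) (C₁ C₂ : ℝ → ℂ) (H : ℝ × ℝ → ℂ) : Prop :=
  ContinuousOn H square ∧ (∀ t ∈ Icc (0 : ℝ) 1, H (0, t) = C₁ t ∧ H (1, t) = C₂ t) ∧
    ∀ s ∈ Icc (0 : ℝ) 1, H (s, 0) = p₀ ∧ H (s, 1) = p₀

/-- `H` is piecewise differentiable: the parameter square is the union of finitely many closed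
pieces on each of which `H` is differentiable. -/
def IsPiecewiseDifferentiable (H : ℝ × ℝ → ℂ) : Prop :=
  ∃ (n : ℕ) (P : Fin n → Set (ℝ × ℝ)), (∀ i, IsClosed (P i)) ∧ ⋃ i, P i = square ∧
    ∀ i, DifferentiableOn ℝ H (P i)

/-- The number of connected components of the preimage of `x` in the parameter square. -/
noncomputable def sweepCount (H : ℝ × ℝ → ℂ) (x : ℂ) : ℕ∞ :=
  ENat.card (ConnectedComponents {q : ℝ × ℝ // q ∈ square ∧ H q = x})

/-- The homotopy area: the integral of `sweepCount H` over the plane. -/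
noncomputable def homotopyArea (H : ℝ × ℝ → ℂ) : ENNReal :=
  ∫⁻ x : ℂ, (sweepCount H x : ENNReal)

/-- The minimum homotopy area between two closed curves based at `p₀`. -/
noncomputable def minHomotopyArea (p₀ : ℂ) (C₁ C₂ : ℝ → ℂ) : ENNReal :=
  ⨅ (H : ℝ × ℝ → ℂ) (_ : IsHomotopy p₀ C₁ C₂ H ∧ IsPiecewiseDifferentiable H), homotopyArea H

/-- The closed unit disk. -/
def disk : Set ℂ := Metric.closedBall 0 1

/-- `F` is a (`C¹`) immersion of the closed unit disk into the plane. -/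
def IsDiskImmersion (F : ℂ → ℂ) : Prop :=
  ContDiffOn ℝ 1 F disk ∧ ∀ z ∈ disk, Function.Injective (fderivWithin ℝ F disk z)

/-- The restriction of `F` to the boundary circle is the curve `C`, where `C` may parametrize the
circle through any homeomorphism `φ` of it. -/
def IsBoundaryCurve (F : ℂ → ℂ) (φ : Circle ≃ₜ Circle) (C : ℝ → ℂ) : Prop :=
  ∀ t ∈ Icc (0 : ℝ) 1, C t = F (φ (Circle.exp (2 * Real.pi * t)))

/-- `C` is the boundary curve of an immersed disk. -/
def BoundsImmersedDisk (C : ℝ → ℂ) : Prop :=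
  ∃ (F : ℂ → ℂ) (φ : Circle ≃ₜ Circle), IsDiskImmersion F ∧ IsBoundaryCurve F φ C

/-- `C` is a regular normal curve that bounds an immersed disk. -/
def IsRegularSelfOverlapping (C : ℝ → ℂ) : Prop :=
  IsRegularCurve C ∧ IsNormalCurve C ∧ BoundsImmersedDisk C

/-- Self-overlapping curves: a regular normal curve has to bound an immersed disk; any other curve
has to be a uniform limit of regular normal curves that bound immersed disks. -/
def IsSelfOverlapping (C : ℝ → ℂ) : Prop :=
  IsRegularSelfOverlapping C ∨
    (¬ (IsRegularCurve C ∧ IsNormalCurve C) ∧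
      ∀ ε > (0 : ℝ), ∃ C' : ℝ → ℂ, IsRegularSelfOverlapping C' ∧
        ∀ t ∈ Icc (0 : ℝ) 1, dist (C' t) (C t) < ε)

/-- The homotopy that contracts an immersed disk linearly: the straight-line contraction of the
disk to the boundary point `φ 1`, restricted to the boundary circle and followed by `F`. -/
noncomputable def linearContraction (F : ℂ → ℂ) (φ : Circle ≃ₜ Circle) : ℝ × ℝ → ℂ :=
  fun q => F ((1 - (q.1 : ℂ)) * φ (Circle.exp (2 * Real.pi * q.2)) + (q.1 : ℂ) * φ 1)

/-- The winding number is well defined. -/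
theorem HasWindingNumber.unique {C : ℝ → ℂ} {x : ℂ} {m n : ℤ} (hm : HasWindingNumber C x m)
    (hn : HasWindingNumber C x n) : m = n := by
  obtain ⟨L, hLc, hL, hL'⟩ := hm
  obtain ⟨K, hKc, hK, hK'⟩ := hn
  have hne : (2 * Real.pi * Complex.I : ℂ) ≠ 0 := Complex.two_pi_I_ne_zero
  have key : ∀ t ∈ Icc (0 : ℝ) 1, ∃ k : ℤ, L t - K t = k * (2 * Real.pi * Complex.I) := by
    intro t ht
    obtain ⟨k, hk⟩ := Complex.exp_eq_exp_iff_exists_int.1 ((hL t ht).trans (hK t ht).symm)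
    exact ⟨k, by rw [hk]; ring⟩
  have hcont : ContinuousOn (fun t => ((L t - K t) / (2 * Real.pi * Complex.I)).re)
      (Icc (0 : ℝ) 1) :=
    Complex.continuous_re.comp_continuousOn ((hLc.sub hKc).div_const _)
  have hconn : IsPreconnected
      ((fun t => ((L t - K t) / (2 * Real.pi * Complex.I)).re) '' Icc (0 : ℝ) 1) :=
    isPreconnected_Icc.image _ hcont
  have hsub : ((fun t => ((L t - K t) / (2 * Real.pi * Complex.I)).re) '' Icc (0 : ℝ) 1) ⊆
      range (fun k : ℤ => (k : ℝ)) := by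
    rintro _ ⟨t, ht, rfl⟩
    obtain ⟨k, hk⟩ := key t ht
    refine ⟨k, ?_⟩
    simp only [hk]
    rw [mul_div_cancel_right₀ _ hne]
    simp
  have htd : IsTotallyDisconnected (range (fun k : ℤ => (k : ℝ))) :=
    (countable_range _).isTotallyDisconnected
  have h01 := htd _ hsub hconn ⟨1, by simp, rfl⟩ ⟨0, by simp, rfl⟩
  obtain ⟨a, ha⟩ := key 1 (by simp)
  obtain ⟨b, hb⟩ := key 0 (by simp)
  simp only [ha, hb] at h01
  rw [mul_div_cancel_right₀ _ hne, mul_div_cancel_right₀ _ hne] at h01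
  have hab : a = b := by simpa using h01
  have : (m : ℂ) * (2 * Real.pi * Complex.I) = n * (2 * Real.pi * Complex.I) := by
    rw [← hL', ← hK']
    subst hab
    linear_combination ha - hb
  exact_mod_cast mul_right_cancel₀ hne this

theorem HasWindingNumber.windingNumber_eq {C : ℝ → ℂ} {x : ℂ} {n : ℤ}
    (h : HasWindingNumber C x n) : windingNumber C x = n := by
  have hex : ∃ n : ℤ, HasWindingNumber C x n := ⟨n, h⟩
  rw [windingNumber, dif_pos hex]
  exact hex.choose_spec.unique h

end HomotopyArea

/-!
The two inequalities between the winding area and the minimum homotopy area have different sources.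

*Lower bound.* Let `H` contract `C` to its base point. Sard's theorem, applied on each of the closed
pieces on which `H` is differentiable, shows that almost every `x` is a regular value
(`ae_regular`): its fibre is a finite set of interior points at which `H` has an invertible
derivative, so that the components of the fibre are its points. Near each of them `H - x` looks like
a real-linear isomorphism of polar coordinates on the square, which is a deformation of the identity
or of complex conjugation. Dividing these local models out of `H - x` (`exists_factor_zeros`) leaves
a function without zeros, which has a continuous logarithm and does not contribute to the winding
number. Hence `windingNumber C x` is a sum of signs, one for each point of the fibre
(`exists_windingNumber_eq_sum`), and its absolute value is at most the number of these points.

*Immersed disks.* If `C` is the boundary curve of an immersion `F` of the disk, the same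
factorization on the disk has equal signs at all points, since an immersion of a connected set has
one orientation, and a homeomorphism of the circle has degree `1` or `-1`. So `|windingNumber C x|`
is the number of points of the disk over `x` (`natAbs_windingNumber_eq_encard`). The linear
contraction passes each interior point of the disk exactly once, so its area is the winding area. It
is piecewise differentiable although `φ` is merely a homeomorphism: `F` is a local embedding, so `φ`
inherits the differentiability of `C`.

*Limits of such curves.* A limit `C` of boundary curves `C'` is contracted by pushing it to a nearby
`C'` and contracting `C'` through its disk. The number of sheets of this homotopy is the right one
away from `C` (`exists_contraction_of_limit`), but near `C` it is out of control, since the lengths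
of the curves `C'` need not be bounded. The excess is removed by composing the homotopy with a map
`gridMap` that collapses the plane to the lines of a grid of mesh `δ`, except that it stretches
tiny squares around lattice points over the cells of the grid. If these squares avoid `C`, the
composed homotopy covers almost every point of a cell at most as often as `C` winds around the
corresponding lattice point (`ae_sweepCount_gridMap_le`). It contracts the image of `C` under the
collapse, and a straight-line homotopy between `C` and that image sweeps an area of order `δ` times
the lengths of the two curves (`exists_measurable_ge_encard_linearHomotopy`). The collapse may
stretch `C` a lot, but averaged over the origin of the grid it does so by a bounded factor only, as
each staircase climbs one step per period; likewise the average of the weighted sum of the winding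
numbers around the lattice points is at most the winding area. So for a suitable origin
(`exists_origin`) the total area exceeds the winding area by an error of order `δ`.
-/

namespace HomotopyArea

open Filter Topology Asymptotics ComplexConjugate

/-! ### Continuous logarithms -/

/-- A nonvanishing continuous function on a retract of a normed space has a continuous logarithm. -/
theorem exists_continuousOn_log {E : Type*} [NormedAddCommGroup E] [NormedSpace ℝ E] {S : Set E}
    {R : E → E} (hR : Continuous R) (hRS : ∀ q, R q ∈ S) (hid : ∀ q ∈ S, R q = q) {g : E → ℂ}
    (hg : ContinuousOn g S) (h0 : ∀ q ∈ S, g q ≠ 0) :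
    ∃ G : E → ℂ, ContinuousOn G S ∧ ∀ q ∈ S, Complex.exp (G q) = g q := by
  have hu : IsSimplyConnected (univ : Set E) := by
    have : ContractibleSpace (univ : Set E) := convex_univ.contractibleSpace univ_nonempty
    exact (inferInstance : SimplyConnectedSpace (univ : Set E))
  obtain ⟨G, hG, hG'⟩ := Complex.exists_continuousOn_eqOn_exp_comp hu isOpen_univ
    (g := g ∘ R) ((hg.comp_continuous hR hRS).continuousOn) (by
      rintro ⟨q, -, hq⟩
      exact h0 _ (hRS q) hq)
  refine ⟨G, hG.mono (subset_univ _), fun q hq => ?_⟩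
  have := hG' (mem_univ q)
  simpa [hid q hq] using this

theorem exists_continuousOn_log_Icc {γ : ℝ → ℂ} (hγ : ContinuousOn γ (Icc 0 1))
    (h0 : ∀ t ∈ Icc (0 : ℝ) 1, γ t ≠ 0) :
    ∃ L : ℝ → ℂ, ContinuousOn L (Icc 0 1) ∧ ∀ t ∈ Icc (0 : ℝ) 1, Complex.exp (L t) = γ t :=
  exists_continuousOn_log (R := fun t => (projIcc (0 : ℝ) 1 zero_le_one t : ℝ))
    (continuous_subtype_val.comp continuous_projIcc) (fun q => (projIcc (0 : ℝ) 1 _ q).2)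
    (fun q hq => by simp [projIcc_of_mem zero_le_one hq]) hγ h0

/-! ### Winding numbers -/

theorem hasWindingNumber_sub_iff {C : ℝ → ℂ} {x : ℂ} {n : ℤ} :
    HasWindingNumber (fun t => C t - x) 0 n ↔ HasWindingNumber C x n := by
  simp [HasWindingNumber]

theorem HasWindingNumber.congr {C C' : ℝ → ℂ} {x : ℂ} {n : ℤ} (h : HasWindingNumber C x n)
    (hCC : ∀ t ∈ Icc (0 : ℝ) 1, C t = C' t) : HasWindingNumber C' x n := by
  obtain ⟨L, h1, h2, h3⟩ := h
  exact ⟨L, h1, fun t ht => by rw [h2 t ht, hCC t ht], h3⟩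

theorem HasWindingNumber.mul {γ γ' : ℝ → ℂ} {m n : ℤ} (h : HasWindingNumber γ 0 m)
    (h' : HasWindingNumber γ' 0 n) : HasWindingNumber (fun t => γ t * γ' t) 0 (m + n) := by
  obtain ⟨L, h1, h2, h3⟩ := h
  obtain ⟨K, k1, k2, k3⟩ := h'
  refine ⟨fun t => L t + K t, h1.add k1, fun t ht => ?_, ?_⟩
  · rw [Complex.exp_add, h2 t ht, k2 t ht]; ring
  · push_cast
    linear_combination h3 + k3

theorem HasWindingNumber.conj {γ : ℝ → ℂ} {n : ℤ} (h : HasWindingNumber γ 0 n) :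
    HasWindingNumber (fun t => conj (γ t)) 0 (-n) := by
  obtain ⟨L, h1, h2, h3⟩ := h
  refine ⟨fun t => conj (L t), Complex.continuous_conj.comp_continuousOn h1, fun t ht => ?_, ?_⟩
  · rw [Complex.exp_conj, h2 t ht]; simp
  · rw [← map_sub, h3]
    simp [Complex.conj_ofReal, map_ofNat]

theorem hasWindingNumber_exp {G : ℝ → ℂ} (hG : ContinuousOn G (Icc 0 1)) (h : G 0 = G 1) :
    HasWindingNumber (fun t => Complex.exp (G t)) 0 0 :=
  ⟨G, hG, by simp, by simp [h]⟩

theorem hasWindingNumber_one : HasWindingNumber (fun _ => 1) 0 0 := by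
  simpa using hasWindingNumber_exp (G := fun _ => 0) continuousOn_const rfl

theorem hasWindingNumber_prod {ι : Type*} {γ : ι → ℝ → ℂ} {n : ι → ℤ} (s : Finset ι)
    (h : ∀ i ∈ s, HasWindingNumber (γ i) 0 (n i)) :
    HasWindingNumber (fun t => ∏ i ∈ s, γ i t) 0 (∑ i ∈ s, n i) := by
  classical
  induction s using Finset.induction_on with
  | empty => simpa using hasWindingNumber_one
  | insert a s ha ih =>
    simp only [Finset.prod_insert ha, Finset.sum_insert ha]
    exact (h a (by simp)).mul (ih fun i hi => h i (by simp [hi]))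

theorem exists_hasWindingNumber {C : ℝ → ℂ} (hC : IsClosedCurve C) {x : ℂ}
    (hx : ∀ t ∈ Icc (0 : ℝ) 1, C t ≠ x) : ∃ n, HasWindingNumber C x n := by
  obtain ⟨L, h1, h2⟩ := exists_continuousOn_log_Icc (γ := fun t => C t - x)
    (hC.1.sub continuousOn_const) (fun t ht => sub_ne_zero.2 (hx t ht))
  have : Complex.exp (L 1) = Complex.exp (L 0) := by
    rw [h2 1 (by simp), h2 0 (by simp), hC.2]
  obtain ⟨n, hn⟩ := Complex.exp_eq_exp_iff_exists_int.1 this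
  exact ⟨n, L, h1, h2, by rw [hn]; ring⟩

theorem hasWindingNumber_windingNumber {C : ℝ → ℂ} (hC : IsClosedCurve C) {x : ℂ}
    (hx : ∀ t ∈ Icc (0 : ℝ) 1, C t ≠ x) : HasWindingNumber C x (windingNumber C x) := by
  obtain ⟨n, hn⟩ := exists_hasWindingNumber hC hx
  rwa [hn.windingNumber_eq]

theorem HasWindingNumber.ne {C : ℝ → ℂ} {x : ℂ} {n : ℤ} (h : HasWindingNumber C x n) :
    ∀ t ∈ Icc (0 : ℝ) 1, C t ≠ x := by
  obtain ⟨L, -, h2, -⟩ := h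
  intro t ht h
  have := h2 t ht
  rw [h, sub_self] at this
  exact Complex.exp_ne_zero _ this

theorem windingNumber_eq_zero_of_mem {C : ℝ → ℂ} {x : ℂ} {t : ℝ} (ht : t ∈ Icc (0 : ℝ) 1)
    (h : C t = x) : windingNumber C x = 0 := by
  rw [windingNumber, dif_neg]
  rintro ⟨n, hn⟩
  exact hn.ne t ht h

/-- Rouché's principle: a closed curve that is, at each parameter, closer to `γ` than `γ` is to the
origin has the same winding number around the origin. -/
theorem HasWindingNumber.of_norm_sub_lt {γ γ' : ℝ → ℂ} {n : ℤ} (h : HasWindingNumber γ 0 n)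
    (hγ : IsClosedCurve γ) (hγ' : IsClosedCurve γ')
    (hlt : ∀ t ∈ Icc (0 : ℝ) 1, ‖γ' t - γ t‖ < ‖γ t‖) : HasWindingNumber γ' 0 n := by
  have h0 : ∀ t ∈ Icc (0 : ℝ) 1, γ t ≠ 0 := h.ne
  have hs : ∀ t ∈ Icc (0 : ℝ) 1, 1 + (γ' t - γ t) / γ t ∈ Complex.slitPlane := fun t ht => by
    apply Complex.mem_slitPlane_of_norm_lt_one
    rw [norm_div, div_lt_one (norm_pos_iff.2 (h0 t ht))]
    exact hlt t ht
  have hq : HasWindingNumber (fun t => 1 + (γ' t - γ t) / γ t) 0 0 := by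
    refine ⟨fun t => Complex.log (1 + (γ' t - γ t) / γ t), ?_, fun t ht => ?_, ?_⟩
    · exact (continuousOn_const.add ((hγ'.1.sub hγ.1).div hγ.1 h0)).clog hs
    · rw [Complex.exp_log (Complex.slitPlane_ne_zero (hs t ht)), sub_zero]
    · simp [hγ.2, hγ'.2]
  have := h.mul hq
  rw [add_zero] at this
  refine this.congr fun t ht => ?_
  have := h0 t ht
  field_simp
  ring

/-- The standard parametrization of the unit circle. -/
noncomputable def unitLoop (t : ℝ) : ℂ := Circle.exp (2 * Real.pi * t)

theorem unitLoop_eq (t : ℝ) : unitLoop t = Complex.exp (t * (2 * Real.pi * Complex.I)) := by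
  rw [unitLoop, Circle.coe_exp]
  congr 1
  push_cast
  ring

theorem norm_unitLoop (t : ℝ) : ‖unitLoop t‖ = 1 := Circle.norm_coe _

theorem continuous_unitLoop : Continuous unitLoop := by
  unfold unitLoop
  fun_prop

@[simp] theorem unitLoop_zero : unitLoop 0 = 1 := by simp [unitLoop]

@[simp] theorem unitLoop_one : unitLoop 1 = 1 := by simp [unitLoop_eq]

theorem hasWindingNumber_unitLoop : HasWindingNumber unitLoop 0 1 :=
  ⟨fun t => t * (2 * Real.pi * Complex.I), by fun_prop,
    fun t _ => by rw [unitLoop_eq, sub_zero], by simp⟩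

theorem HasWindingNumber.sub_of_norm_lt_one {u : ℝ → ℂ} {n : ℤ} (h : HasWindingNumber u 0 n)
    (hu : IsClosedCurve u) (h1 : ∀ t ∈ Icc (0 : ℝ) 1, ‖u t‖ = 1) {z : ℂ} (hz : ‖z‖ < 1) :
    HasWindingNumber (fun t => u t - z) 0 n := by
  refine h.of_norm_sub_lt hu ⟨hu.1.sub continuousOn_const, by simp [hu.2]⟩ fun t ht => ?_
  simpa [h1 t ht] using hz

/-- The exponential of a path can only be constant if the path returns to its start. -/
theorem eq_of_exp_eq_const {γ : ℝ → ℂ} (hγ : ContinuousOn γ (Icc 0 1)) {c : ℂ}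
    (h : ∀ t ∈ Icc (0 : ℝ) 1, Complex.exp (γ t) = c) : γ 0 = γ 1 := by
  have h01 : Complex.exp (γ 1) = Complex.exp (γ 0) := by
    rw [h 1 (by simp), h 0 (by simp)]
  obtain ⟨n, hn⟩ := Complex.exp_eq_exp_iff_exists_int.1 h01
  have hw : HasWindingNumber (fun _ => c) 0 n :=
    ⟨γ, hγ, fun t ht => by rw [h t ht, sub_zero], by rw [hn]; ring⟩
  have hw0 : HasWindingNumber (fun _ => c) 0 0 :=
    ⟨fun _ => γ 0, continuousOn_const, fun t _ => by rw [h 0 (by simp), sub_zero], by simp⟩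
  have := hw.unique hw0
  subst this
  simpa using hn.symm

/-! ### Removing nondegenerate zeros -/

/-- A zero of `f` near which `f` looks like an invertible real-linear function of `D` can be divided
out, up to a modification of the quotient near that zero.  There `f / D` stays in a ball around `κ`
that does not contain `0`, so it may be deformed to the constant `κ` by convex combinations. -/
theorem exists_divide_zero {E : Type*} [MetricSpace E] {S : Set E} {f D : E → ℂ}
    (hf : ContinuousOn f S) (hD : ContinuousOn D S) {z : E}
    (hD0 : ∀ q ∈ S, D q = 0 ↔ q = z) {κ μ : ℂ} (hκμ : ‖μ‖ < ‖κ‖)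
    (ho : (fun q => f q - (κ * D q + μ * conj (D q))) =o[𝓝[S] z] D) {ρ : ℝ} (hρ : 0 < ρ) :
    ∃ f₁ : E → ℂ, ContinuousOn f₁ S ∧ f₁ z ≠ 0 ∧ (∀ q ∈ S, q ≠ z → (f₁ q = 0 ↔ f q = 0)) ∧
      ∀ q ∈ S, ρ ≤ dist q z → f q = f₁ q * D q := by
  classical
  have hε : 0 < (‖κ‖ - ‖μ‖) / 2 := by linarith
  obtain ⟨r₀, hr₀, hball⟩ := Metric.mem_nhdsWithin_iff.1 (ho.bound hε)
  set r := min r₀ ρ with hr_def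
  have hr : 0 < r := lt_min hr₀ hρ
  have hk : ∀ q ∈ S, q ≠ z → dist q z < r → ‖f q / D q - κ‖ < ‖κ‖ := by
    intro q hq hqz hqr
    have hDq : D q ≠ 0 := fun h => hqz ((hD0 q hq).1 h)
    have hDq' : 0 < ‖D q‖ := norm_pos_iff.2 hDq
    have h1 : ‖f q - (κ * D q + μ * conj (D q))‖ ≤ (‖κ‖ - ‖μ‖) / 2 * ‖D q‖ :=
      hball ⟨Metric.mem_ball.2 (hqr.trans_le (min_le_left _ _)), hq⟩
    have h2 : ‖f q - κ * D q‖ ≤ ((‖κ‖ - ‖μ‖) / 2 + ‖μ‖) * ‖D q‖ := by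
      calc ‖f q - κ * D q‖ = ‖(f q - (κ * D q + μ * conj (D q))) + μ * conj (D q)‖ := by ring_nf
        _ ≤ ‖f q - (κ * D q + μ * conj (D q))‖ + ‖μ * conj (D q)‖ := norm_add_le _ _
        _ ≤ _ := by
          rw [norm_mul, RCLike.norm_conj]
          linarith
    have h3 : f q / D q - κ = (f q - κ * D q) / D q := by field_simp
    rw [h3, norm_div, div_lt_iff₀ hDq']
    nlinarith
  set χ : E → ℝ := fun q => max 0 (min 1 (2 - 2 * (dist q z / r))) with hχ
  have hχc : Continuous χ := by fun_prop
  have hχ0 : ∀ q, 0 ≤ χ q := fun q => le_max_left _ _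
  have hχ1 : ∀ q, χ q ≤ 1 := fun q => max_le zero_le_one (min_le_left _ _)
  have hχfar : ∀ q, r ≤ dist q z → χ q = 0 := fun q hq => by
    have : 1 ≤ dist q z / r := (one_le_div hr).2 hq
    exact max_eq_left ((min_le_right _ _).trans (by linarith))
  have hχnear : ∀ q, dist q z < r / 2 → χ q = 1 := fun q hq => by
    have : dist q z / r ≤ 1 / 2 := by rw [div_le_iff₀ hr]; linarith
    simp only [hχ]
    rw [min_eq_left (by linarith), max_eq_right zero_le_one]
  refine ⟨fun q => if q = z then κ else (1 - χ q) * (f q / D q) + χ q * κ, ?_, ?_, ?_, ?_⟩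
  · intro q hq
    by_cases hqz : q = z
    · subst hqz
      have : (fun q' => if q' = q then κ else (1 - χ q') * (f q' / D q') + χ q' * κ)
          =ᶠ[𝓝[S] q] fun _ => κ := by
        filter_upwards [mem_nhdsWithin_of_mem_nhds (Metric.ball_mem_nhds q (half_pos hr))] with p hp
        rw [hχnear p hp]
        simp
      exact (continuousWithinAt_const.congr_of_eventuallyEq this (by simp))
    · have hDq : D q ≠ 0 := fun h => hqz ((hD0 q hq).1 h)
      have : (fun q' => if q' = z then κ else (1 - χ q') * (f q' / D q') + χ q' * κ)
          =ᶠ[𝓝[S] q] fun q' => (1 - χ q') * (f q' / D q') + χ q' * κ := by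
        filter_upwards [mem_nhdsWithin_of_mem_nhds (isOpen_ne.mem_nhds hqz)] with p hp
        exact if_neg hp
      refine ContinuousWithinAt.congr_of_eventuallyEq ?_ this (by simp [hqz])
      have hc : ContinuousWithinAt (fun q => (χ q : ℂ)) S q :=
        (Complex.continuous_ofReal.comp hχc).continuousWithinAt
      exact ((continuousWithinAt_const.sub hc).mul ((hf q hq).div (hD q hq) hDq)).add
        (hc.mul continuousWithinAt_const)
  · simp only [if_true]
    exact norm_pos_iff.1 ((norm_nonneg _).trans_lt hκμ)
  · intro q hq hqz
    have hDq : D q ≠ 0 := fun h => hqz ((hD0 q hq).1 h)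
    simp only [if_neg hqz]
    rcases lt_or_ge (dist q z) r with hlt | hge
    · have hlt' := hk q hq hqz hlt
      have hne : f q ≠ 0 := by
        intro h
        simp [h] at hlt'
      refine iff_of_false (fun h0 => ?_) hne
      have h1 : κ = (1 - χ q) * (κ - f q / D q) := by linear_combination h0
      have h2 : ‖κ‖ = (1 - χ q) * ‖f q / D q - κ‖ := by
        conv_lhs => rw [h1]
        rw [norm_mul, norm_sub_rev κ]
        congr 1
        rw [← Complex.ofReal_one, ← Complex.ofReal_sub, Complex.norm_real, Real.norm_eq_abs,
          abs_of_nonneg (by linarith [hχ1 q])]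
      have h3 : (1 - χ q) * ‖f q / D q - κ‖ ≤ 1 * ‖f q / D q - κ‖ :=
        mul_le_mul_of_nonneg_right (by linarith [hχ0 q]) (norm_nonneg _)
      linarith
    · simp [hχfar q hge, hDq]
  · intro q hq hqρ
    have hqz : q ≠ z := by
      rintro rfl
      simp at hqρ
      linarith
    have hDq : D q ≠ 0 := fun h => hqz ((hD0 q hq).1 h)
    simp only [if_neg hqz, hχfar q ((min_le_right _ _).trans hqρ)]
    field_simp
    simp

/-- A function with finitely many nondegenerate zeros factors, away from its zeros, into a
nonvanishing function and the local models `D z` of the zeros. -/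
theorem exists_factor_zeros {E : Type*} [MetricSpace E] {S : Set E} {D : E → E → ℂ}
    {ρ : ℝ} (hρ : 0 < ρ) (Z : Finset E) :
    ∀ f : E → ℂ, ContinuousOn f S → (∀ z ∈ Z, z ∈ S) → (∀ q ∈ S, f q = 0 ↔ q ∈ Z) →
    (∀ z ∈ Z, ContinuousOn (D z) S ∧ (∀ q ∈ S, D z q = 0 ↔ q = z) ∧ ∃ κ μ : ℂ, ‖μ‖ < ‖κ‖ ∧
      (fun q => f q - (κ * D z q + μ * conj (D z q))) =o[𝓝[S] z] D z) →
    ∃ g : E → ℂ, ContinuousOn g S ∧ (∀ q ∈ S, g q ≠ 0) ∧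
      ∀ q ∈ S, (∀ z ∈ Z, ρ ≤ dist q z) → f q = g q * ∏ z ∈ Z, D z q := by
  classical
  induction Z using Finset.induction_on with
  | empty =>
    intro f hf _ h0 _
    exact ⟨f, hf, fun q hq h => by simpa using (h0 q hq).1 h, fun q _ _ => by simp⟩
  | insert z Z hz ih =>
    intro f hf hZS h0 hD
    obtain ⟨hDc, hD0, κ, μ, hκμ, ho⟩ := hD z (by simp)
    obtain ⟨ρ', hρ', hle, hfar⟩ : ∃ ρ' > 0, ρ' ≤ ρ ∧ ∀ y ∈ Z, ρ' < dist y z := by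
      have hfin : ∀ᶠ r in 𝓝[>] (0 : ℝ), ∀ y ∈ Z, r < dist y z := by
        rw [Filter.eventually_all_finset]
        intro y hy
        have : 0 < dist y z := dist_pos.2 (by rintro rfl; exact hz hy)
        exact mem_nhdsWithin_of_mem_nhds (Iio_mem_nhds this)
      have h2 : ∀ᶠ r in 𝓝[>] (0 : ℝ), r ≤ ρ :=
        mem_nhdsWithin_of_mem_nhds (Iic_mem_nhds hρ)
      obtain ⟨r, ⟨h1, h2⟩, h3⟩ := ((hfin.and h2).and self_mem_nhdsWithin).exists
      exact ⟨r, h3, h2, h1⟩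
    obtain ⟨f₁, hf₁, hf₁z, hf₁0, hfac⟩ := exists_divide_zero hf hDc hD0 hκμ ho hρ'
    have hf₁' : ∀ q ∈ S, f₁ q = 0 ↔ q ∈ Z := by
      intro q hq
      by_cases hqz : q = z
      · subst hqz
        exact iff_of_false hf₁z hz
      · rw [hf₁0 q hq hqz, h0 q hq]
        simp [hqz]
    obtain ⟨g, hg, hg0, hgf⟩ := ih f₁ hf₁ (fun y hy => hZS y (by simp [hy])) hf₁' (by
      intro y hy
      obtain ⟨hyc, hy0, κ', μ', hκμ', ho'⟩ := hD y (by simp [hy])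
      have hyS : y ∈ S := hZS y (by simp [hy])
      have hyz : y ≠ z := by rintro rfl; exact hz hy
      have hc : D z y ≠ 0 := fun h => hyz ((hD0 y hyS).1 h)
      refine ⟨hyc, hy0, κ' / D z y, μ' / D z y, ?_, ?_⟩
      · rw [norm_div, norm_div]
        exact div_lt_div_of_pos_right hκμ' (norm_pos_iff.2 hc)
      · have hev : ∀ᶠ q in 𝓝[S] y, f q = f₁ q * D z q ∧ D z q ≠ 0 := by
          have h1 : ∀ᶠ q in 𝓝[S] y, ρ' < dist q z :=
            mem_nhdsWithin_of_mem_nhds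
              ((isOpen_lt continuous_const (continuous_id.dist continuous_const)).mem_nhds
                (hfar y hy))
          filter_upwards [h1, self_mem_nhdsWithin] with q hq hqS
          refine ⟨hfac q hqS hq.le, fun h => ?_⟩
          rw [(hD0 q hqS).1 h, dist_self] at hq
          linarith
        have hinv : Tendsto (fun q => (D z q)⁻¹) (𝓝[S] y) (𝓝 (D z y)⁻¹) :=
          (hDc y hyS).inv₀ hc
        have t1 : (fun q => (D z q)⁻¹ * (f q - (κ' * D y q + μ' * conj (D y q))))
            =o[𝓝[S] y] D y := by
          have := (hinv.isBigO_one ℂ).mul_isLittleO ho'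
          simpa using this
        have hbig : (fun q => κ' * D y q + μ' * conj (D y q)) =O[𝓝[S] y] D y := by
          refine IsBigO.add ((isBigO_refl _ _).const_mul_left _) (IsBigO.const_mul_left ?_ _)
          exact IsBigO.of_bound 1 (Eventually.of_forall fun q => by simp)
        have t2 : (fun q => ((D z q)⁻¹ - (D z y)⁻¹) * (κ' * D y q + μ' * conj (D y q)))
            =o[𝓝[S] y] D y := by
          have h0 : (fun q => (D z q)⁻¹ - (D z y)⁻¹) =o[𝓝[S] y] fun _ => (1 : ℂ) := by
            rw [isLittleO_one_iff]
            simpa using hinv.sub_const (D z y)⁻¹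
          simpa using h0.mul_isBigO hbig
        refine (t1.add t2).congr' ?_ EventuallyEq.rfl
        filter_upwards [hev] with q hq
        rw [hq.1]
        have := hq.2
        field_simp
        ring)
    refine ⟨g, hg, hg0, fun q hq hqρ => ?_⟩
    rw [Finset.prod_insert hz, hfac q hq (hle.trans (hqρ z (by simp))),
      hgf q hq fun y hy => hqρ y (by simp [hy])]
    ring

/-! ### Real-linear maps of the complex plane -/

/-- The complex-linear coefficient of a real-linear map `T w = κ w + μ conj w`. -/
noncomputable def linCoeff (T : ℂ →L[ℝ] ℂ) : ℂ := (T 1 - Complex.I * T Complex.I) / 2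

/-- The conjugate-linear coefficient of a real-linear map `T w = κ w + μ conj w`. -/
noncomputable def conjCoeff (T : ℂ →L[ℝ] ℂ) : ℂ := (T 1 + Complex.I * T Complex.I) / 2

theorem apply_eq_linCoeff (T : ℂ →L[ℝ] ℂ) (w : ℂ) :
    T w = linCoeff T * w + conjCoeff T * conj w := by
  have h : T w = w.re * T 1 + w.im * T Complex.I := by
    conv_lhs => rw [show w = w.re • (1 : ℂ) + w.im • Complex.I by simp]
    rw [map_add, map_smul, map_smul]
    simp
  have hc : conj w = w.re - w.im * Complex.I := by
    apply Complex.ext <;> simp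
  have hw : w = w.re + w.im * Complex.I := (Complex.re_add_im w).symm
  rw [h, hc, linCoeff, conjCoeff]
  linear_combination ((w.im : ℂ) * T Complex.I) * Complex.I_sq -
    (T 1 - Complex.I * T Complex.I) / 2 * hw

/-- The determinant of `T` is `‖linCoeff T‖ ^ 2 - ‖conjCoeff T‖ ^ 2`. -/
theorem norm_linCoeff_ne_of_injective {T : ℂ →L[ℝ] ℂ} (hT : Function.Injective T) :
    ‖linCoeff T‖ ≠ ‖conjCoeff T‖ := by
  intro h
  set κ := linCoeff T with hκ
  set μ := conjCoeff T with hμ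
  have key : ∀ w : ℂ, κ * w + μ * conj w = 0 → w = 0 := fun w hw => by
    apply hT
    rw [apply_eq_linCoeff T w, hw, map_zero]
  by_cases h0 : κ = 0
  · have h1 : μ = 0 := by rw [h0, norm_zero] at h; exact norm_eq_zero.1 h.symm
    simpa using key 1 (by simp [h0, h1])
    -- Otherwise a unit complex number `w` with `w ^ 2 = - μ / κ` lies in the kernel.
  · obtain ⟨w, hw⟩ := IsAlgClosed.exists_pow_nat_eq (-μ / κ) (n := 2) two_pos
    have hnorm : ‖w‖ ^ 2 = 1 := by
      rw [← norm_pow, hw, norm_div, norm_neg, h, div_self]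
      rw [← h]
      exact norm_ne_zero_iff.2 h0
    have hcw : w * conj w = 1 := by
      rw [Complex.mul_conj, Complex.normSq_eq_norm_sq, hnorm, Complex.ofReal_one]
    have hw0 : w ≠ 0 := by rintro rfl; simp at hcw
    refine hw0 (key w ?_)
    have : w * (κ * w + μ * conj w) = 0 := by
      have : κ * w ^ 2 = -μ := by rw [hw]; field_simp
      linear_combination this + μ * hcw
    exact (mul_eq_zero.1 this).resolve_left hw0

/-- If `H` and `P` are differentiable at `q₀` with invertible derivatives, then near `q₀` the
function `H` looks like an invertible linear function of `P`. -/
theorem exists_linear_isLittleO {E : Type*} [NormedAddCommGroup E] [NormedSpace ℝ E]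
    [FiniteDimensional ℝ E] (hE : Module.finrank ℝ E = 2) {H P : E → ℂ} {A B : E →L[ℝ] ℂ}
    {S : Set E} {q₀ : E}
    (hH : HasFDerivWithinAt H A S q₀) (hA : Function.Injective A)
    (hP : HasFDerivWithinAt P B S q₀) (hB : Function.Injective B) :
    ∃ T : ℂ →L[ℝ] ℂ, Function.Injective T ∧
      (fun q => H q - H q₀ - T (P q - P q₀)) =o[𝓝[S] q₀] fun q => P q - P q₀ := by
  let e : E ≃ₗ[ℝ] ℂ := LinearEquiv.ofInjectiveOfFinrankEq B.toLinearMap hB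
    (by rw [hE, Complex.finrank_real_complex])
  have he : ∀ v, e v = B v := fun v => rfl
  let T : ℂ →L[ℝ] ℂ := LinearMap.toContinuousLinearMap (A.toLinearMap ∘ₗ e.symm.toLinearMap)
  have hTB : ∀ v, T (B v) = A v := fun v => by
    change A (e.symm (B v)) = A v
    rw [← he, e.symm_apply_apply]
  refine ⟨T, hA.comp e.symm.injective, ?_⟩
  have hAo := hH.isLittleO
  have hBo := hP.isLittleO
  have hbig : (fun q => q - q₀) =O[𝓝[S] q₀] fun q => P q - P q₀ := by
    obtain ⟨K, hK⟩ : ∃ K, AntilipschitzWith K B :=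
      let ⟨K, _, hK⟩ := LinearMap.exists_antilipschitzWith B.toLinearMap
        (LinearMap.ker_eq_bot.2 hB)
      ⟨K, hK⟩
    have h1 : (fun q => q - q₀) =O[𝓝[S] q₀] fun q => B (q - q₀) :=
      IsBigO.of_bound K (Eventually.of_forall fun q => by
        simpa using hK.le_mul_norm (map_zero B) (q - q₀))
    have h2 : (fun q => B (q - q₀)) =O[𝓝[S] q₀] fun q => P q - P q₀ := by
      have h3 : (fun q => (P q - P q₀) - B (q - q₀)) =o[𝓝[S] q₀] fun q => B (q - q₀) :=
        hBo.trans_isBigO h1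
      exact h3.right_isBigO_add.congr_right fun q => by ring
    exact h1.trans h2
  have h5 : (fun q => T (P q - P q₀ - B (q - q₀))) =o[𝓝[S] q₀] fun q => q - q₀ :=
    (T.isBigO_comp _ _).trans_isLittleO hBo
  refine ((hAo.sub h5).trans_isBigO hbig).congr_left fun q => ?_
  rw [map_sub T, hTB]
  ring

/-! ### Counting components of a fibre -/

theorem card_connectedComponents_of_finite {X : Type*} [TopologicalSpace X] [T1Space X] [Finite X] :
    ENat.card (ConnectedComponents X) = ENat.card X := by
  refine (ENat.card_congr (Equiv.ofBijective (ConnectedComponents.mk : X → _)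
    ⟨fun a b hab => ?_, ConnectedComponents.surjective_coe⟩)).symm
  have := ConnectedComponents.coe_eq_coe'.1 hab
  rwa [connectedComponent_eq_singleton, mem_singleton_iff] at this

theorem card_le_card_of_surjective {X Y : Type*} {f : X → Y} (hf : Function.Surjective f) :
    ENat.card Y ≤ ENat.card X :=
  ENat.card_le_card_of_injective (Function.injective_surjInv hf)

theorem card_connectedComponents_le {X : Type*} [TopologicalSpace X] :
    ENat.card (ConnectedComponents X) ≤ ENat.card X :=
  card_le_card_of_surjective ConnectedComponents.surjective_coe

/-- The part of the fibre of `H` over `x` that lies in the parameter square. -/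
def squareFiber (H : ℝ × ℝ → ℂ) (x : ℂ) : Set (ℝ × ℝ) := {q | q ∈ square ∧ H q = x}

theorem sweepCount_of_finite {H : ℝ × ℝ → ℂ} {x : ℂ} (h : (squareFiber H x).Finite) :
    sweepCount H x = (squareFiber H x).encard := by
  have : Finite {q : ℝ × ℝ // q ∈ square ∧ H q = x} := h
  rw [sweepCount, card_connectedComponents_of_finite]
  rfl

theorem sweepCount_le_encard (H : ℝ × ℝ → ℂ) (x : ℂ) :
    sweepCount H x ≤ (squareFiber H x).encard :=
  card_connectedComponents_le

theorem isCompact_square : IsCompact square := isCompact_Icc.prod isCompact_Icc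

theorem isCompact_squareFiber {H : ℝ × ℝ → ℂ} (hH : ContinuousOn H square) (x : ℂ) :
    IsCompact (squareFiber H x) :=
  isCompact_square.of_isClosed_subset
    (hH.preimage_isClosed_of_isClosed isCompact_square.isClosed isClosed_singleton) fun _ h => h.1

/-- A compact set in which no point is a limit of other points is finite. -/
theorem _root_.IsCompact.finite_of_isolated {X : Type*} [TopologicalSpace X] {K : Set X}
    (hK : IsCompact K) (h : ∀ q ∈ K, ∀ᶠ p in 𝓝[≠] q, p ∉ K) : K.Finite := by
  by_contra hinf
  obtain ⟨q, hq, hacc⟩ := Set.Infinite.exists_accPt_of_subset_isCompact hinf hK Subset.rfl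
  rw [accPt_iff_frequently_nhdsNE] at hacc
  exact hacc (h q hq)

/-! ### Almost every value of a piecewise differentiable map is regular -/

/-- Two families of derivatives of the same function within a measurable set agree almost
everywhere on it.  Their difference is a derivative of the zero function within the set. -/
theorem measure_setOf_fderiv_ne_eq_zero {K : ℂ → ℂ} {s : Set ℂ} (hs : MeasurableSet s)
    {f g : ℂ → ℂ →L[ℝ] ℂ} (hf : ∀ x ∈ s, HasFDerivWithinAt K (f x) s x)
    (hg : ∀ x ∈ s, HasFDerivWithinAt K (g x) s x) : volume {x | x ∈ s ∧ f x ≠ g x} = 0 := by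
  have h0 : ApproximatesLinearOn (fun _ : ℂ => (0 : ℂ)) (0 : ℂ →L[ℝ] ℂ) s 0 := by
    intro x _ y _
    simp
  have hd : ∀ x ∈ s, HasFDerivWithinAt (fun _ : ℂ => (0 : ℂ)) (f x - g x) s x := fun x hx => by
    have h := (hf x hx).sub (hg x hx)
    rw [sub_self K] at h
    exact h
  have := h0.norm_fderiv_sub_le volume hs (fun x => f x - g x) hd
  rw [ae_restrict_iff' hs, ae_iff] at this
  refine measure_mono_null (fun x hx => ?_) this
  simp only [mem_ofPred_eq, Classical.not_imp, sub_zero]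
  refine ⟨hx.1, fun h => hx.2 ?_⟩
  have h' : ‖f x - g x‖₊ = 0 := le_antisymm h bot_le
  rwa [nnnorm_eq_zero, sub_eq_zero] at h'

theorem hasFDerivWithinAt_iUnion_fin {E F : Type*} [NormedAddCommGroup E] [NormedSpace ℝ E]
    [NormedAddCommGroup F] [NormedSpace ℝ F] {n : ℕ} {s : Fin n → Set E} {K : E → F}
    {A : E →L[ℝ] F} {x : E} (h : ∀ i, HasFDerivWithinAt K A (s i) x) :
    HasFDerivWithinAt K A (⋃ i, s i) x := by
  classical
  have : ∀ t : Finset (Fin n), HasFDerivWithinAt K A (⋃ i ∈ t, s i) x := by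
    intro t
    induction t using Finset.induction_on with
    | empty => exact .of_notMem_closure (by simp)
    | insert a t _ ih =>
      rw [Finset.set_biUnion_insert]
      exact (h a).union ih
  simpa using this Finset.univ

theorem det_ne_zero_iff_injective (A : ℂ →L[ℝ] ℂ) : A.det ≠ 0 ↔ Function.Injective A := by
  have h := LinearMap.isUnit_iff_isUnit_det (A : ℂ →ₗ[ℝ] ℂ)
  rw [LinearMap.isUnit_iff_ker_eq_bot, isUnit_iff_ne_zero] at h
  exact h.symm.trans LinearMap.ker_eq_bot

/-- The values of a function on a finite closed cover, on each piece of which it is differentiable,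
are almost all regular: the points over them are interior, and the function has an injective
derivative there. -/
theorem ae_regular_aux {K : ℂ → ℂ} {S : Set ℂ} (hS : Convex ℝ S) {n : ℕ} {P : Fin n → Set ℂ}
    (hPc : ∀ i, IsClosed (P i)) (hPS : ⋃ i, P i = S) (hd : ∀ i, DifferentiableOn ℝ K (P i)) :
    ∀ᵐ x : ℂ, ∀ q ∈ S, K q = x →
      q ∈ interior S ∧ ∃ A : ℂ →L[ℝ] ℂ, HasFDerivAt K A q ∧ Function.Injective A := by
  have hder : ∀ i, ∀ q ∈ P i, HasFDerivWithinAt K (fderivWithin ℝ K (P i) q) (P i) q :=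
    fun i q hq => (hd i q hq).hasFDerivWithinAt
  have h1 : ∀ i, volume (K '' (P i ∩ frontier S)) = 0 := fun i =>
    addHaar_image_eq_zero_of_differentiableOn_of_addHaar_eq_zero volume
      ((hd i).mono inter_subset_left)
      (measure_mono_null inter_subset_right (hS.addHaar_frontier volume))
  have h2 : ∀ i, volume (K '' {q | q ∈ P i ∧ (fderivWithin ℝ K (P i) q).det = 0}) = 0 := fun i =>
    addHaar_image_eq_zero_of_det_fderivWithin_eq_zero volume
      (fun q hq => (hder i q hq.1).mono fun _ h => h.1) fun q hq => hq.2
  have h3 : ∀ i j, volume (K '' {q | q ∈ P i ∩ P j ∧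
      fderivWithin ℝ K (P i) q ≠ fderivWithin ℝ K (P j) q}) = 0 := fun i j =>
    addHaar_image_eq_zero_of_differentiableOn_of_addHaar_eq_zero volume
      ((hd i).mono fun q hq => hq.1.1)
      (measure_setOf_fderiv_ne_eq_zero ((hPc i).inter (hPc j)).measurableSet
        (fun q hq => (hder i q hq.1).mono inter_subset_left)
        (fun q hq => (hder j q hq.2).mono inter_subset_right))
  have a1 : ∀ᵐ x : ℂ, ∀ i, x ∉ K '' (P i ∩ frontier S) :=
    ae_all_iff.2 fun i => measure_eq_zero_iff_ae_notMem.1 (h1 i)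
  have a2 : ∀ᵐ x : ℂ, ∀ i, x ∉ K '' {q | q ∈ P i ∧ (fderivWithin ℝ K (P i) q).det = 0} :=
    ae_all_iff.2 fun i => measure_eq_zero_iff_ae_notMem.1 (h2 i)
  have a3 : ∀ᵐ x : ℂ, ∀ i j, x ∉ K '' {q | q ∈ P i ∩ P j ∧
      fderivWithin ℝ K (P i) q ≠ fderivWithin ℝ K (P j) q} :=
    ae_all_iff.2 fun i => ae_all_iff.2 fun j => measure_eq_zero_iff_ae_notMem.1 (h3 i j)
  filter_upwards [a1, a2, a3] with x b1 b2 b3 q hq hqx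
  obtain ⟨i, hi⟩ : ∃ i, q ∈ P i := by
    rw [← hPS] at hq
    exact mem_iUnion.1 hq
  have hint : q ∈ interior S := by
    by_contra h
    exact b1 i ⟨q, ⟨hi, subset_closure hq, h⟩, hqx⟩
  refine ⟨hint, fderivWithin ℝ K (P i) q, ?_, ?_⟩
  · have : HasFDerivWithinAt K (fderivWithin ℝ K (P i) q) (⋃ j, P j) q := by
      refine hasFDerivWithinAt_iUnion_fin fun j => ?_
      by_cases hj : q ∈ P j
      · by_cases he : fderivWithin ℝ K (P i) q = fderivWithin ℝ K (P j) q
        · rw [he]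
          exact hder j q hj
        · exact absurd ⟨q, ⟨⟨hi, hj⟩, he⟩, hqx⟩ (b3 i j)
      · exact .of_notMem_closure (by rwa [(hPc j).closure_eq])
    rw [hPS] at this
    exact this.hasFDerivAt (mem_interior_iff_mem_nhds.1 hint)
  · rw [← det_ne_zero_iff_injective]
    intro h
    exact b2 i ⟨q, ⟨hi, h⟩, hqx⟩

theorem convex_square : Convex ℝ square := (convex_Icc 0 1).prod (convex_Icc 0 1)

theorem ae_regular {H : ℝ × ℝ → ℂ} (hH : IsPiecewiseDifferentiable H) :
    ∀ᵐ x : ℂ, ∀ q ∈ squareFiber H x,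
      q ∈ interior square ∧ ∃ A : ℝ × ℝ →L[ℝ] ℂ, HasFDerivAt H A q ∧ Function.Injective A := by
  obtain ⟨n, P, hPc, hPS, hd⟩ := hH
  let e : ℂ ≃L[ℝ] ℝ × ℝ := Complex.equivRealProdCLM
  have := ae_regular_aux (K := H ∘ e) (S := e ⁻¹' square) (P := fun i => e ⁻¹' P i)
    (convex_square.linear_preimage e.toLinearEquiv.toLinearMap)
    (fun i => (hPc i).preimage e.continuous) (by rw [← preimage_iUnion, hPS])
    (fun i => (hd i).comp e.differentiable.differentiableOn fun _ h => h)
  filter_upwards [this] with x hx q hq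
  obtain ⟨hint, A, hA, hinj⟩ := hx (e.symm q) (by simpa using hq.1) (by simpa using hq.2)
  constructor
  · have : e (e.symm q) ∈ interior square := by
      have h := e.toHomeomorph.preimage_interior square
      exact h.symm.subset hint
    simpa using this
  · refine ⟨A.comp (e.symm : ℝ × ℝ →L[ℝ] ℂ), ?_, hinj.comp e.symm.injective⟩
    have h1 := hA.comp q e.symm.hasFDerivAt
    refine h1.congr_of_eventuallyEq (Eventually.of_forall fun p => ?_)
    simp

theorem squareFiber_finite {H : ℝ × ℝ → ℂ} (hc : ContinuousOn H square) {x : ℂ}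
    (hx : ∀ q ∈ squareFiber H x, ∃ A : ℝ × ℝ →L[ℝ] ℂ, HasFDerivAt H A q ∧ Function.Injective A) :
    (squareFiber H x).Finite := by
  refine (isCompact_squareFiber hc x).finite_of_isolated fun q hq => ?_
  obtain ⟨A, hA, hinj⟩ := hx q hq
  have hanti : ∃ C, AntilipschitzWith C A :=
    let ⟨K, _, hK⟩ := LinearMap.exists_antilipschitzWith A.toLinearMap (LinearMap.ker_eq_bot.2 hinj)
    ⟨K, hK⟩
  filter_upwards [hA.eventually_ne hanti] with p hp h
  exact hp h.2

/-! ### The winding number is at most the number of sheets -/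

/-- Polar coordinates on the parameter square: the side `s = 0` goes to the unit circle, and the
side `s = 1` to the origin. -/
noncomputable def polar (q : ℝ × ℝ) : ℂ := (1 - (q.1 : ℂ)) * unitLoop q.2

theorem continuous_polar : Continuous polar :=
  (continuous_const.sub (Complex.continuous_ofReal.comp continuous_fst)).mul
    (continuous_unitLoop.comp continuous_snd)

theorem norm_polar {q : ℝ × ℝ} (hq : q.1 ≤ 1) : ‖polar q‖ = 1 - q.1 := by
  rw [polar, norm_mul, norm_unitLoop, mul_one, ← Complex.ofReal_one, ← Complex.ofReal_sub,
    Complex.norm_real, Real.norm_of_nonneg (by linarith)]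

theorem unitLoop_eq_unitLoop_iff {a b : ℝ} : unitLoop a = unitLoop b ↔ ∃ n : ℤ, a = b + n := by
  rw [unitLoop_eq, unitLoop_eq, Complex.exp_eq_exp_iff_exists_int]
  refine exists_congr fun n => ?_
  rw [← add_mul, mul_left_inj' Complex.two_pi_I_ne_zero]
  norm_cast

theorem eq_of_unitLoop_eq {a b : ℝ} (h : unitLoop a = unitLoop b) (hab : |a - b| < 1) : a = b := by
  obtain ⟨n, hn⟩ := unitLoop_eq_unitLoop_iff.1 h
  have : |(n : ℝ)| < 1 := by rwa [show (n : ℝ) = a - b by linarith]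
  have hn0 : n = 0 := by
    rw [← Int.abs_lt_one_iff]
    exact_mod_cast this
  simpa [hn0] using hn

theorem interior_square : interior square = Ioo 0 1 ×ˢ Ioo 0 1 := by
  rw [square, interior_prod_eq, interior_Icc]

theorem polar_eq_polar_iff {q z : ℝ × ℝ} (hq : q ∈ square) (hz : z ∈ interior square) :
    polar q = polar z ↔ q = z := by
  refine ⟨fun h => ?_, fun h => by rw [h]⟩
  rw [interior_square] at hz
  obtain ⟨⟨hz1, hz2⟩, hz3, hz4⟩ := hz
  obtain ⟨⟨hq1, hq2⟩, hq3, hq4⟩ := hq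
  have h1 : q.1 = z.1 := by
    have := congrArg norm h
    rw [norm_polar hq2, norm_polar hz2.le] at this
    linarith
  have hne : (1 - (z.1 : ℂ)) ≠ 0 := by
    rw [← Complex.ofReal_one, ← Complex.ofReal_sub, Complex.ofReal_ne_zero]
    linarith
  have h2 : unitLoop q.2 = unitLoop z.2 := by
    rw [polar, polar, h1] at h
    exact mul_left_cancel₀ hne h
  exact Prod.ext h1 (eq_of_unitLoop_eq h2 (abs_lt.2 ⟨by linarith, by linarith⟩))

theorem exists_hasFDerivAt_polar {z : ℝ × ℝ} (hz : z.1 < 1) :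
    ∃ B : ℝ × ℝ →L[ℝ] ℂ, HasFDerivAt polar B z ∧ Function.Injective B := by
  have h1 : HasFDerivAt (fun q : ℝ × ℝ => (1 - (q.1 : ℂ)))
      (-(Complex.ofRealCLM.comp (ContinuousLinearMap.fst ℝ ℝ ℝ))) z := by
    have := (Complex.ofRealCLM.comp (ContinuousLinearMap.fst ℝ ℝ ℝ)).hasFDerivAt (x := z)
    exact this.const_sub 1
  have h2 : HasDerivAt unitLoop (unitLoop z.2 * (2 * Real.pi * Complex.I)) z.2 := by
    have h3 : HasDerivAt (fun t : ℝ => (t : ℂ) * (2 * Real.pi * Complex.I))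
        (1 * (2 * Real.pi * Complex.I)) z.2 :=
      (Complex.ofRealCLM.hasDerivAt (x := z.2)).mul_const _
    have h4 := h3.cexp
    rw [one_mul, ← unitLoop_eq] at h4
    exact h4.congr_of_eventuallyEq (Eventually.of_forall unitLoop_eq)
  have h5 := h1.mul (h2.hasFDerivAt.comp z (hasFDerivAt_snd (𝕜 := ℝ) (p := z)))
  refine ⟨_, h5, ?_⟩
  rw [injective_iff_map_eq_zero]
  rintro ⟨a, b⟩ hab
  have hab' : unitLoop z.2 * (-(a : ℂ) + (1 - (z.1 : ℂ)) * (b * (2 * Real.pi)) * Complex.I) = 0 := by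
    rw [← hab]
    simp
    ring
  have hne : unitLoop z.2 ≠ 0 := norm_ne_zero_iff.1 (by rw [norm_unitLoop]; norm_num)
  have h6 := (mul_eq_zero.1 hab').resolve_left hne
  have hre := congrArg Complex.re h6
  have him := congrArg Complex.im h6
  simp at hre him
  have h7 : (1 - z.1) ≠ 0 := by linarith
  have h8 : b = 0 := by
    rcases him with h | h
    · exact absurd h h7
    · exact h
  simp [hre, h8]

theorem exists_continuousOn_log_square {g : ℝ × ℝ → ℂ} (hg : ContinuousOn g square)
    (h0 : ∀ q ∈ square, g q ≠ 0) :
    ∃ G : ℝ × ℝ → ℂ, ContinuousOn G square ∧ ∀ q ∈ square, Complex.exp (G q) = g q :=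
  exists_continuousOn_log (S := square)
    (R := fun q =>
      ((projIcc (0 : ℝ) 1 zero_le_one q.1 : ℝ), (projIcc (0 : ℝ) 1 zero_le_one q.2 : ℝ)))
    (((continuous_subtype_val.comp continuous_projIcc).comp continuous_fst).prodMk
      ((continuous_subtype_val.comp continuous_projIcc).comp continuous_snd))
    (fun q => ⟨(projIcc (0 : ℝ) 1 zero_le_one q.1).2, (projIcc (0 : ℝ) 1 zero_le_one q.2).2⟩)
    (fun q hq => by simp [projIcc_of_mem zero_le_one hq.1, projIcc_of_mem zero_le_one hq.2]) hg h0

open Classical in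
/-- The identity or complex conjugation of `w`, whichever has the orientation of `T`. -/
noncomputable def orient (T : ℂ →L[ℝ] ℂ) (w : ℂ) : ℂ :=
  if ‖conjCoeff T‖ < ‖linCoeff T‖ then w else conj w

open Classical in
/-- The orientation of an invertible real-linear map of the plane. -/
noncomputable def orientSign (T : ℂ →L[ℝ] ℂ) : ℤ :=
  if ‖conjCoeff T‖ < ‖linCoeff T‖ then 1 else -1

theorem orient_eq_zero_iff (T : ℂ →L[ℝ] ℂ) (w : ℂ) : orient T w = 0 ↔ w = 0 := by
  unfold orient
  split_ifs <;> simp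

theorem continuous_orient (T : ℂ →L[ℝ] ℂ) : Continuous (orient T) := by
  unfold orient
  split_ifs
  · exact continuous_id
  · exact Complex.continuous_conj

theorem natAbs_orientSign (T : ℂ →L[ℝ] ℂ) : (orientSign T).natAbs = 1 := by
  unfold orientSign
  split_ifs <;> simp

theorem exists_apply_eq_orient {T : ℂ →L[ℝ] ℂ} (hT : Function.Injective T) :
    ∃ κ μ : ℂ, ‖μ‖ < ‖κ‖ ∧ ∀ w, T w = κ * orient T w + μ * conj (orient T w) := by
  by_cases h : ‖conjCoeff T‖ < ‖linCoeff T‖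
  · exact ⟨_, _, h, fun w => by simp only [orient, if_pos h]; exact apply_eq_linCoeff T w⟩
  · refine ⟨_, _, lt_of_le_of_ne (not_lt.1 h) (norm_linCoeff_ne_of_injective hT), fun w => ?_⟩
    simp only [orient, if_neg h, Complex.conj_conj]
    rw [apply_eq_linCoeff T w, add_comm]

theorem HasWindingNumber.orient {γ : ℝ → ℂ} {n : ℤ} (h : HasWindingNumber γ 0 n) (T : ℂ →L[ℝ] ℂ) :
    HasWindingNumber (fun t => orient T (γ t)) 0 (orientSign T * n) := by
  unfold HomotopyArea.orient orientSign
  split_ifs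
  · simpa using h
  · simpa using h.conj

theorem orient_isLittleO {E : Type*} [TopologicalSpace E] {f D : E → ℂ} {l : Filter E}
    {T : ℂ →L[ℝ] ℂ} (hT : Function.Injective T) (h : (fun q => f q - T (D q)) =o[l] D) :
    ∃ κ μ : ℂ, ‖μ‖ < ‖κ‖ ∧
      (fun q => f q - (κ * orient T (D q) + μ * conj (orient T (D q)))) =o[l]
        fun q => orient T (D q) := by
  obtain ⟨κ, μ, hlt, hw⟩ := exists_apply_eq_orient hT
  refine ⟨κ, μ, hlt, ?_⟩
  have h2 : D =O[l] fun q => orient T (D q) := by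
    refine IsBigO.of_bound 1 (Eventually.of_forall fun q => ?_)
    unfold orient
    split_ifs <;> simp
  exact (h.trans_isBigO h2).congr_left fun q => by rw [hw]

/-- The winding number around a regular value of a based contraction is a sum of orientation
signs, one for each point of the fibre. -/
theorem exists_windingNumber_eq_sum {p₀ : ℂ} {C : ℝ → ℂ} {H : ℝ × ℝ → ℂ}
    (hH : IsHomotopy p₀ C (fun _ => p₀) H) {x : ℂ}
    (hx : ∀ q ∈ squareFiber H x,
      q ∈ interior square ∧ ∃ A : ℝ × ℝ →L[ℝ] ℂ, HasFDerivAt H A q ∧ Function.Injective A)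
    (Z : Finset (ℝ × ℝ)) (hZ : (Z : Set (ℝ × ℝ)) = squareFiber H x) :
    ∃ T : ℝ × ℝ → ℂ →L[ℝ] ℂ, windingNumber C x = ∑ z ∈ Z, orientSign (T z) := by
  classical
  obtain ⟨hc, hb, hp⟩ := hH
  have hZmem : ∀ q, q ∈ Z ↔ q ∈ squareFiber H x := fun q => by rw [← hZ]; simp
  -- near each point of the fibre, `H - x` is an invertible linear function of `polar`
  have hloc : ∀ z, ∃ T : ℂ →L[ℝ] ℂ, z ∈ Z → Function.Injective T ∧
      (fun q => H q - x - T (polar q - polar z)) =o[𝓝[square] z] fun q => polar q - polar z := by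
    intro z
    by_cases hz : z ∈ Z
    · obtain ⟨hint, A, hA, hAi⟩ := hx z ((hZmem z).1 hz)
      have hz1 : z.1 < 1 := by
        rw [interior_square] at hint
        exact hint.1.2
      obtain ⟨B, hB, hBi⟩ := exists_hasFDerivAt_polar hz1
      obtain ⟨T, hT, ho⟩ := exists_linear_isLittleO (by simp) hA.hasFDerivWithinAt hAi
        (hB.hasFDerivWithinAt (s := square)) hBi
      rw [((hZmem z).1 hz).2] at ho
      exact ⟨T, fun _ => ⟨hT, ho⟩⟩
    · exact ⟨0, fun h => absurd h hz⟩
  choose T hT using hloc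
  refine ⟨T, ?_⟩
  obtain ⟨ρ, hρ, hball⟩ : ∃ ρ > 0, ∀ z ∈ Z, Metric.ball z ρ ⊆ interior square := by
    have h1 : ∀ᶠ r in 𝓝[>] (0 : ℝ), ∀ z ∈ Z, Metric.ball z r ⊆ interior square := by
      rw [Filter.eventually_all_finset]
      intro z hz
      obtain ⟨r, hr, hrs⟩ := Metric.isOpen_iff.1 isOpen_interior z (hx z ((hZmem z).1 hz)).1
      filter_upwards [mem_nhdsWithin_of_mem_nhds (Iic_mem_nhds hr)] with r' hr'
      exact (Metric.ball_subset_ball hr').trans hrs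
    obtain ⟨r, h2, h3⟩ := (h1.and self_mem_nhdsWithin).exists
    exact ⟨r, h3, h2⟩
  obtain ⟨g, hg, hg0, hgf⟩ := exists_factor_zeros (S := square)
    (D := fun z q => orient (T z) (polar q - polar z)) hρ Z (fun q => H q - x)
    (hc.sub continuousOn_const) (fun z hz => ((hZmem z).1 hz).1)
    (fun q hq => by rw [hZmem, sub_eq_zero]; exact ⟨fun h => ⟨hq, h⟩, fun h => h.2⟩)
    (fun z hz => ⟨((continuous_orient _).comp (continuous_polar.sub continuous_const)).continuousOn,
      fun q hq => by
        rw [orient_eq_zero_iff, sub_eq_zero,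
          polar_eq_polar_iff hq (hx z ((hZmem z).1 hz)).1],
      orient_isLittleO (hT z hz).1 (hT z hz).2⟩)
  obtain ⟨G, hG, hGg⟩ := exists_continuousOn_log_square hg hg0
  have hfac : ∀ q ∈ square, q ∉ interior square →
      H q - x = Complex.exp (G q) * ∏ z ∈ Z, orient (T z) (polar q - polar z) := by
    intro q hq hqi
    rw [hGg q hq]
    refine hgf q hq fun z hz => ?_
    by_contra hlt
    exact hqi (hball z hz (not_le.1 hlt))
  have hprod : ∀ q ∈ square, q ∉ interior square →
      (∏ z ∈ Z, orient (T z) (polar q - polar z)) ≠ 0 := by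
    intro q hq hqi
    rw [Finset.prod_ne_zero_iff]
    intro z hz
    have hzi := (hx z ((hZmem z).1 hz)).1
    rw [Ne, orient_eq_zero_iff, sub_eq_zero, polar_eq_polar_iff hq hzi]
    rintro rfl
    exact hqi hzi
  have hb0 : ∀ t, t ∈ Icc (0 : ℝ) 1 →
      ((0 : ℝ), t) ∈ square ∧ ((0 : ℝ), t) ∉ interior square := fun t ht =>
    ⟨⟨by simp, ht⟩, by rw [interior_square]; simp⟩
  have hb1 : ∀ t, t ∈ Icc (0 : ℝ) 1 →
      ((1 : ℝ), t) ∈ square ∧ ((1 : ℝ), t) ∉ interior square := fun t ht =>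
    ⟨⟨by simp, ht⟩, by rw [interior_square]; simp⟩
  have hc0 : ∀ s, s ∈ Icc (0 : ℝ) 1 →
      (s, (0 : ℝ)) ∈ square ∧ (s, (0 : ℝ)) ∉ interior square := fun s hs =>
    ⟨⟨hs, by simp⟩, by rw [interior_square]; simp⟩
  have hc1 : ∀ s, s ∈ Icc (0 : ℝ) 1 →
      (s, (1 : ℝ)) ∈ square ∧ (s, (1 : ℝ)) ∉ interior square := fun s hs =>
    ⟨⟨hs, by simp⟩, by rw [interior_square]; simp⟩
  -- on the side `s = 1` everything is constant, so the logarithm returns to its start there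
  have hpx : p₀ - x ≠ 0 := by
    intro h
    have h0 := (hb1 0 (by simp))
    have : ((1 : ℝ), (0 : ℝ)) ∈ squareFiber H x :=
      ⟨h0.1, by rw [(hp 1 (by simp)).1]; exact sub_eq_zero.1 h⟩
    exact h0.2 (hx _ this).1
  have hG1 : G (1, 0) = G (1, 1) := by
    refine eq_of_exp_eq_const (γ := fun t => G (1, t))
      (hG.comp (by fun_prop) fun t ht => (hb1 t ht).1)
      (c := (p₀ - x) / ∏ z ∈ Z, orient (T z) (0 - polar z)) fun t ht => ?_
    have h1 := hfac _ (hb1 t ht).1 (hb1 t ht).2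
    have h2 := hprod _ (hb1 t ht).1 (hb1 t ht).2
    have h3 : polar (1, t) = 0 := by simp [polar]
    rw [(hb t ht).2, h3] at h1
    rw [h3] at h2
    rw [h1]
    field_simp
  have hG0 : G (0, 1) - G (0, 0) = G (1, 1) - G (1, 0) := by
    refine eq_of_exp_eq_const (γ := fun s => G (s, 1) - G (s, 0)) (c := 1)
      ((hG.comp (by fun_prop) fun s hs => (hc1 s hs).1).sub
        (hG.comp (by fun_prop) fun s hs => (hc0 s hs).1)) fun s hs => ?_
    have h1 := hfac _ (hc1 s hs).1 (hc1 s hs).2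
    have h0 := hfac _ (hc0 s hs).1 (hc0 s hs).2
    have h2 := hprod _ (hc0 s hs).1 (hc0 s hs).2
    have h3 : polar (s, 1) = polar (s, 0) := by simp [polar]
    rw [(hp s hs).2, h3] at h1
    rw [(hp s hs).1, h1] at h0
    rw [Complex.exp_sub, mul_right_cancel₀ h2 h0, div_self (Complex.exp_ne_zero _)]
  have hGG : G (0, 0) = G (0, 1) := by
    rw [hG1, sub_self, sub_eq_zero] at hG0
    exact hG0.symm
  have hw : HasWindingNumber (fun t => C t - x) 0 (0 + ∑ z ∈ Z, orientSign (T z)) := by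
    have h1 : HasWindingNumber (fun t => Complex.exp (G (0, t))) 0 0 :=
      hasWindingNumber_exp (G := fun t => G (0, t))
        (hG.comp (by fun_prop) fun t ht => (hb0 t ht).1) hGG
    have h2 : HasWindingNumber (fun t => ∏ z ∈ Z, orient (T z) (unitLoop t - polar z)) 0
        (∑ z ∈ Z, orientSign (T z)) := by
      refine hasWindingNumber_prod Z fun z hz => ?_
      have hzi := (hx z ((hZmem z).1 hz)).1
      rw [interior_square] at hzi
      have := (hasWindingNumber_unitLoop.sub_of_norm_lt_one
        ⟨continuous_unitLoop.continuousOn, by simp⟩ (fun t _ => norm_unitLoop t)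
        (z := polar z) (by rw [norm_polar hzi.1.2.le]; linarith [hzi.1.1])).orient (T z)
      rwa [mul_one] at this
    refine (h1.mul h2).congr fun t ht => ?_
    have h3 := hfac _ (hb0 t ht).1 (hb0 t ht).2
    rw [(hb t ht).1] at h3
    rw [h3]
    simp [polar]
  rw [zero_add, hasWindingNumber_sub_iff] at hw
  exact hw.windingNumber_eq

/-- A piecewise differentiable contraction covers almost every point at least as often as the curve
winds around it. -/
theorem windingArea_le_homotopyArea {p₀ : ℂ} {C : ℝ → ℂ} {H : ℝ × ℝ → ℂ}
    (hH : IsHomotopy p₀ C (fun _ => p₀) H) (hd : IsPiecewiseDifferentiable H) :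
    windingArea C ≤ homotopyArea H := by
  refine lintegral_mono_ae ?_
  filter_upwards [ae_regular hd] with x hx
  have hfin := squareFiber_finite hH.1 fun q hq => (hx q hq).2
  obtain ⟨T, hT⟩ := exists_windingNumber_eq_sum hH hx hfin.toFinset hfin.coe_toFinset
  rw [sweepCount_of_finite hfin, hfin.encard_eq_coe_toFinset_card, hT]
  have : (∑ z ∈ hfin.toFinset, orientSign (T z)).natAbs ≤ hfin.toFinset.card := by
    refine (Int.natAbs_sum_le _ _).trans ?_
    simp [natAbs_orientSign]
  exact_mod_cast this

/-! ### Homeomorphisms of the circle -/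

/-- The loop that runs once around the circle, reparametrized by a homeomorphism. -/
noncomputable def circleLoop (φ : Circle ≃ₜ Circle) (t : ℝ) : ℂ :=
  φ (Circle.exp (2 * Real.pi * t))

theorem continuous_circleLoop (φ : Circle ≃ₜ Circle) : Continuous (circleLoop φ) := by
  unfold circleLoop
  fun_prop

theorem norm_circleLoop (φ : Circle ≃ₜ Circle) (t : ℝ) : ‖circleLoop φ t‖ = 1 :=
  Circle.norm_coe _

theorem circleLoop_zero (φ : Circle ≃ₜ Circle) : circleLoop φ 0 = φ 1 := by simp [circleLoop]

theorem circleLoop_eq_iff (φ : Circle ≃ₜ Circle) {a b : ℝ} :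
    circleLoop φ a = circleLoop φ b ↔ unitLoop a = unitLoop b := by
  simp only [circleLoop, unitLoop, Circle.coe_inj, φ.injective.eq_iff]

theorem circleLoop_one (φ : Circle ≃ₜ Circle) : circleLoop φ 1 = φ 1 := by
  rw [← circleLoop_zero, circleLoop_eq_iff]
  simp

theorem isClosedCurve_circleLoop (φ : Circle ≃ₜ Circle) : IsClosedCurve (circleLoop φ) :=
  ⟨(continuous_circleLoop φ).continuousOn, by rw [circleLoop_zero, circleLoop_one]⟩

theorem exists_circleLoop_eq (φ : Circle ≃ₜ Circle) {z : ℂ} (hz : ‖z‖ = 1) :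
    ∃ t ∈ Ico (0 : ℝ) 1, circleLoop φ t = z := by
  let w : Circle := φ.symm ⟨z, mem_sphere_zero_iff_norm.2 hz⟩
  obtain ⟨θ, hθ⟩ : ∃ θ : ℝ, Circle.exp θ = w := ⟨_, Circle.exp_arg w⟩
  refine ⟨Int.fract (θ / (2 * Real.pi)), ⟨Int.fract_nonneg _, Int.fract_lt_one _⟩, ?_⟩
  have h : circleLoop φ (Int.fract (θ / (2 * Real.pi))) = circleLoop φ (θ / (2 * Real.pi)) := by
    rw [circleLoop_eq_iff, unitLoop_eq_unitLoop_iff]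
    exact ⟨-⌊θ / (2 * Real.pi)⌋, by rw [Int.fract]; push_cast; ring⟩
  rw [h, circleLoop, mul_div_cancel₀ _ (by positivity), hθ]
  have hw : φ w = ⟨z, mem_sphere_zero_iff_norm.2 hz⟩ := φ.apply_symm_apply _
  rw [hw]

/-- A homeomorphism of the circle has degree `1` or `-1`: a lift of it is injective on `[0,1)`, so
it neither returns to its start nor passes the start again on the way. -/
theorem exists_hasWindingNumber_circleLoop (φ : Circle ≃ₜ Circle) :
    ∃ k : ℤ, k.natAbs = 1 ∧ HasWindingNumber (circleLoop φ) 0 k := by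
  obtain ⟨n, hn⟩ := exists_hasWindingNumber (isClosedCurve_circleLoop φ) (x := 0) fun t _ h => by
    have := norm_circleLoop φ t
    rw [h] at this
    simp at this
  refine ⟨n, ?_, hn⟩
  obtain ⟨L, hLc, hL, hL1⟩ := hn
  have hre : ∀ t ∈ Icc (0 : ℝ) 1, (L t).re = 0 := fun t ht => by
    have := congrArg norm (hL t ht)
    rw [Complex.norm_exp, sub_zero, norm_circleLoop] at this
    simpa using this
  set θ : ℝ → ℝ := fun t => (L t).im with hθ
  have hθc : ContinuousOn θ (Icc 0 1) := Complex.continuous_im.comp_continuousOn hLc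
  have hθ1 : θ 1 - θ 0 = n * (2 * Real.pi) := by
    have := congrArg Complex.im hL1
    simpa using this
  have hLθ : ∀ t ∈ Icc (0 : ℝ) 1, L t = θ t * Complex.I := fun t ht => by
    apply Complex.ext <;> simp [hre t ht, hθ]
  have hinj : ∀ a ∈ Ico (0 : ℝ) 1, ∀ b ∈ Ico (0 : ℝ) 1, ∀ m : ℤ,
      θ a = θ b + m * (2 * Real.pi) → a = b := by
    intro a ha b hb m hab
    have ha' := Ico_subset_Icc_self ha
    have hb' := Ico_subset_Icc_self hb
    have h1 : circleLoop φ a = circleLoop φ b := by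
      rw [← sub_zero (circleLoop φ a), ← sub_zero (circleLoop φ b), ← hL a ha', ← hL b hb',
        Complex.exp_eq_exp_iff_exists_int]
      refine ⟨m, ?_⟩
      rw [hLθ a ha', hLθ b hb', hab]
      push_cast
      ring
    exact eq_of_unitLoop_eq ((circleLoop_eq_iff φ).1 h1)
      (abs_lt.2 ⟨by linarith [ha.1, hb.2], by linarith [ha.2, hb.1]⟩)
  have hpi := Real.pi_pos
  have hivt : ∀ a ∈ Icc (0 : ℝ) 1, ∀ b ∈ Icc (0 : ℝ) 1, uIcc (θ a) (θ b) ⊆ θ '' uIcc a b :=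
    fun a ha b hb => intermediate_value_uIcc
      (hθc.mono ((convex_Icc (0 : ℝ) 1).ordConnected.uIcc_subset ha hb))
  have hn0 : n ≠ 0 := by
    rintro rfl
    have h10 : θ 1 = θ 0 := by simpa [sub_eq_zero] using hθ1
    have hne : θ (1 / 2) ≠ θ 0 := fun h => by
      have := hinj (1 / 2) (by norm_num) 0 (by norm_num) 0 (by simpa using h)
      norm_num at this
    have hv : ∀ a b : ℝ, (a + b) / 2 ∈ uIcc a b := fun a b => by
      rw [mem_uIcc]
      rcases le_total a b with h | h
      · left; constructor <;> linarith
      · right; constructor <;> linarith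
    obtain ⟨t₁, ht₁, h₁⟩ := hivt 0 (by norm_num) (1 / 2) (by norm_num) (hv _ _)
    obtain ⟨t₂, ht₂, h₂⟩ := hivt 1 (by norm_num) (1 / 2) (by norm_num) (hv _ _)
    rw [uIcc_of_le (by norm_num)] at ht₁
    rw [uIcc_of_ge (by norm_num)] at ht₂
    rw [h10] at h₂
    have ht₂1 : t₂ ≠ 1 := by
      rintro rfl
      apply hne
      linarith
    have h12 : t₁ = t₂ := hinj t₁ ⟨ht₁.1, by linarith [ht₁.2]⟩ t₂
      ⟨by linarith [ht₂.1], lt_of_le_of_ne ht₂.2 ht₂1⟩ 0 (by rw [h₁, h₂]; simp)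
    have : t₁ = 1 / 2 := le_antisymm ht₁.2 (by rw [h12]; exact ht₂.1)
    rw [this] at h₁
    apply hne
    linarith
  by_contra hne
  -- a lift with increment beyond `2π` passes `θ 0 ± 2π` before its end
  obtain ⟨m, hm, hmem⟩ : ∃ m : ℤ, m ≠ n ∧ m ≠ 0 ∧
      θ 0 + m * (2 * Real.pi) ∈ uIcc (θ 0) (θ 1) := by
    have hθ1' : θ 1 = θ 0 + n * (2 * Real.pi) := by linarith
    rcases lt_trichotomy n 0 with h | h | h
    · refine ⟨-1, by rintro rfl; simp at hne, by norm_num, ?_⟩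
      have h1 : (n : ℝ) ≤ -1 := by exact_mod_cast Int.le_sub_one_of_lt h
      rw [mem_uIcc, hθ1']
      right
      push_cast
      constructor <;> nlinarith
    · exact absurd h hn0
    · refine ⟨1, by rintro rfl; simp at hne, by norm_num, ?_⟩
      have h1 : (1 : ℝ) ≤ n := by exact_mod_cast h
      rw [mem_uIcc, hθ1']
      left
      push_cast
      constructor <;> nlinarith
  obtain ⟨hm0, hmem⟩ := hmem
  obtain ⟨t, ht, hmt⟩ := hivt 0 (by norm_num) 1 (by norm_num) hmem
  rw [uIcc_of_le zero_le_one] at ht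
  have ht1 : t ≠ 1 := by
    rintro rfl
    have : (m : ℝ) * (2 * Real.pi) = n * (2 * Real.pi) := by linarith
    exact hm (by exact_mod_cast mul_right_cancel₀ (by positivity) this)
  have ht0 : t = 0 := hinj t ⟨ht.1, lt_of_le_of_ne ht.2 ht1⟩ 0 (by norm_num) m hmt
  rw [ht0] at hmt
  have h2 : (m : ℝ) * (2 * Real.pi) = 0 := by linarith
  have h3 : (m : ℝ) = 0 := (mul_eq_zero.1 h2).resolve_right (by positivity)
  exact hm0 (by exact_mod_cast h3)

/-! ### Immersed disks -/

theorem uniqueDiffOn_disk : UniqueDiffOn ℝ disk :=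
  uniqueDiffOn_convex (convex_closedBall _ _) ⟨0, by
    rw [disk, interior_closedBall _ one_ne_zero]; simp⟩

theorem isCompact_disk : IsCompact disk := isCompact_closedBall _ _

theorem mem_disk_iff {z : ℂ} : z ∈ disk ↔ ‖z‖ ≤ 1 := mem_closedBall_zero_iff

theorem exists_continuousOn_log_disk {g : ℂ → ℂ} (hg : ContinuousOn g disk)
    (h0 : ∀ z ∈ disk, g z ≠ 0) :
    ∃ G : ℂ → ℂ, ContinuousOn G disk ∧ ∀ z ∈ disk, Complex.exp (G z) = g z := by
  have hpos : ∀ z : ℂ, 0 < max 1 ‖z‖ := fun z => lt_max_of_lt_left one_pos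
  refine exists_continuousOn_log (S := disk) (R := fun z => (max 1 ‖z‖)⁻¹ • z) ?_ (fun z => ?_)
    (fun z hz => ?_) hg h0
  · exact ((continuous_const.max continuous_norm).inv₀ fun z => (hpos z).ne').smul continuous_id
  · rw [mem_disk_iff, norm_smul, norm_inv, Real.norm_of_nonneg (hpos z).le,
      inv_mul_le_iff₀ (hpos z), mul_one]
    exact le_max_right _ _
  · rw [max_eq_left (mem_disk_iff.1 hz)]
    simp

theorem IsDiskImmersion.hasFDerivWithinAt {F : ℂ → ℂ} (hF : IsDiskImmersion F) {z : ℂ}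
    (hz : z ∈ disk) : HasFDerivWithinAt F (fderivWithin ℝ F disk z) disk z :=
  (hF.1.differentiableOn one_ne_zero z hz).hasFDerivWithinAt

/-- An immersion of the disk either preserves or reverses the orientation everywhere. -/
theorem IsDiskImmersion.orientSign_eq {F : ℂ → ℂ} (hF : IsDiskImmersion F) {z w : ℂ}
    (hz : z ∈ disk) (hw : w ∈ disk) :
    orientSign (fderivWithin ℝ F disk z) = orientSign (fderivWithin ℝ F disk w) := by
  have hc := hF.1.continuousOn_fderivWithin uniqueDiffOn_disk le_rfl
  have hap : ∀ v : ℂ, ContinuousOn (fun z => fderivWithin ℝ F disk z v) disk :=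
    fun v => hc.clm_apply continuousOn_const
  set d : ℂ → ℝ := fun z => ‖linCoeff (fderivWithin ℝ F disk z)‖ -
    ‖conjCoeff (fderivWithin ℝ F disk z)‖ with hd
  have hdc : ContinuousOn d disk := by
    have h1 := hap 1
    have h2 := hap Complex.I
    simp only [hd, linCoeff, conjCoeff]
    fun_prop
  have hd0 : ∀ z ∈ disk, d z ≠ 0 := fun z hz h =>
    norm_linCoeff_ne_of_injective (hF.2 z hz) (sub_eq_zero.1 h)
  have hpre : IsPreconnected disk := (convex_closedBall _ _).isPreconnected
  have key : ∀ z ∈ disk, ∀ w ∈ disk, 0 < d z → 0 < d w := by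
    intro z hz w hw h
    by_contra hlt
    obtain ⟨y, hy, hy0⟩ := hpre.intermediate_value hw hz hdc ⟨not_lt.1 hlt, h.le⟩
    exact hd0 y hy hy0
  have hiff : 0 < d z ↔ 0 < d w := ⟨key z hz w hw, key w hw z hz⟩
  simp only [hd, sub_pos] at hiff
  simp only [orientSign, hiff]

/-- The part of the fibre of `F` over `x` that lies in the disk. -/
def diskFiber (F : ℂ → ℂ) (x : ℂ) : Set ℂ := {z | z ∈ disk ∧ F z = x}

theorem IsDiskImmersion.finite_diskFiber {F : ℂ → ℂ} (hF : IsDiskImmersion F) (x : ℂ) :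
    (diskFiber F x).Finite := by
  have hK : IsCompact (diskFiber F x) := isCompact_disk.of_isClosed_subset
    (hF.1.continuousOn.preimage_isClosed_of_isClosed isCompact_disk.isClosed isClosed_singleton)
    fun _ h => h.1
  refine hK.finite_of_isolated fun z hz => ?_
  have hanti : ∃ C, AntilipschitzWith C (fderivWithin ℝ F disk z) :=
    let ⟨K, _, hK⟩ := LinearMap.exists_antilipschitzWith (fderivWithin ℝ F disk z).toLinearMap
      (LinearMap.ker_eq_bot.2 (hF.2 z hz.1))
    ⟨K, hK⟩
  have h := (hF.hasFDerivWithinAt hz.1).eventually_ne (c := x) hanti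
  rw [eventually_nhdsWithin_iff] at h ⊢
  filter_upwards [h] with p hp hpz hpK
  exact hp ⟨hpK.1, hpz⟩ hpK.2

/-- The boundary curve of an immersed disk winds around each point off the curve exactly as often,
up to sign, as the disk covers that point. -/
theorem natAbs_windingNumber_eq_encard {F : ℂ → ℂ} {φ : Circle ≃ₜ Circle} {C : ℝ → ℂ}
    (hF : IsDiskImmersion F) (hC : IsBoundaryCurve F φ C) {x : ℂ}
    (hx : ∀ t ∈ Icc (0 : ℝ) 1, C t ≠ x) :
    ((windingNumber C x).natAbs : ℕ∞) = (diskFiber F x).encard := by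
  classical
  obtain ⟨k, hk1, hk⟩ := exists_hasWindingNumber_circleLoop φ
  have hfin := hF.finite_diskFiber x
  set Z := hfin.toFinset with hZ
  have hZmem : ∀ z, z ∈ Z ↔ z ∈ diskFiber F x := fun z => hfin.mem_toFinset
  have hu : ∀ t, circleLoop φ t ∈ disk := fun t => by rw [mem_disk_iff, norm_circleLoop]
  have hZ1 : ∀ z ∈ Z, ‖z‖ < 1 := by
    intro z hz
    have hz' := (hZmem z).1 hz
    refine lt_of_le_of_ne (mem_disk_iff.1 hz'.1) fun h1 => ?_
    obtain ⟨t, ht, rfl⟩ := exists_circleLoop_eq φ h1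
    refine hx t (Ico_subset_Icc_self ht) ?_
    rw [hC t (Ico_subset_Icc_self ht), ← hz'.2]
    rfl
  obtain ⟨ρ, hρ, hball⟩ : ∃ ρ > 0, ∀ z ∈ Z, ‖z‖ + ρ < 1 := by
    have h1 : ∀ᶠ r in 𝓝[>] (0 : ℝ), ∀ z ∈ Z, ‖z‖ + r < 1 := by
      rw [Filter.eventually_all_finset]
      intro z hz
      have : 0 < 1 - ‖z‖ := by linarith [hZ1 z hz]
      filter_upwards [mem_nhdsWithin_of_mem_nhds (Iio_mem_nhds this)] with r hr
      rw [mem_Iio] at hr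
      linarith
    obtain ⟨r, h2, h3⟩ := (h1.and self_mem_nhdsWithin).exists
    exact ⟨r, h3, h2⟩
  set T : ℂ → ℂ →L[ℝ] ℂ := fun z => fderivWithin ℝ F disk z with hT
  obtain ⟨g, hg, hg0, hgf⟩ := exists_factor_zeros (S := disk)
    (D := fun z q => orient (T z) (q - z)) hρ Z (fun q => F q - x)
    (hF.1.continuousOn.sub continuousOn_const) (fun z hz => ((hZmem z).1 hz).1)
    (fun q hq => by rw [hZmem, sub_eq_zero]; exact ⟨fun h => ⟨hq, h⟩, fun h => h.2⟩)
    (fun z hz => ⟨((continuous_orient _).comp (continuous_id.sub continuous_const)).continuousOn,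
      fun q hq => by rw [orient_eq_zero_iff, sub_eq_zero],
      orient_isLittleO (hF.2 z ((hZmem z).1 hz).1) (by
        have := (hF.hasFDerivWithinAt ((hZmem z).1 hz).1).isLittleO
        rwa [((hZmem z).1 hz).2] at this)⟩)
  obtain ⟨G, hG, hGg⟩ := exists_continuousOn_log_disk hg hg0
  have hw : HasWindingNumber (fun t => C t - x) 0 (0 + ∑ z ∈ Z, orientSign (T z) * k) := by
    have h1 : HasWindingNumber (fun t => Complex.exp (G (circleLoop φ t))) 0 0 :=
      hasWindingNumber_exp (G := fun t => G (circleLoop φ t))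
        (hG.comp (continuous_circleLoop φ).continuousOn fun t _ => hu t)
        (by simp only [circleLoop_zero, circleLoop_one])
    have h2 : HasWindingNumber (fun t => ∏ z ∈ Z, orient (T z) (circleLoop φ t - z)) 0
        (∑ z ∈ Z, orientSign (T z) * k) :=
      hasWindingNumber_prod Z fun z hz =>
        (hk.sub_of_norm_lt_one (isClosedCurve_circleLoop φ) (fun t _ => norm_circleLoop φ t)
          (hZ1 z hz)).orient (T z)
    refine (h1.mul h2).congr fun t ht => ?_
    rw [hC t ht, hGg _ (hu t)]
    refine (hgf _ (hu t) fun z hz => ?_).symm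
    have h3 : ‖circleLoop φ t‖ - ‖z‖ ≤ ‖circleLoop φ t - z‖ := norm_sub_norm_le _ _
    rw [norm_circleLoop] at h3
    rw [dist_eq_norm]
    linarith [hball z hz]
  rw [zero_add, hasWindingNumber_sub_iff] at hw
  have h0 : (0 : ℂ) ∈ disk := by simp [mem_disk_iff]
  have hsum : ∑ z ∈ Z, orientSign (T z) * k = Z.card * (orientSign (T 0) * k) := by
    rw [Finset.sum_congr rfl fun z hz => by
      rw [hT, hF.orientSign_eq ((hZmem z).1 hz).1 h0]]
    simp [hT]
  rw [hw.windingNumber_eq, hsum, Int.natAbs_mul, Int.natAbs_mul, natAbs_orientSign, hk1,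
    hfin.encard_eq_coe_toFinset_card]
  simp [hZ]

/-! ### The linear contraction of an immersed disk -/

/-- The straight-line contraction of the disk to `φ 1`, restricted to the boundary circle. -/
noncomputable def contractionMap (φ : Circle ≃ₜ Circle) (q : ℝ × ℝ) : ℂ :=
  (1 - (q.1 : ℂ)) * circleLoop φ q.2 + (q.1 : ℂ) * φ 1

theorem linearContraction_eq (F : ℂ → ℂ) (φ : Circle ≃ₜ Circle) (q : ℝ × ℝ) :
    linearContraction F φ q = F (contractionMap φ q) := rfl

theorem continuous_contractionMap (φ : Circle ≃ₜ Circle) : Continuous (contractionMap φ) := by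
  have := continuous_circleLoop φ
  unfold contractionMap
  fun_prop

theorem norm_one_sub_coe {s : ℝ} (hs : s ≤ 1) : ‖1 - (s : ℂ)‖ = 1 - s := by
  rw [← Complex.ofReal_one, ← Complex.ofReal_sub, Complex.norm_real,
    Real.norm_of_nonneg (by linarith)]

theorem contractionMap_mem_disk (φ : Circle ≃ₜ Circle) {q : ℝ × ℝ} (hq : q ∈ square) :
    contractionMap φ q ∈ disk := by
  rw [mem_disk_iff, contractionMap]
  refine (norm_add_le _ _).trans ?_
  rw [norm_mul, norm_mul, norm_one_sub_coe hq.1.2, norm_circleLoop, Circle.norm_coe,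
    Complex.norm_real, Real.norm_of_nonneg hq.1.1]
  linarith

theorem contractionMap_zero (φ : Circle ≃ₜ Circle) (t : ℝ) :
    contractionMap φ (0, t) = circleLoop φ t := by simp [contractionMap]

theorem contractionMap_side (φ : Circle ≃ₜ Circle) (s : ℝ) {t : ℝ} (ht : circleLoop φ t = φ 1) :
    contractionMap φ (s, t) = φ 1 := by
  simp only [contractionMap, ht]
  ring

/-- The parameter `s` of a point `z` of the disk is determined by `‖z - s w‖ = 1 - s`, where `w`
is the centre of the contraction. -/
theorem norm_sub_mul_eq_iff {z w : ℂ} (hw : ‖w‖ = 1) (hz : ‖z‖ < 1) {s : ℝ} (hs : s ≤ 1) :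
    ‖z - s * w‖ = 1 - s ↔ s = (1 - ‖z‖ ^ 2) / (2 * (1 - (z * conj w).re)) := by
  have hre : (z * conj w).re < 1 := by
    calc (z * conj w).re ≤ ‖z * conj w‖ := Complex.re_le_norm _
      _ = ‖z‖ := by rw [norm_mul, RCLike.norm_conj, hw, mul_one]
      _ < 1 := hz
  have hsq : ‖z - s * w‖ ^ 2 = ‖z‖ ^ 2 - 2 * s * (z * conj w).re + s ^ 2 := by
    have h1 : w.re ^ 2 + w.im ^ 2 = 1 := by
      have := Complex.sq_norm w
      rw [hw, Complex.normSq_apply] at this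
      nlinarith
    rw [Complex.sq_norm, Complex.sq_norm, Complex.normSq_apply, Complex.normSq_apply]
    simp
    linear_combination s ^ 2 * h1
  rw [← sq_eq_sq₀ (norm_nonneg _) (by linarith), hsq, eq_div_iff (by linarith)]
  constructor <;> intro h <;> linarith

theorem contractionMap_sub (φ : Circle ≃ₜ Circle) (q : ℝ × ℝ) :
    contractionMap φ q - q.1 * φ 1 = (1 - (q.1 : ℂ)) * circleLoop φ q.2 := by
  rw [contractionMap]
  ring

theorem norm_contractionMap_sub (φ : Circle ≃ₜ Circle) {q : ℝ × ℝ} (hq : q ∈ square) :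
    ‖contractionMap φ q - q.1 * φ 1‖ = 1 - q.1 := by
  rw [contractionMap_sub, norm_mul, norm_one_sub_coe hq.1.2, norm_circleLoop, mul_one]

theorem contractionMap_injOn (φ : Circle ≃ₜ Circle) :
    InjOn (contractionMap φ) {q | q ∈ square ∧ ‖contractionMap φ q‖ < 1} := by
  rintro q ⟨hq, hq1⟩ r ⟨hr, hr1⟩ h
  have hs : q.1 = r.1 := by
    have h1 := (norm_sub_mul_eq_iff (Circle.norm_coe (φ 1)) hq1 hq.1.2).1
      (norm_contractionMap_sub φ hq)
    have h2 := (norm_sub_mul_eq_iff (Circle.norm_coe (φ 1)) hr1 hr.1.2).1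
      (norm_contractionMap_sub φ hr)
    rw [h1, h2, h]
  have hmid : ∀ q : ℝ × ℝ, q ∈ square → ‖contractionMap φ q‖ < 1 →
      q.1 < 1 ∧ 0 < q.2 ∧ q.2 < 1 := by
    intro q hq hq1
    refine ⟨lt_of_le_of_ne hq.1.2 fun h => ?_, lt_of_le_of_ne hq.2.1 fun h => ?_,
      lt_of_le_of_ne hq.2.2 fun h => ?_⟩
    · rw [contractionMap, h] at hq1
      simp only [Complex.ofReal_one, sub_self, zero_mul, one_mul, zero_add] at hq1
      rw [Circle.norm_coe] at hq1
      exact lt_irrefl _ hq1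
    · rw [show q = (q.1, 0) from Prod.ext rfl h.symm, contractionMap_side φ _ (circleLoop_zero φ),
        Circle.norm_coe] at hq1
      exact lt_irrefl _ hq1
    · rw [show q = (q.1, 1) from Prod.ext rfl h, contractionMap_side φ _ (circleLoop_one φ),
        Circle.norm_coe] at hq1
      exact lt_irrefl _ hq1
  obtain ⟨hq2, hq3, hq4⟩ := hmid q hq hq1
  obtain ⟨hr2, hr3, hr4⟩ := hmid r hr hr1
  have hu : circleLoop φ q.2 = circleLoop φ r.2 := by
    have h1 := contractionMap_sub φ q
    rw [h, hs, contractionMap_sub φ r] at h1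
    refine (mul_left_cancel₀ ?_ h1).symm
    rw [← Complex.ofReal_one, ← Complex.ofReal_sub, Complex.ofReal_ne_zero]
    linarith
  exact Prod.ext hs (eq_of_unitLoop_eq ((circleLoop_eq_iff φ).1 hu)
    (abs_lt.2 ⟨by linarith, by linarith⟩))

theorem exists_contractionMap_eq (φ : Circle ≃ₜ Circle) {z : ℂ} (hz : ‖z‖ < 1) :
    ∃ q ∈ square, contractionMap φ q = z := by
  set w : ℂ := ((φ 1 : Circle) : ℂ) with hwdef
  have hw : ‖w‖ = 1 := Circle.norm_coe _
  set s : ℝ := (1 - ‖z‖ ^ 2) / (2 * (1 - (z * conj w).re)) with hs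
  have hre : (z * conj w).re < 1 := by
    calc (z * conj w).re ≤ ‖z * conj w‖ := Complex.re_le_norm _
      _ = ‖z‖ := by rw [norm_mul, RCLike.norm_conj, hw, mul_one]
      _ < 1 := hz
  have hre' : (z * conj w).re ≤ ‖z‖ := by
    calc (z * conj w).re ≤ ‖z * conj w‖ := Complex.re_le_norm _
      _ = ‖z‖ := by rw [norm_mul, RCLike.norm_conj, hw, mul_one]
  have hs0 : 0 ≤ s := div_nonneg (by nlinarith [norm_nonneg z]) (by linarith)
  have hs1 : s < 1 := by
    rw [hs, div_lt_one (by linarith)]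
    nlinarith [norm_nonneg z]
  have hnorm := (norm_sub_mul_eq_iff hw hz hs1.le).2 hs
  have hne : (1 - (s : ℂ)) ≠ 0 := by
    rw [← Complex.ofReal_one, ← Complex.ofReal_sub, Complex.ofReal_ne_zero]
    linarith
  obtain ⟨t, ht, htz⟩ := exists_circleLoop_eq φ (z := (z - s * w) / (1 - (s : ℂ))) (by
    rw [norm_div, hnorm, norm_one_sub_coe hs1.le, div_self (by linarith)])
  refine ⟨(s, t), ⟨⟨hs0, hs1.le⟩, Ico_subset_Icc_self ht⟩, ?_⟩
  rw [contractionMap, htz, mul_div_cancel₀ _ hne, ← hwdef]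
  ring

/-- The linear contraction passes every interior point of the disk exactly once, so its fibres are
those of the immersion. -/
theorem sweepCount_linearContraction {F : ℂ → ℂ} {φ : Circle ≃ₜ Circle} {C : ℝ → ℂ}
    (hF : IsDiskImmersion F) (hC : IsBoundaryCurve F φ C) {x : ℂ}
    (hx : ∀ t ∈ Icc (0 : ℝ) 1, C t ≠ x) :
    sweepCount (linearContraction F φ) x = ((windingNumber C x).natAbs : ℕ∞) := by
  have hlt : ∀ z ∈ diskFiber F x, ‖z‖ < 1 := by
    intro z hz
    refine lt_of_le_of_ne (mem_disk_iff.1 hz.1) fun h1 => ?_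
    obtain ⟨t, ht, rfl⟩ := exists_circleLoop_eq φ h1
    refine hx t (Ico_subset_Icc_self ht) ?_
    rw [hC t (Ico_subset_Icc_self ht), ← hz.2]
    rfl
  have hbij : BijOn (contractionMap φ) (squareFiber (linearContraction F φ) x)
      (diskFiber F x) := by
    have hmaps : MapsTo (contractionMap φ) (squareFiber (linearContraction F φ) x)
        (diskFiber F x) := fun q hq => ⟨contractionMap_mem_disk φ hq.1, hq.2⟩
    have hsub : squareFiber (linearContraction F φ) x ⊆
        {q | q ∈ square ∧ ‖contractionMap φ q‖ < 1} := fun q hq => ⟨hq.1, hlt _ (hmaps hq)⟩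
    refine ⟨hmaps, (contractionMap_injOn φ).mono hsub, ?_⟩
    intro z hz
    obtain ⟨q, hq, hqz⟩ := exists_contractionMap_eq φ (hlt z hz)
    exact ⟨q, ⟨hq, by rw [linearContraction_eq, hqz, hz.2]⟩, hqz⟩
  have hfin : (squareFiber (linearContraction F φ) x).Finite :=
    (hbij.finite_iff_finite).2 (hF.finite_diskFiber x)
  rw [sweepCount_of_finite hfin, natAbs_windingNumber_eq_encard hF hC hx, ← hbij.image_eq,
    hbij.injOn.encard_image]

theorem isHomotopy_linearContraction {F : ℂ → ℂ} {φ : Circle ≃ₜ Circle} {C : ℝ → ℂ}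
    (hF : IsDiskImmersion F) (hC : IsBoundaryCurve F φ C) :
    IsHomotopy (C 0) C (fun _ => C 0) (linearContraction F φ) := by
  have h0 : C 0 = F (φ 1) := by
    rw [hC 0 (by simp)]
    simp
  refine ⟨?_, fun t ht => ⟨?_, ?_⟩, fun s _ => ⟨?_, ?_⟩⟩
  · exact hF.1.continuousOn.comp (continuous_contractionMap φ).continuousOn
      fun q hq => contractionMap_mem_disk φ hq
  · rw [linearContraction_eq, contractionMap_zero, hC t ht]
    rfl
  · rw [linearContraction_eq, h0]
    congr 1
    simp [contractionMap]
  · rw [linearContraction_eq, contractionMap_side φ _ (circleLoop_zero φ), h0]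
  · rw [linearContraction_eq, contractionMap_side φ _ (circleLoop_one φ), h0]

/-! ### Piecewise differentiability -/

/-- A curve is piecewise `C¹` if it is continuously differentiable on each piece of a partition of
`[0,1]`.  The derivative may vanish, so constant curves are included. -/
def IsPiecewiseC1 (C : ℝ → ℂ) : Prop :=
  ∃ (n : ℕ) (τ : ℕ → ℝ), τ 0 = 0 ∧ τ n = 1 ∧ ∀ i < n,
    τ i < τ (i + 1) ∧ ContDiffOn ℝ 1 C (Icc (τ i) (τ (i + 1)))

theorem exists_mem_Ico_partition {n : ℕ} {τ : ℕ → ℝ} {t : ℝ} (h0 : τ 0 ≤ t)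
    (hn : t < τ n) : ∃ i < n, t ∈ Ico (τ i) (τ (i + 1)) := by
  induction n with
  | zero => exact absurd hn (not_lt.2 h0)
  | succ n ih =>
    rcases lt_or_ge t (τ n) with h | h
    · obtain ⟨i, hi, hit⟩ := ih h
      exact ⟨i, hi.trans (Nat.lt_succ_self n), hit⟩
    · exact ⟨n, Nat.lt_succ_self n, h, hn⟩

theorem exists_mem_Icc_partition {n : ℕ} {τ : ℕ → ℝ} {t : ℝ} (h0 : τ 0 < τ n) (ht : τ 0 ≤ t)
    (hn : t ≤ τ n) : ∃ i < n, t ∈ Icc (τ i) (τ (i + 1)) := by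
  rcases hn.lt_or_eq with h | h
  · obtain ⟨i, hi, hit⟩ := exists_mem_Ico_partition ht h
    exact ⟨i, hi, Ico_subset_Icc_self hit⟩
  · cases n with
    | zero => exact absurd h0 (lt_irrefl _)
    | succ n =>
      by_cases h' : τ n ≤ t
      · exact ⟨n, Nat.lt_succ_self n, h', hn⟩
      · obtain ⟨i, hi, hit⟩ := exists_mem_Ico_partition ht (not_le.1 h')
        exact ⟨i, hi.trans (Nat.lt_succ_self n), Ico_subset_Icc_self hit⟩

theorem partition_le {n : ℕ} {τ : ℕ → ℝ} (h : ∀ i < n, τ i < τ (i + 1)) {i j : ℕ} (hij : i ≤ j)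
    (hj : j ≤ n) : τ i ≤ τ j := by
  induction j, hij using Nat.le_induction with
  | base => exact le_rfl
  | succ j hij ih => exact (ih (by omega)).trans (h j (by omega)).le

theorem partition_Icc_subset {n : ℕ} {τ : ℕ → ℝ} (h0 : τ 0 = 0) (hn : τ n = 1)
    (h : ∀ i < n, τ i < τ (i + 1)) {i : ℕ} (hi : i < n) :
    Icc (τ i) (τ (i + 1)) ⊆ Icc 0 1 := by
  rw [← h0, ← hn]
  exact Icc_subset_Icc (partition_le h (Nat.zero_le i) hi.le) (partition_le h hi le_rfl)

/-- It suffices to find pieces over which `H` is differentiable, indexed by any finite type. -/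
theorem IsPiecewiseDifferentiable.of_fintype {H : ℝ × ℝ → ℂ} {ι : Type*} [Finite ι]
    (P : ι → Set (ℝ × ℝ)) (hc : ∀ i, IsClosed (P i)) (hP : ⋃ i, P i = square)
    (hd : ∀ i, DifferentiableOn ℝ H (P i)) : IsPiecewiseDifferentiable H := by
  obtain ⟨n, ⟨e⟩⟩ := Finite.exists_equiv_fin ι
  refine ⟨n, fun i => P (e.symm i), fun i => hc _, ?_, fun i => hd _⟩
  rw [← hP]
  exact e.symm.iSup_comp (g := P)

/-- A homotopy that is differentiable over each piece of a partition of the curve parameter is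
piecewise differentiable. -/
theorem isPiecewiseDifferentiable_of_partition {H : ℝ × ℝ → ℂ} {n : ℕ} {τ : ℕ → ℝ}
    (h0 : τ 0 = 0) (hn : τ n = 1) (h : ∀ i < n, τ i < τ (i + 1))
    (hd : ∀ i < n, DifferentiableOn ℝ H (Icc 0 1 ×ˢ Icc (τ i) (τ (i + 1)))) :
    IsPiecewiseDifferentiable H := by
  refine ⟨n, fun i => Icc 0 1 ×ˢ Icc (τ i) (τ (i + 1)), fun i => isClosed_Icc.prod isClosed_Icc,
    ?_, fun i => hd i i.2⟩
  ext q
  simp only [mem_iUnion, square]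
  constructor
  · rintro ⟨i, h1, h2⟩
    exact ⟨h1, partition_Icc_subset h0 hn h i.2 h2⟩
  · rintro ⟨h1, h2⟩
    obtain ⟨i, hi, hit⟩ := exists_mem_Icc_partition (τ := τ) (n := n) (t := q.2)
      (by rw [h0, hn]; exact one_pos) (by rw [h0]; exact h2.1) (by rw [hn]; exact h2.2)
    exact ⟨⟨i, hi⟩, h1, hit⟩

/-- A continuous lift of a differentiable curve through an immersion is differentiable. -/
theorem IsDiskImmersion.differentiableWithinAt_of_comp {F : ℂ → ℂ} (hF : IsDiskImmersion F)
    {u : ℝ → ℂ} (hu : Continuous u) (hud : ∀ t, u t ∈ disk) {I : Set ℝ} {t : ℝ}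
    (h : DifferentiableWithinAt ℝ (fun t => F (u t)) I t) : DifferentiableWithinAt ℝ u I t := by
  set A := fderivWithin ℝ F disk (u t) with hA
  have hAi : Function.Injective A := hF.2 _ (hud t)
  let e : ℂ ≃L[ℝ] ℂ :=
    (LinearEquiv.ofInjectiveOfFinrankEq A.toLinearMap hAi rfl).toContinuousLinearEquiv
  have he : ∀ v, e v = A v := fun v => rfl
  have hut : Tendsto u (𝓝[I] t) (𝓝[disk] (u t)) :=
    tendsto_nhdsWithin_iff.2 ⟨hu.continuousWithinAt, Eventually.of_forall hud⟩
  have h1 := (hF.hasFDerivWithinAt (hud t)).isLittleO.comp_tendsto hut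
  simp only [Function.comp_def, ← hA] at h1
  have h2 := h.hasFDerivWithinAt
  set B := fderivWithin ℝ (fun t => F (u t)) I t with hB
  have h2o := h2.isLittleO
  have hbig1 : (fun p => u p - u t) =O[𝓝[I] t] fun p => A (u p - u t) := by
    refine (e.symm : ℂ →L[ℝ] ℂ).isBigO_comp (fun p => A (u p - u t)) (𝓝[I] t) |>.congr_left
      fun p => ?_
    change e.symm (A (u p - u t)) = _
    rw [← he, e.symm_apply_apply]
  have hbig2 : (fun p => A (u p - u t)) =O[𝓝[I] t] fun p => F (u p) - F (u t) := by
    have h3 : (fun p => F (u p) - F (u t) - A (u p - u t)) =o[𝓝[I] t] fun p => A (u p - u t) :=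
      h1.trans_isBigO hbig1
    exact h3.right_isBigO_add.congr_right fun q => by ring
  have hbig3 : (fun p => F (u p) - F (u t)) =O[𝓝[I] t] fun p => p - t := h2.isBigO_sub
  have hbig : (fun p => u p - u t) =O[𝓝[I] t] fun p => p - t := (hbig1.trans hbig2).trans hbig3
  have h4 : (fun p => A (u p - u t) - B (p - t)) =o[𝓝[I] t] fun p => p - t :=
    (h2o.sub (h1.trans_isBigO hbig)).congr_left fun p => by ring
  have h5 : (fun p => u p - u t - ((e.symm : ℂ →L[ℝ] ℂ).comp B) (p - t)) =o[𝓝[I] t]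
      fun p => p - t := by
    refine (((e.symm : ℂ →L[ℝ] ℂ).isBigO_comp _ (𝓝[I] t)).trans_isLittleO h4).congr_left
      fun p => ?_
    rw [map_sub]
    congr 1
    change e.symm (A (u p - u t)) = _
    rw [← he, e.symm_apply_apply]
  exact (HasFDerivWithinAt.of_isLittleO h5).differentiableWithinAt

/-- The linear contraction is differentiable over each piece of the curve, because `φ` is there a
lift of the curve through the immersion. -/
theorem isPiecewiseDifferentiable_linearContraction {F : ℂ → ℂ} {φ : Circle ≃ₜ Circle} {C : ℝ → ℂ}
    (hF : IsDiskImmersion F) (hC : IsBoundaryCurve F φ C) (hC1 : IsPiecewiseC1 C) :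
    IsPiecewiseDifferentiable (linearContraction F φ) := by
  obtain ⟨n, τ, h0, hn, hτ⟩ := hC1
  refine isPiecewiseDifferentiable_of_partition h0 hn (fun i hi => (hτ i hi).1) fun i hi => ?_
  have hsub := partition_Icc_subset h0 hn (fun i hi => (hτ i hi).1) hi
  have hu : DifferentiableOn ℝ (circleLoop φ) (Icc (τ i) (τ (i + 1))) := fun t ht =>
    hF.differentiableWithinAt_of_comp (continuous_circleLoop φ)
      (fun t => by rw [mem_disk_iff, norm_circleLoop])
      (((hτ i hi).2.differentiableOn one_ne_zero t ht).congr
        (fun p hp => (hC p (hsub hp)).symm) (hC t (hsub ht)).symm)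
  refine (hF.1.differentiableOn one_ne_zero).comp (t := disk) ?_
    fun q hq => contractionMap_mem_disk φ ⟨hq.1, hsub hq.2⟩
  have h1 : DifferentiableOn ℝ (fun q : ℝ × ℝ => circleLoop φ q.2)
      (Icc 0 1 ×ˢ Icc (τ i) (τ (i + 1))) :=
    hu.comp differentiableOn_snd fun q hq => hq.2
  have h2 : DifferentiableOn ℝ (fun q : ℝ × ℝ => (q.1 : ℂ)) (Icc 0 1 ×ˢ Icc (τ i) (τ (i + 1))) :=
    (Complex.ofRealCLM.differentiable.comp differentiable_fst).differentiableOn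
  exact (((differentiableOn_const _).sub h2).mul h1).add (h2.mul (differentiableOn_const _))

theorem IsPiecewiseC1.of_mem_normalCurves {p₀ : ℂ} {C : ℝ → ℂ} (hC : C ∈ normalCurves p₀) :
    IsPiecewiseC1 C ∧ IsClosedCurve C ∧ C 0 = p₀ := by
  rcases hC with ⟨hC, h0⟩ | hC
  · obtain ⟨hcl, n, τ, h1, h2, h3⟩ := hC.1
    exact ⟨⟨n, τ, h1, h2, fun i hi => ⟨(h3 i hi).1, (h3 i hi).2.1⟩⟩, hcl, h0⟩
  · refine ⟨⟨1, fun i => i, by simp, by simp, fun i hi => ?_⟩,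
      ⟨continuousOn_const.congr hC, by rw [hC 0 (by simp), hC 1 (by simp)]⟩, hC 0 (by simp)⟩
    obtain rfl : i = 0 := by omega
    refine ⟨by simp, ContDiffOn.congr (contDiffOn_const (c := p₀)) ?_⟩
    simpa using hC

/-! ### Counting preimages of Lipschitz maps of a rectangle -/

theorem encard_le_of_forall_finset {α : Type*} {s : Set α} {L : ENNReal}
    (h : ∀ t : Finset α, (t : Set α) ⊆ s → (t.card : ENNReal) ≤ L) : (s.encard : ENNReal) ≤ L := by
  have hk : ∀ k : ℕ, (k : ℕ∞) ≤ s.encard → (k : ENNReal) ≤ L := by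
    intro k hk
    obtain ⟨t, hts, htk⟩ := exists_subset_encard_eq hk
    have hfin : t.Finite := finite_of_encard_eq_coe htk
    have hc := h hfin.toFinset (by simpa using hts)
    rw [hfin.encard_eq_coe_toFinset_card] at htk
    rwa [show hfin.toFinset.card = k by exact_mod_cast htk] at hc
  rcases eq_or_ne s.encard ⊤ with h' | h'
  · have : L = ⊤ := ENNReal.eq_top_of_forall_nnreal_le fun r => by
      obtain ⟨k, hkr⟩ := exists_nat_ge r
      refine le_trans ?_ (hk k (by rw [h']; exact le_top))
      exact_mod_cast hkr
    rw [this]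
    exact le_top
  · obtain ⟨k, hk'⟩ := ENat.ne_top_iff_exists.1 h'
    rw [← hk']
    exact_mod_cast hk k hk'.le

theorem floor_mul_ne {x y : ℝ} (hx : 0 ≤ x) (hy : 0 ≤ y) {c : ℝ} (hc : 1 ≤ c * |x - y|)
    (hc0 : 0 < c) : ⌊x * c⌋₊ ≠ ⌊y * c⌋₊ := by
  intro h
  have h1 := Nat.floor_le (mul_nonneg hx hc0.le)
  have h2 := Nat.lt_floor_add_one (x * c)
  have h3 := Nat.floor_le (mul_nonneg hy hc0.le)
  have h4 := Nat.lt_floor_add_one (y * c)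
  rw [h] at h1 h2
  have : |x * c - y * c| < 1 := abs_lt.2 ⟨by linarith, by linarith⟩
  rw [← sub_mul, abs_mul, abs_of_pos hc0] at this
  linarith

/-- If the coordinates `ψ` embed `S` in a rectangle `[0,a] × [0,b]` and `f` is Lipschitz in these
coordinates, then the number of preimages of a point under `f` has an integral of order `a b`.
Cutting the rectangle into squares of side `1/n` covers the values of `f` by balls of radius `2/n`;
the number of balls that contain a point is in the limit at least its number of preimages. -/
theorem exists_measurable_ge_encard {α : Type*} {S : Set α} {ψ : α → ℝ × ℝ} {f : α → ℂ} {a b : ℝ}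
    (ha : 0 ≤ a) (hb : 0 ≤ b) (hinj : InjOn ψ S) (hψ : MapsTo ψ S (Icc 0 a ×ˢ Icc 0 b))
    (hf : ∀ p ∈ S, ∀ q ∈ S, dist (f p) (f q) ≤ |(ψ p).1 - (ψ q).1| + |(ψ p).2 - (ψ q).2|) :
    ∃ g : ℂ → ENNReal, Measurable g ∧ (∀ x, ({q | q ∈ S ∧ f q = x}.encard : ENNReal) ≤ g x) ∧
      ∫⁻ x, g x ≤ ENNReal.ofReal (16 * a * b) := by
  classical
  set c : ℕ → ℝ := fun n => n + 1 with hc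
  have hc0 : ∀ n, 0 < c n := fun n => by positivity
  set idx : ℕ → α → ℕ × ℕ := fun n p => (⌊(ψ p).1 * c n⌋₊, ⌊(ψ p).2 * c n⌋₊) with hidx
  set I : ℕ → Finset (ℕ × ℕ) := fun n =>
    Finset.range (⌊a * c n⌋₊ + 1) ×ˢ Finset.range (⌊b * c n⌋₊ + 1) with hI
  set ctr : ℕ → ℕ × ℕ → ℂ := fun n k =>
    if h : ∃ p, p ∈ S ∧ idx n p = k then f h.choose else 0 with hctr
  have hdist : ∀ n, ∀ p ∈ S, dist (f p) (ctr n (idx n p)) ≤ 2 / c n := by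
    intro n p hp
    have hex : ∃ p', p' ∈ S ∧ idx n p' = idx n p := ⟨p, hp, rfl⟩
    simp only [hctr, dif_pos hex]
    obtain ⟨h1, h2⟩ := hex.choose_spec
    set p' := hex.choose
    have hm := hψ hp
    have hm' := hψ h1
    have hclose : ∀ x y : ℝ, 0 ≤ x → 0 ≤ y → ⌊x * c n⌋₊ = ⌊y * c n⌋₊ → |x - y| ≤ 1 / c n := by
      intro x y hx hy hxy
      by_contra hlt
      refine floor_mul_ne hx hy ?_ (hc0 n) hxy
      rw [not_le, div_lt_iff₀ (hc0 n)] at hlt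
      linarith
    have h3 := hclose _ _ hm'.1.1 hm.1.1 (congrArg Prod.fst h2)
    have h4 := hclose _ _ hm'.2.1 hm.2.1 (congrArg Prod.snd h2)
    rw [abs_sub_comm] at h3 h4
    have h5 : 2 / c n = 1 / c n + 1 / c n := by ring
    linarith [hf p hp p' h1]
  set g : ℕ → ℂ → ENNReal := fun n x =>
    ∑ k ∈ I n, (Metric.closedBall (ctr n k) (2 / c n)).indicator 1 x with hg
  have hgm : ∀ n, Measurable (g n) := fun n =>
    Finset.measurable_fun_sum _ fun k _ =>
      measurable_one.indicator Metric.isClosed_closedBall.measurableSet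
  refine ⟨fun x => liminf (fun n => g n x) atTop, Measurable.liminf hgm, ?_, ?_⟩
  · intro x
    refine encard_le_of_forall_finset fun t ht => ?_
    refine le_liminf_of_le (by isBoundedDefault) ?_
    have hsep : ∀ᶠ n in atTop, ∀ p ∈ t, ∀ q ∈ t, p ≠ q → idx n p ≠ idx n q := by
      rw [Filter.eventually_all_finset]
      intro p hp
      rw [Filter.eventually_all_finset]
      intro q hq
      by_cases hpq : p = q
      · exact Eventually.of_forall fun n h => absurd hpq h
      have hψne : ψ p ≠ ψ q := fun h => hpq (hinj (ht hp).1 (ht hq).1 h)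
      have hpos : 0 < max |(ψ p).1 - (ψ q).1| |(ψ p).2 - (ψ q).2| := by
        by_contra h
        rw [not_lt, max_le_iff] at h
        have e1 := abs_nonpos_iff.1 h.1
        have e2 := abs_nonpos_iff.1 h.2
        exact hψne (Prod.ext (sub_eq_zero.1 e1) (sub_eq_zero.1 e2))
      obtain ⟨N, hN⟩ := exists_nat_gt (max |(ψ p).1 - (ψ q).1| |(ψ p).2 - (ψ q).2|)⁻¹
      filter_upwards [eventually_ge_atTop N] with n hn _ h
      have hcn : (max |(ψ p).1 - (ψ q).1| |(ψ p).2 - (ψ q).2|)⁻¹ ≤ c n := by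
        have : (N : ℝ) ≤ n := by exact_mod_cast hn
        simp only [hc]
        linarith
      rw [inv_le_iff_one_le_mul₀ hpos] at hcn
      have hp' := hψ (ht hp).1
      have hq' := hψ (ht hq).1
      rcases max_choice |(ψ p).1 - (ψ q).1| |(ψ p).2 - (ψ q).2| with h' | h'
      · rw [h'] at hcn
        exact floor_mul_ne hp'.1.1 hq'.1.1 hcn (hc0 n) (congrArg Prod.fst h)
      · rw [h'] at hcn
        exact floor_mul_ne hp'.2.1 hq'.2.1 hcn (hc0 n) (congrArg Prod.snd h)
    filter_upwards [hsep] with n hn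
    have himg : (t.image (idx n)).card = t.card :=
      Finset.card_image_of_injOn fun p hp q hq h => by
        by_contra hpq
        exact hn p hp q hq hpq h
    have hsub : t.image (idx n) ⊆ I n := by
      intro k hk
      obtain ⟨p, hp, rfl⟩ := Finset.mem_image.1 hk
      have hp' := hψ (ht hp).1
      simp only [hI, hidx, Finset.mem_product, Finset.mem_range, Nat.lt_succ_iff]
      exact ⟨Nat.floor_le_floor (mul_le_mul_of_nonneg_right hp'.1.2 (hc0 n).le),
        Nat.floor_le_floor (mul_le_mul_of_nonneg_right hp'.2.2 (hc0 n).le)⟩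
    calc (t.card : ENNReal) = ∑ k ∈ t.image (idx n), 1 := by rw [← himg]; simp
      _ = ∑ k ∈ t.image (idx n), (Metric.closedBall (ctr n k) (2 / c n)).indicator 1 x := by
        refine Finset.sum_congr rfl fun k hk => ?_
        obtain ⟨p, hp, rfl⟩ := Finset.mem_image.1 hk
        rw [indicator_of_mem]
        · rfl
        · rw [Metric.mem_closedBall, ← (ht hp).2]
          exact hdist n p (ht hp).1
      _ ≤ g n x := Finset.sum_le_sum_of_subset hsub
  · refine (lintegral_liminf_le hgm).trans ?_
    have hint : ∀ n, ∫⁻ x, g n x ≤ ENNReal.ofReal (16 * (a + 1 / c n) * (b + 1 / c n)) := by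
      intro n
      have h1 : ∫⁻ x, g n x = (I n).card * ENNReal.ofReal (4 * Real.pi / c n ^ 2) := by
        simp only [hg]
        rw [lintegral_finsetSum _ fun k _ =>
          measurable_one.indicator Metric.isClosed_closedBall.measurableSet]
        rw [Finset.sum_congr rfl fun k _ => by
          rw [lintegral_indicator_one Metric.isClosed_closedBall.measurableSet,
            Complex.volume_closedBall], Finset.sum_const, nsmul_eq_mul]
        congr 1
        rw [← ENNReal.ofReal_pow (by have := hc0 n; positivity),
          ← ENNReal.ofReal_coe_nnreal, ← ENNReal.ofReal_mul (by positivity)]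
        congr 1
        rw [NNReal.coe_real_pi]
        ring_nf
      have h2 : (((I n).card : ℕ) : ℝ) ≤ (a * c n + 1) * (b * c n + 1) := by
        simp only [hI, Finset.card_product, Finset.card_range]
        push_cast
        have e1 := Nat.floor_le (mul_nonneg ha (hc0 n).le)
        have e2 := Nat.floor_le (mul_nonneg hb (hc0 n).le)
        gcongr
      rw [h1, ← ENNReal.ofReal_natCast, ← ENNReal.ofReal_mul (by positivity)]
      apply ENNReal.ofReal_le_ofReal
      have h3 := hc0 n
      have h4 : 16 * (a + 1 / c n) * (b + 1 / c n) =
          (a * c n + 1) * (b * c n + 1) * (4 * 4 / c n ^ 2) := by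
        field_simp
        ring
      rw [h4]
      gcongr
      exact Real.pi_le_four
    have htend : Tendsto (fun n => ENNReal.ofReal (16 * (a + 1 / c n) * (b + 1 / c n))) atTop
        (𝓝 (ENNReal.ofReal (16 * a * b))) := by
      refine ENNReal.tendsto_ofReal ?_
      have h0 : Tendsto (fun n : ℕ => 1 / c n) atTop (𝓝 0) :=
        tendsto_one_div_add_atTop_nhds_zero_nat
      simpa using ((h0.const_add a).const_mul 16).mul (h0.const_add b)
    rw [← htend.liminf_eq]
    exact liminf_le_liminf (Eventually.of_forall hint)

/-! ### Null sets in the plane -/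

theorem volume_setOf_re_eq (c : ℝ) : volume {z : ℂ | z.re = c} = 0 := by
  have h := Complex.volume_preserving_equiv_real_prod.measure_preimage
    (s := {c} ×ˢ univ) ((measurableSet_singleton c).prod MeasurableSet.univ).nullMeasurableSet
  rw [Measure.volume_eq_prod, Measure.prod_prod, Real.volume_singleton, zero_mul] at h
  refine measure_mono_null (fun z hz => ?_) h
  exact ⟨hz, trivial⟩

theorem volume_setOf_im_eq (c : ℝ) : volume {z : ℂ | z.im = c} = 0 := by
  have h := Complex.volume_preserving_equiv_real_prod.measure_preimage
    (s := univ ×ˢ {c}) (MeasurableSet.univ.prod (measurableSet_singleton c)).nullMeasurableSet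
  rw [Measure.volume_eq_prod, Measure.prod_prod, Real.volume_singleton, mul_zero] at h
  refine measure_mono_null (fun z hz => ?_) h
  exact ⟨trivial, hz⟩

/-- The trace of a differentiable curve is a null set. -/
theorem volume_image_eq_zero {γ : ℝ → ℂ} {I : Set ℝ} (hγ : DifferentiableOn ℝ γ I) :
    volume (γ '' I) = 0 := by
  have h := addHaar_image_eq_zero_of_differentiableOn_of_addHaar_eq_zero volume
    (f := fun z : ℂ => γ z.re) (s := {z : ℂ | z.im = 0 ∧ z.re ∈ I})
    (hγ.comp (t := I) Complex.reCLM.differentiable.differentiableOn fun z hz => hz.2)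
    (measure_mono_null (fun z hz => hz.1) (volume_setOf_im_eq 0))
  refine measure_mono_null ?_ h
  rintro _ ⟨t, ht, rfl⟩
  exact ⟨t, ⟨by simp, by simpa using ht⟩, by simp⟩

theorem IsPiecewiseC1.volume_image {C : ℝ → ℂ} (hC : IsPiecewiseC1 C) :
    volume (C '' Icc 0 1) = 0 := by
  obtain ⟨n, τ, h0, hn, hτ⟩ := hC
  have : C '' Icc 0 1 ⊆ ⋃ i : Fin n, C '' Icc (τ i) (τ (i + 1)) := by
    rintro _ ⟨t, ht, rfl⟩
    obtain ⟨i, hi, hit⟩ := exists_mem_Icc_partition (τ := τ) (n := n) (t := t)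
      (by rw [h0, hn]; exact one_pos) (by rw [h0]; exact ht.1) (by rw [hn]; exact ht.2)
    exact mem_iUnion.2 ⟨⟨i, hi⟩, t, hit, rfl⟩
  refine measure_mono_null this (measure_iUnion_null fun i => ?_)
  exact volume_image_eq_zero ((hτ i i.2).2.differentiableOn one_ne_zero)

/-! ### Gluing a homotopy of closed curves to a contraction -/

/-- The path that runs straight from `p` to `p'`. -/
noncomputable def segmentPath (p p' : ℂ) (l : ℝ) : ℂ := (1 - (l : ℂ)) * p + l * p'

theorem differentiable_segmentPath (p p' : ℂ) : Differentiable ℝ (segmentPath p p') := by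
  have h : Differentiable ℝ fun l : ℝ => (l : ℂ) := Complex.ofRealCLM.differentiable
  unfold segmentPath
  fun_prop

/-- A homotopy through closed curves from `C` to `C'` along which the base point moves straight
from `p` to `p'`. -/
structure IsFreeHomotopy (p p' : ℂ) (C C' : ℝ → ℂ) (A : ℝ × ℝ → ℂ) : Prop where
  continuousOn : ContinuousOn A square
  piecewise : IsPiecewiseDifferentiable A
  left : ∀ t ∈ Icc (0 : ℝ) 1, A (0, t) = C t
  right : ∀ t ∈ Icc (0 : ℝ) 1, A (1, t) = C' t
  bottom : ∀ s ∈ Icc (0 : ℝ) 1, A (s, 0) = segmentPath p p' s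
  top : ∀ s ∈ Icc (0 : ℝ) 1, A (s, 1) = segmentPath p p' s

/-- The distance of a point of the parameter square from its sides other than `s = 0`. -/
noncomputable def sideDist (q : ℝ × ℝ) : ℝ := min q.2 (min (1 - q.2) (1 - q.1))

/-- The trapezoid between the side `s = 0` and the middle square. -/
def leftTrapezoid : Set (ℝ × ℝ) := {q | 0 ≤ q.1 ∧ q.1 ≤ 1 / 3 ∧ q.1 ≤ q.2 ∧ q.2 ≤ 1 - q.1}

/-- The middle square of the parameter square. -/
def middleSquare : Set (ℝ × ℝ) := Icc (1 / 3) (2 / 3) ×ˢ Icc (1 / 3) (2 / 3)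

/-- The three trapezoids between the middle square and the sides other than `s = 0`. -/
def outerTrapezoids : Set (ℝ × ℝ) := {q | q ∈ square ∧ sideDist q ≤ 1 / 3 ∧ sideDist q ≤ q.1}

/-- The coordinates on the left trapezoid that make it a square. -/
noncomputable def trapezoidChart (q : ℝ × ℝ) : ℝ × ℝ := (3 * q.1, (q.2 - q.1) / (1 - 2 * q.1))

/-- The coordinates on the middle square. -/
noncomputable def middleChart (q : ℝ × ℝ) : ℝ × ℝ := (3 * q.1 - 1, 3 * q.2 - 1)

open Classical in
/-- The homotopy `A` on the left trapezoid, followed by the contraction `B` on the middle square;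
the remaining trapezoids carry the track from `p` to `p'` of the base point under `A`, so that the
result keeps the base point `p`. -/
noncomputable def glue (p p' : ℂ) (A B : ℝ × ℝ → ℂ) (q : ℝ × ℝ) : ℂ :=
  if q ∈ leftTrapezoid then A (trapezoidChart q)
  else if q ∈ middleSquare then B (middleChart q)
  else segmentPath p p' (3 * sideDist q)

theorem continuous_sideDist : Continuous sideDist := by
  unfold sideDist
  fun_prop

theorem sideDist_cases (q : ℝ × ℝ) :
    sideDist q = q.2 ∨ sideDist q = 1 - q.2 ∨ sideDist q = 1 - q.1 := by
  unfold sideDist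
  rcases min_choice q.2 (min (1 - q.2) (1 - q.1)) with h | h
  · exact Or.inl h
  · rw [h]
    exact Or.inr (min_choice _ _)

theorem isClosed_leftTrapezoid : IsClosed leftTrapezoid :=
  (isClosed_le continuous_const continuous_fst).inter
    ((isClosed_le continuous_fst continuous_const).inter
      ((isClosed_le continuous_fst continuous_snd).inter
        (isClosed_le continuous_snd (continuous_const.sub continuous_fst))))

theorem isClosed_middleSquare : IsClosed middleSquare := isClosed_Icc.prod isClosed_Icc

theorem isClosed_outerTrapezoids : IsClosed outerTrapezoids :=
  isCompact_square.isClosed.inter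
    ((isClosed_le continuous_sideDist continuous_const).inter
      (isClosed_le continuous_sideDist continuous_fst))

theorem union_trapezoids : leftTrapezoid ∪ middleSquare ∪ outerTrapezoids = square := by
  ext ⟨s, t⟩
  simp only [leftTrapezoid, middleSquare, outerTrapezoids, square, sideDist, mem_union,
    mem_ofPred_eq, mem_prod, mem_Icc, min_le_iff]
  constructor
  · rintro ((⟨h1, h2, h3, h4⟩ | ⟨⟨h1, h2⟩, h3, h4⟩) | h)
    · exact ⟨⟨h1, by linarith⟩, by linarith, by linarith⟩
    · exact ⟨⟨by linarith, by linarith⟩, by linarith, by linarith⟩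
    · exact h.1
  · rintro ⟨⟨h1, h2⟩, h3, h4⟩
    by_cases hl : s ≤ 1 / 3 ∧ s ≤ t ∧ t ≤ 1 - s
    · exact Or.inl (Or.inl ⟨h1, hl⟩)
    by_cases hm : (1 / 3 ≤ s ∧ s ≤ 2 / 3) ∧ 1 / 3 ≤ t ∧ t ≤ 2 / 3
    · exact Or.inl (Or.inr hm)
    · refine Or.inr ⟨⟨⟨h1, h2⟩, h3, h4⟩, ?_, ?_⟩
      · by_contra hcon
        push Not at hcon
        grind
      · by_contra hcon
        push Not at hcon
        grind

theorem leftTrapezoid_subset : leftTrapezoid ⊆ square := by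
  rw [← union_trapezoids]
  exact subset_union_left.trans subset_union_left

theorem middleSquare_subset : middleSquare ⊆ square := by
  rw [← union_trapezoids]
  exact subset_union_right.trans subset_union_left

theorem trapezoidChart_mem {q : ℝ × ℝ} (hq : q ∈ leftTrapezoid) : trapezoidChart q ∈ square := by
  obtain ⟨h1, h2, h3, h4⟩ := hq
  have h5 : 0 < 1 - 2 * q.1 := by linarith
  refine ⟨⟨?_, ?_⟩, ?_, ?_⟩ <;> simp only [trapezoidChart]
  · linarith
  · linarith
  · exact div_nonneg (by linarith) h5.le
  · rw [div_le_one h5]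
    linarith

theorem trapezoidChart_injOn : InjOn trapezoidChart leftTrapezoid := by
  rintro ⟨s, t⟩ ⟨h1, h2, h3, h4⟩ ⟨s', t'⟩ _ h
  simp only [trapezoidChart, Prod.mk.injEq] at *
  obtain ⟨ha, hb⟩ := h
  have hs : s = s' := by linarith
  subst hs
  have h5 : 1 - 2 * s ≠ 0 := by linarith
  rw [div_left_inj' h5] at hb
  exact ⟨rfl, by linarith⟩

theorem differentiableOn_trapezoidChart : DifferentiableOn ℝ trapezoidChart leftTrapezoid := by
  intro q hq
  have h5 : 1 - 2 * q.1 ≠ 0 := by linarith [hq.1, hq.2.1]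
  have h : DifferentiableAt ℝ trapezoidChart q := by
    unfold trapezoidChart
    exact DifferentiableAt.prodMk (by fun_prop) (by fun_prop (disch := exact h5))
  exact h.differentiableWithinAt

theorem differentiable_middleChart : Differentiable ℝ middleChart := by
  unfold middleChart
  fun_prop

theorem middleChart_mem {q : ℝ × ℝ} (hq : q ∈ middleSquare) : middleChart q ∈ square := by
  obtain ⟨⟨h1, h2⟩, h3, h4⟩ := hq
  refine ⟨⟨?_, ?_⟩, ?_, ?_⟩ <;> simp only [middleChart] <;> linarith

section Glue

variable {p p' : ℂ} {C C' : ℝ → ℂ} {A B : ℝ × ℝ → ℂ}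

theorem glue_of_mem_left {q : ℝ × ℝ} (hq : q ∈ leftTrapezoid) :
    glue p p' A B q = A (trapezoidChart q) := if_pos hq

theorem glue_of_mem_middle (hA : IsFreeHomotopy p p' C C' A)
    (hB : IsHomotopy p' C' (fun _ => p') B) {q : ℝ × ℝ} (hq : q ∈ middleSquare) :
    glue p p' A B q = B (middleChart q) := by
  by_cases hl : q ∈ leftTrapezoid
  · rw [glue_of_mem_left hl]
    obtain ⟨s, t⟩ := q
    obtain ⟨h1, h2, h3, h4⟩ := hl
    obtain ⟨⟨h5, h6⟩, h7, h8⟩ := hq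
    simp only at *
    have hs : s = 1 / 3 := le_antisymm h2 h5
    subst hs
    have ht : 3 * t - 1 ∈ Icc (0 : ℝ) 1 := ⟨by linarith, by linarith⟩
    have e1 : trapezoidChart (1 / 3, t) = (1, 3 * t - 1) := by
      simp only [trapezoidChart, Prod.mk.injEq]
      constructor
      · norm_num
      · rw [div_eq_iff (by norm_num)]
        ring
    have e2 : middleChart (1 / 3, t) = (0, 3 * t - 1) := by
      simp only [middleChart, Prod.mk.injEq]
      exact ⟨by norm_num, trivial⟩
    rw [e1, e2, hA.right _ ht, (hB.2.1 _ ht).1]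
  · rw [glue, if_neg hl, if_pos hq]

theorem segmentPath_one : segmentPath p p' 1 = p' := by simp [segmentPath]

theorem segmentPath_zero : segmentPath p p' 0 = p := by simp [segmentPath]

theorem glue_of_mem_outer (hA : IsFreeHomotopy p p' C C' A)
    (hB : IsHomotopy p' C' (fun _ => p') B) {q : ℝ × ℝ} (hq : q ∈ outerTrapezoids) :
    glue p p' A B q = segmentPath p p' (3 * sideDist q) := by
  by_cases hl : q ∈ leftTrapezoid
  · rw [glue_of_mem_left hl]
    obtain ⟨s, t⟩ := q
    obtain ⟨h1, h2, h3, h4⟩ := hl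
    obtain ⟨_, -, hm⟩ := hq
    simp only at h1 h2 h3 h4 hm
    have hs : 3 * s ∈ Icc (0 : ℝ) 1 := ⟨by linarith, by linarith⟩
    have hsd : sideDist (s, t) = s :=
      le_antisymm hm (le_min h3 (le_min (by simp only; linarith) (by simp only; linarith)))
    have h5 : 1 - 2 * s ≠ 0 := by linarith
    have hcase : t = s ∨ 1 - t = s := by
      rcases sideDist_cases (s, t) with h | h | h <;> rw [hsd] at h <;> simp only at h
      · exact Or.inl h.symm
      · exact Or.inr h.symm
      · linarith
    rw [hsd]
    rcases hcase with rfl | h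
    · have : trapezoidChart (t, t) = (3 * t, 0) := by simp [trapezoidChart]
      rw [this, hA.bottom _ hs]
    · obtain rfl : t = 1 - s := by linarith
      have : trapezoidChart (s, 1 - s) = (3 * s, 1) := by
        simp only [trapezoidChart, Prod.mk.injEq, true_and]
        rw [div_eq_one_iff_eq h5]
        ring
      rw [this, hA.top _ hs]
  · by_cases hmid : q ∈ middleSquare
    · rw [glue, if_neg hl, if_pos hmid]
      obtain ⟨s, t⟩ := q
      obtain ⟨⟨h5, h6⟩, h7, h8⟩ := hmid
      obtain ⟨_, hm, -⟩ := hq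
      simp only at h5 h6 h7 h8
      have hsd : sideDist (s, t) = 1 / 3 :=
        le_antisymm hm (le_min h7 (le_min (by simp only; linarith) (by simp only; linarith)))
      have hs' : 3 * s - 1 ∈ Icc (0 : ℝ) 1 := ⟨by linarith, by linarith⟩
      have ht' : 3 * t - 1 ∈ Icc (0 : ℝ) 1 := ⟨by linarith, by linarith⟩
      rw [hsd, show (3 : ℝ) * (1 / 3) = 1 by norm_num, segmentPath_one, middleChart]
      rcases sideDist_cases (s, t) with h | h | h <;> rw [hsd] at h <;> simp only at h
      · simp only [show 3 * t - 1 = 0 by linarith, (hB.2.2 _ hs').1]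
      · simp only [show 3 * t - 1 = 1 by linarith, (hB.2.2 _ hs').2]
      · simp only [show 3 * s - 1 = 1 by linarith, (hB.2.1 _ ht').2]
    · rw [glue, if_neg hl, if_neg hmid]

theorem sideDist_nonneg {q : ℝ × ℝ} (hq : q ∈ square) : 0 ≤ sideDist q :=
  le_min hq.2.1 (le_min (by linarith [hq.2.2]) (by linarith [hq.1.2]))

theorem isHomotopy_glue (hA : IsFreeHomotopy p p' C C' A)
    (hB : IsHomotopy p' C' (fun _ => p') B) : IsHomotopy p C (fun _ => p) (glue p p' A B) := by
  have hside : ∀ q ∈ square, sideDist q = 0 → glue p p' A B q = p := by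
    intro q hq h
    rw [glue_of_mem_outer hA hB ⟨hq, by rw [h]; norm_num, by rw [h]; exact hq.1.1⟩, h, mul_zero,
      segmentPath_zero]
  refine ⟨?_, fun t ht => ⟨?_, ?_⟩, fun s hs => ⟨?_, ?_⟩⟩
  · rw [← union_trapezoids]
    refine ContinuousOn.union_of_isClosed (ContinuousOn.union_of_isClosed ?_ ?_
      isClosed_leftTrapezoid isClosed_middleSquare) ?_
      (isClosed_leftTrapezoid.union isClosed_middleSquare) isClosed_outerTrapezoids
    · exact (hA.continuousOn.comp differentiableOn_trapezoidChart.continuousOn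
        fun q hq => trapezoidChart_mem hq).congr fun q hq => glue_of_mem_left hq
    · exact (hB.1.comp differentiable_middleChart.continuous.continuousOn
        fun q hq => middleChart_mem hq).congr fun q hq => glue_of_mem_middle hA hB hq
    · exact ((differentiable_segmentPath p p').continuous.comp
        (continuous_const.mul continuous_sideDist)).continuousOn.congr
          fun q hq => glue_of_mem_outer hA hB hq
  · rw [glue_of_mem_left ⟨le_rfl, by norm_num, ht.1, by simpa using ht.2⟩]
    simp only [trapezoidChart, mul_zero, sub_zero, div_one]
    exact hA.left t ht
  · refine hside _ ⟨by simp, ht⟩ (le_antisymm ?_ (sideDist_nonneg ⟨by simp, ht⟩))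
    exact ((min_le_right _ _).trans (min_le_right _ _)).trans (by simp)
  · refine hside _ ⟨hs, by simp⟩ (le_antisymm ?_ (sideDist_nonneg ⟨hs, by simp⟩))
    exact min_le_left _ _
  · refine hside _ ⟨hs, by simp⟩ (le_antisymm ?_ (sideDist_nonneg ⟨hs, by simp⟩))
    exact ((min_le_right _ _).trans (min_le_left _ _)).trans (by simp)

theorem isPiecewiseDifferentiable_glue (hA : IsFreeHomotopy p p' C C' A)
    (hB : IsHomotopy p' C' (fun _ => p') B) (hBd : IsPiecewiseDifferentiable B) :
    IsPiecewiseDifferentiable (glue p p' A B) := by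
  obtain ⟨n, P, hPc, hPu, hPd⟩ := hA.piecewise
  obtain ⟨m, Q, hQc, hQu, hQd⟩ := hBd
  let d : Fin 3 → ℝ × ℝ → ℝ := ![fun q => q.2, fun q => 1 - q.2, fun q => 1 - q.1]
  have hdd : ∀ i, Differentiable ℝ (d i) := by
    intro i
    fin_cases i <;> simp [d]
  refine .of_fintype (ι := Fin n ⊕ Fin m ⊕ Fin 3) (Sum.elim
    (fun i => leftTrapezoid ∩ trapezoidChart ⁻¹' P i)
    (Sum.elim (fun i => middleSquare ∩ middleChart ⁻¹' Q i)
      fun i => outerTrapezoids ∩ {q | sideDist q = d i q})) ?_ ?_ ?_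
  · rintro (i | i | i)
    · exact differentiableOn_trapezoidChart.continuousOn.preimage_isClosed_of_isClosed
        isClosed_leftTrapezoid (hPc i)
    · exact isClosed_middleSquare.inter ((hQc i).preimage differentiable_middleChart.continuous)
    · exact isClosed_outerTrapezoids.inter
        (isClosed_eq continuous_sideDist (hdd i).continuous)
  · rw [← union_trapezoids, iUnion_sum, iUnion_sum]
    simp only [Sum.elim_inl, Sum.elim_inr, ← inter_iUnion, ← preimage_iUnion, hPu, hQu]
    rw [← union_assoc]
    congr 1
    · congr 1
      · exact inter_eq_left.2 fun q hq => trapezoidChart_mem hq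
      · exact inter_eq_left.2 fun q hq => middleChart_mem hq
    · refine inter_eq_left.2 fun q _ => mem_iUnion.2 ?_
      rcases sideDist_cases q with h | h | h
      exacts [⟨0, h⟩, ⟨1, h⟩, ⟨2, h⟩]
  · rintro (i | i | i)
    · exact ((hPd i).comp (differentiableOn_trapezoidChart.mono inter_subset_left)
        fun q hq => hq.2).congr fun q hq => glue_of_mem_left hq.1
    · exact ((hQd i).comp differentiable_middleChart.differentiableOn
        fun q hq => hq.2).congr fun q hq => glue_of_mem_middle hA hB hq.1
    · refine ((differentiable_segmentPath p p').comp
        ((hdd i).const_mul 3)).differentiableOn.congr fun q hq => ?_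
      rw [glue_of_mem_outer hA hB hq.1, show sideDist q = d i q from hq.2]
      rfl

/-- Off the track of the base point, the fibre of a glued homotopy consists of the fibres of its
two parts. -/
theorem sweepCount_glue_le (hA : IsFreeHomotopy p p' C C' A)
    (hB : IsHomotopy p' C' (fun _ => p') B) {x : ℂ} (hx : x ∉ segmentPath p p' '' Icc 0 1) :
    sweepCount (glue p p' A B) x ≤ (squareFiber A x).encard + sweepCount B x := by
  let Y := {q : ℝ × ℝ // q ∈ leftTrapezoid ∧ A (trapezoidChart q) = x}
  let W := {q : ℝ × ℝ // q ∈ square ∧ B q = x}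
  let X := {q : ℝ × ℝ // q ∈ square ∧ glue p p' A B q = x}
  have hback : ∀ q : ℝ × ℝ, q ∈ square → ((q.1 + 1) / 3, (q.2 + 1) / 3) ∈ middleSquare ∧
      middleChart ((q.1 + 1) / 3, (q.2 + 1) / 3) = q := by
    rintro ⟨s, t⟩ ⟨⟨h1, h2⟩, h3, h4⟩
    simp only at *
    refine ⟨⟨⟨?_, ?_⟩, ?_, ?_⟩, ?_⟩
    · simp only; linarith
    · simp only; linarith
    · simp only; linarith
    · simp only; linarith
    · simp only [middleChart]
      ext <;> simp only <;> ring
  let ιW : W → X := fun q => ⟨((q.1.1 + 1) / 3, (q.1.2 + 1) / 3),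
    middleSquare_subset (hback q.1 q.2.1).1, by
      rw [glue_of_mem_middle hA hB (hback q.1 q.2.1).1, (hback q.1 q.2.1).2, q.2.2]⟩
  have hιW : Continuous ιW := by
    refine Continuous.subtype_mk ?_ _
    fun_prop
  let ιY : Y → X := fun q => ⟨q.1, leftTrapezoid_subset q.2.1, by
    rw [glue_of_mem_left q.2.1, q.2.2]⟩
  let f : Y ⊕ ConnectedComponents W → ConnectedComponents X :=
    Sum.elim (fun y => ConnectedComponents.mk (ιY y)) hιW.connectedComponentsMap
  have hf : Function.Surjective f := by
    intro c
    obtain ⟨⟨q, hq, hqx⟩, rfl⟩ := ConnectedComponents.surjective_coe c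
    have hq' := hq
    rw [← union_trapezoids] at hq'
    rcases hq' with (hl | hm) | ho
    · exact ⟨Sum.inl ⟨q, hl, (glue_of_mem_left hl).symm.trans hqx⟩, rfl⟩
    · have hmc := glue_of_mem_middle hA hB hm
      refine ⟨Sum.inr (ConnectedComponents.mk ⟨middleChart q, middleChart_mem hm,
        by rw [← hmc, hqx]⟩), ?_⟩
      change ConnectedComponents.mk (ιW _) = _
      congr 1
      apply Subtype.ext
      simp only [ιW, middleChart]
      ext <;> simp only <;> ring
    · refine absurd ⟨3 * sideDist q, ⟨by linarith [sideDist_nonneg hq], by linarith [ho.2.1]⟩,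
        ?_⟩ hx
      rw [← glue_of_mem_outer hA hB ho, hqx]
  have h1 : ENat.card Y ≤ (squareFiber A x).encard := by
    let j : Y → squareFiber A x := fun q => ⟨trapezoidChart q.1, trapezoidChart_mem q.2.1, q.2.2⟩
    refine ENat.card_le_card_of_injective (f := j) fun q r h => ?_
    exact Subtype.ext (trapezoidChart_injOn q.2.1 r.2.1 (congrArg Subtype.val h))
  calc sweepCount (glue p p' A B) x ≤ ENat.card (Y ⊕ ConnectedComponents W) :=
        card_le_card_of_surjective hf
    _ = ENat.card Y + ENat.card (ConnectedComponents W) := ENat.card_sum _ _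
    _ ≤ _ := by gcongr; rfl

end Glue

/-! ### Linear homotopies between curves -/

/-- A piecewise `C¹` curve has bounded right derivatives. -/
theorem IsPiecewiseC1.exists_rightDeriv {C : ℝ → ℂ} (hC : IsPiecewiseC1 C) :
    ∃ L : ℝ, 0 ≤ L ∧ ∃ C' : ℝ → ℂ, ∀ t ∈ Ico (0 : ℝ) 1,
      HasDerivWithinAt C (C' t) (Ici t) t ∧ ‖C' t‖ ≤ L := by
  obtain ⟨n, τ, h0, hn, hτ⟩ := hC
  have hb : ∀ i, ∃ M : ℝ, i < n → ∀ t ∈ Icc (τ i) (τ (i + 1)),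
      ‖derivWithin C (Icc (τ i) (τ (i + 1))) t‖ ≤ M := by
    intro i
    by_cases hi : i < n
    · obtain ⟨M, hM⟩ := isCompact_Icc.exists_bound_of_continuousOn
        ((hτ i hi).2.continuousOn_derivWithin (uniqueDiffOn_Icc (hτ i hi).1) le_rfl)
      exact ⟨M, fun _ => hM⟩
    · exact ⟨0, fun h => absurd h hi⟩
  choose M hM using hb
  refine ⟨∑ i ∈ Finset.range n, |M i|, Finset.sum_nonneg fun i _ => abs_nonneg _, ?_⟩
  have hd : ∀ t, ∃ d : ℂ, t ∈ Ico (0 : ℝ) 1 →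
      HasDerivWithinAt C d (Ici t) t ∧ ‖d‖ ≤ ∑ i ∈ Finset.range n, |M i| := by
    intro t
    by_cases ht : t ∈ Ico (0 : ℝ) 1
    · obtain ⟨i, hi, hit⟩ := exists_mem_Ico_partition (τ := τ) (n := n) (t := t)
        (by rw [h0]; exact ht.1) (by rw [hn]; exact ht.2)
      refine ⟨_, fun _ => ⟨(((hτ i hi).2.differentiableOn one_ne_zero t
        (Ico_subset_Icc_self hit)).hasDerivWithinAt).mono_of_mem_nhdsWithin
          (mem_of_superset (Icc_mem_nhdsGE hit.2) (Icc_subset_Icc_left hit.1)), ?_⟩⟩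
      calc _ ≤ M i := hM i hi t (Ico_subset_Icc_self hit)
        _ ≤ |M i| := le_abs_self _
        _ ≤ _ := Finset.single_le_sum (f := fun i => |M i|) (fun i _ => abs_nonneg _)
          (Finset.mem_range.2 hi)
    · exact ⟨0, fun h => absurd h ht⟩
  choose C' hC' using hd
  exact ⟨C', hC'⟩

theorem IsPiecewiseC1.exists_lipschitz {C : ℝ → ℂ} (hC : IsPiecewiseC1 C)
    (hc : ContinuousOn C (Icc 0 1)) :
    ∃ L : ℝ, 0 ≤ L ∧ ∀ s ∈ Icc (0 : ℝ) 1, ∀ t ∈ Icc (0 : ℝ) 1, s ≤ t →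
      ‖C t - C s‖ ≤ L * (t - s) := by
  obtain ⟨L, hL, C', hC'⟩ := hC.exists_rightDeriv
  refine ⟨L, hL, fun s hs t ht hst => ?_⟩
  exact norm_image_sub_le_of_norm_deriv_right_le_segment (hc.mono (Icc_subset_Icc hs.1 ht.2))
    (fun x hx => (hC' x ⟨hs.1.trans hx.1, hx.2.trans_le ht.2⟩).1)
    (fun x hx => (hC' x ⟨hs.1.trans hx.1, hx.2.trans_le ht.2⟩).2) t ⟨hst, le_rfl⟩

/-- The straight-line homotopy from `C` to `C'`. -/
noncomputable def linearHomotopy (C C' : ℝ → ℂ) (q : ℝ × ℝ) : ℂ :=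
  segmentPath (C q.2) (C' q.2) q.1

theorem isFreeHomotopy_linearHomotopy {C C' : ℝ → ℂ} (hC1 : IsPiecewiseC1 C)
    (hC : IsClosedCurve C) (hC' : IsClosedCurve C')
    (hd : ∀ I ⊆ Icc (0 : ℝ) 1, DifferentiableOn ℝ C I → DifferentiableOn ℝ C' I) :
    IsFreeHomotopy (C 0) (C' 0) C C' (linearHomotopy C C') where
  continuousOn := by
    have h1 : ContinuousOn (fun q : ℝ × ℝ => C q.2) square :=
      hC.1.comp continuousOn_snd fun q hq => hq.2
    have h2 : ContinuousOn (fun q : ℝ × ℝ => C' q.2) square :=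
      hC'.1.comp continuousOn_snd fun q hq => hq.2
    have h3 : ContinuousOn (fun q : ℝ × ℝ => (q.1 : ℂ)) square :=
      (Complex.continuous_ofReal.comp continuous_fst).continuousOn
    exact ((continuousOn_const.sub h3).mul h1).add (h3.mul h2)
  piecewise := by
    obtain ⟨n, τ, h0, hn, hτ⟩ := hC1
    refine isPiecewiseDifferentiable_of_partition h0 hn (fun i hi => (hτ i hi).1) fun i hi => ?_
    have hdC := (hτ i hi).2.differentiableOn one_ne_zero
    have hdC' := hd _ (partition_Icc_subset h0 hn (fun i hi => (hτ i hi).1) hi) hdC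
    have h1 : DifferentiableOn ℝ (fun q : ℝ × ℝ => C q.2) (Icc 0 1 ×ˢ Icc (τ i) (τ (i + 1))) :=
      hdC.comp differentiableOn_snd fun q hq => hq.2
    have h2 : DifferentiableOn ℝ (fun q : ℝ × ℝ => C' q.2) (Icc 0 1 ×ˢ Icc (τ i) (τ (i + 1))) :=
      hdC'.comp differentiableOn_snd fun q hq => hq.2
    have h3 : DifferentiableOn ℝ (fun q : ℝ × ℝ => (q.1 : ℂ)) (Icc 0 1 ×ˢ Icc (τ i) (τ (i + 1))) :=
      (Complex.ofRealCLM.differentiable.comp differentiable_fst).differentiableOn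
    exact (((differentiableOn_const _).sub h3).mul h1).add (h3.mul h2)
  left := fun t _ => by simp [linearHomotopy, segmentPath]
  right := fun t _ => by simp [linearHomotopy, segmentPath]
  bottom := fun s _ => rfl
  top := fun s _ => by simp only [linearHomotopy, hC.2, hC'.2]

theorem dist_segmentPath_le {p p' q q' : ℂ} {s r : ℝ} (hs : s ∈ Icc (0 : ℝ) 1) {M : ℝ}
    (h : ‖p - q‖ ≤ M) (h' : ‖p' - q'‖ ≤ M) :
    ‖segmentPath p p' s - segmentPath q q' r‖ ≤ M + |s - r| * ‖q - q'‖ := by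
  have e : segmentPath p p' s - segmentPath q q' r =
      (1 - (s : ℂ)) * (p - q) + s * (p' - q') + -((s - r : ℝ) : ℂ) * (q - q') := by
    simp only [segmentPath]
    push_cast
    ring
  rw [e]
  refine (norm_add_le _ _).trans (add_le_add ((norm_add_le _ _).trans ?_) ?_)
  · rw [norm_mul, norm_mul, norm_one_sub_coe hs.2, Complex.norm_real, Real.norm_of_nonneg hs.1]
    nlinarith [hs.1, hs.2]
  · rw [norm_mul, norm_neg, Complex.norm_real, Real.norm_eq_abs]

/-- The straight-line homotopy between curves at distance `δ` sweeps an area of order `δ` times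
their lengths, which are bounded by the increment of `w`. -/
theorem exists_measurable_ge_encard_linearHomotopy {C C' : ℝ → ℂ} {δ : ℝ} (hδ : 0 < δ)
    {w : ℝ → ℝ} (hw : StrictMonoOn w (Icc 0 1))
    (hC : ∀ s ∈ Icc (0 : ℝ) 1, ∀ t ∈ Icc (0 : ℝ) 1, s ≤ t → ‖C t - C s‖ ≤ w t - w s)
    (hC' : ∀ s ∈ Icc (0 : ℝ) 1, ∀ t ∈ Icc (0 : ℝ) 1, s ≤ t → ‖C' t - C' s‖ ≤ w t - w s)
    (hCC : ∀ t ∈ Icc (0 : ℝ) 1, ‖C t - C' t‖ ≤ δ) :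
    ∃ g : ℂ → ENNReal, Measurable g ∧
      (∀ x, ((squareFiber (linearHomotopy C C') x).encard : ENNReal) ≤ g x) ∧
      ∫⁻ x, g x ≤ ENNReal.ofReal (16 * δ * (w 1 - w 0)) := by
  have h01 : w 0 < w 1 := hw (by simp) (by simp) one_pos
  have habs : ∀ D : ℝ → ℂ, (∀ s ∈ Icc (0 : ℝ) 1, ∀ t ∈ Icc (0 : ℝ) 1, s ≤ t →
      ‖D t - D s‖ ≤ w t - w s) → ∀ s ∈ Icc (0 : ℝ) 1, ∀ t ∈ Icc (0 : ℝ) 1,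
      ‖D s - D t‖ ≤ |(w s - w 0) - (w t - w 0)| := by
    intro D hD s hs t ht
    rw [sub_sub_sub_cancel_right]
    rcases le_total s t with h | h
    · rw [norm_sub_rev, abs_sub_comm]
      exact (hD s hs t ht h).trans (le_abs_self _)
    · exact (hD t ht s hs h).trans (le_abs_self _)
  refine exists_measurable_ge_encard (S := square) (ψ := fun q => (δ * q.1, w q.2 - w 0))
    hδ.le (sub_nonneg.2 h01.le) ?_ ?_ ?_
  · rintro ⟨s, t⟩ hq ⟨s', t'⟩ hq' h
    simp only [Prod.mk.injEq] at h
    have h1 : s = s' := mul_left_cancel₀ hδ.ne' h.1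
    have h2 : t = t' := hw.injOn hq.2 hq'.2 (by linarith [h.2])
    rw [h1, h2]
  · rintro ⟨s, t⟩ ⟨hs, ht⟩
    refine ⟨⟨mul_nonneg hδ.le hs.1, mul_le_of_le_one_right hδ.le hs.2⟩, ?_, ?_⟩
    · exact sub_nonneg.2 (hw.monotoneOn (by simp) ht ht.1)
    · exact sub_le_sub_right (hw.monotoneOn ht (by simp) ht.2) _
  · rintro ⟨s, t⟩ ⟨hs, ht⟩ ⟨s', t'⟩ ⟨hs', ht'⟩
    simp only at hs ht hs' ht'
    rw [dist_eq_norm]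
    refine (dist_segmentPath_le hs (habs C hC t ht t' ht') (habs C' hC' t ht t' ht')).trans ?_
    simp only
    rw [← mul_sub, abs_mul, abs_of_pos hδ, add_comm, mul_comm δ]
    gcongr
    exact hCC t' ht'

/-- The cone homotopy shows that the winding area is finite. -/
theorem windingArea_lt_top {C : ℝ → ℂ} (hC1 : IsPiecewiseC1 C) (hC : IsClosedCurve C) :
    windingArea C < ⊤ := by
  obtain ⟨L, hL, hLip⟩ := hC1.exists_lipschitz hC.1
  have hfree := isFreeHomotopy_linearHomotopy (C' := fun _ => C 0) hC1 hC
    ⟨continuousOn_const, rfl⟩ fun I _ _ => differentiableOn_const _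
  have hhom : IsHomotopy (C 0) C (fun _ => C 0) (linearHomotopy C fun _ => C 0) := by
    have hconst : ∀ s, segmentPath (C 0) (C 0) s = C 0 := fun s => by
      simp only [segmentPath]
      ring
    refine ⟨hfree.continuousOn, fun t ht => ⟨hfree.left t ht, hfree.right t ht⟩, fun s hs => ?_⟩
    rw [hfree.bottom s hs, hfree.top s hs, hconst]
    exact ⟨rfl, rfl⟩
  obtain ⟨g, -, hg, hgint⟩ := exists_measurable_ge_encard_linearHomotopy (C := C)
    (C' := fun _ => C 0) (δ := L + 1) (w := fun t => (L + 1) * t) (by linarith)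
    (fun s _ t _ hst => by simp only; nlinarith)
    (fun s hs t ht hst => (hLip s hs t ht hst).trans (by nlinarith))
    (fun s hs t ht hst => by simp only [sub_self, norm_zero]; nlinarith)
    (fun t ht => by
      have h := hLip 0 (by simp) t ht ht.1
      nlinarith [ht.1, ht.2])
  calc windingArea C ≤ homotopyArea (linearHomotopy C fun _ => C 0) :=
        windingArea_le_homotopyArea hhom hfree.piecewise
    _ ≤ ∫⁻ x, g x := lintegral_mono fun x =>
        (ENat.toENNReal_mono (sweepCount_le_encard _ x)).trans (hg x)
    _ ≤ _ := hgint
    _ < ⊤ := ENNReal.ofReal_lt_top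

/-! ### Stability of winding numbers -/

theorem windingNumber_eq_of_norm_sub_lt {C C' : ℝ → ℂ} (hC : IsClosedCurve C)
    (hC' : IsClosedCurve C') {x x' : ℂ}
    (h : ∀ t ∈ Icc (0 : ℝ) 1, ‖(C' t - x') - (C t - x)‖ < ‖C t - x‖) :
    windingNumber C' x' = windingNumber C x := by
  have hx : ∀ t ∈ Icc (0 : ℝ) 1, C t ≠ x := fun t ht h0 => by
    have := h t ht
    rw [h0, sub_self, norm_zero] at this
    exact absurd this (not_lt.2 (norm_nonneg _))
  have h1 := hasWindingNumber_sub_iff.2 (hasWindingNumber_windingNumber hC hx)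
  have h2 := h1.of_norm_sub_lt (γ' := fun t => C' t - x')
    ⟨hC.1.sub continuousOn_const, by simp only [hC.2]⟩
    ⟨hC'.1.sub continuousOn_const, by simp only [hC'.2]⟩ h
  exact (hasWindingNumber_sub_iff.1 h2).windingNumber_eq

theorem continuousOn_windingNumber {C : ℝ → ℂ} (hC : IsClosedCurve C) :
    ContinuousOn (windingNumber C) (C '' Icc 0 1)ᶜ := by
  have hcl : IsClosed (C '' Icc 0 1) := (isCompact_Icc.image_of_continuousOn hC.1).isClosed
  intro x hx
  refine ContinuousAt.continuousWithinAt ?_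
  obtain ⟨r, hr, hrx⟩ := Metric.isOpen_iff.1 hcl.isOpen_compl x hx
  have : windingNumber C =ᶠ[𝓝 x] fun _ => windingNumber C x := by
    filter_upwards [Metric.ball_mem_nhds x hr] with y hy
    refine windingNumber_eq_of_norm_sub_lt hC hC fun t ht => ?_
    have h1 : r ≤ ‖C t - x‖ := by
      by_contra hlt
      refine hrx (a := C t) ?_ ⟨t, ht, rfl⟩
      rw [Metric.mem_ball, dist_eq_norm]
      exact not_le.1 hlt
    rw [sub_sub_sub_cancel_left, ← dist_eq_norm, dist_comm]
    exact (Metric.mem_ball.1 hy).trans_le h1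
  exact continuousAt_const.congr this.symm

theorem windingNumber_eq_of_isPreconnected {C : ℝ → ℂ} (hC : IsClosedCurve C) {U : Set ℂ}
    (hU : IsPreconnected U) (hUC : ∀ t ∈ Icc (0 : ℝ) 1, C t ∉ U) {x y : ℂ} (hx : x ∈ U)
    (hy : y ∈ U) : windingNumber C x = windingNumber C y := by
  have hsub : U ⊆ (C '' Icc 0 1)ᶜ := by
    rintro z hz ⟨t, ht, rfl⟩
    exact hUC t ht hz
  exact hU.constant ((continuousOn_windingNumber hC).mono hsub) hx hy

theorem measurable_windingNumber {C : ℝ → ℂ} (hC : IsClosedCurve C) :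
    Measurable (windingNumber C) := by
  have hcl : IsClosed (C '' Icc 0 1) := (isCompact_Icc.image_of_continuousOn hC.1).isClosed
  refine measurable_to_countable' fun n => ?_
  have h1 : MeasurableSet ((C '' Icc 0 1)ᶜ ∩ windingNumber C ⁻¹' {n}) :=
    ((continuousOn_windingNumber hC).isOpen_inter_preimage hcl.isOpen_compl
      (isOpen_discrete _)).measurableSet
  have h2 : MeasurableSet (C '' Icc 0 1 ∩ windingNumber C ⁻¹' {n}) := by
    have h0 : ∀ x ∈ C '' Icc 0 1, windingNumber C x = 0 := by
      rintro _ ⟨t, ht, rfl⟩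
      exact windingNumber_eq_zero_of_mem ht rfl
    by_cases hn : n = 0
    · rw [inter_eq_left.2 fun x hx => by simp [h0 x hx, hn]]
      exact hcl.measurableSet
    · convert! MeasurableSet.empty
      refine eq_empty_of_forall_notMem fun x hx => hn ?_
      rw [← h0 x hx.1]
      exact hx.2.symm
  have := h2.union h1
  rwa [← union_inter_distrib_right, union_compl_self, univ_inter] at this

/-! ### Contractions of limits of boundary curves -/

/-- A limit of boundary curves of immersed disks has contractions that are optimal away from an
arbitrarily small neighbourhood of the curve: push it to a nearby boundary curve and contract that
curve through its disk. -/
theorem exists_contraction_of_limit {C : ℝ → ℂ} (hC1 : IsPiecewiseC1 C) (hC : IsClosedCurve C)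
    (hlim : ∀ ε > (0 : ℝ), ∃ C' : ℝ → ℂ, IsRegularSelfOverlapping C' ∧
        ∀ t ∈ Icc (0 : ℝ) 1, dist (C' t) (C t) < ε) {η : ℝ} (hη : 0 < η) :
    ∃ H : ℝ × ℝ → ℂ, IsHomotopy (C 0) C (fun _ => C 0) H ∧ IsPiecewiseDifferentiable H ∧
      ∀ x, (∀ t ∈ Icc (0 : ℝ) 1, η ≤ dist (C t) x) →
        sweepCount H x ≤ ((windingNumber C x).natAbs : ℕ∞) := by
  obtain ⟨C', ⟨hreg, hnorm, F, φ, hF, hb⟩, hclose⟩ := hlim η hη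
  obtain ⟨hC1', hC', -⟩ := IsPiecewiseC1.of_mem_normalCurves (p₀ := C' 0) (Or.inl ⟨hnorm, rfl⟩)
  have hA : IsFreeHomotopy (C 0) (C' 0) C C' (linearHomotopy C C') :=
    isFreeHomotopy_linearHomotopy hC1 hC hC' fun I hI _ =>
      (hreg.2.1.differentiableOn one_ne_zero).mono hI
  have hB := isHomotopy_linearContraction hF hb
  have hBd := isPiecewiseDifferentiable_linearContraction hF hb hC1'
  have hnear : ∀ t ∈ Icc (0 : ℝ) 1, ∀ s ∈ Icc (0 : ℝ) 1,
      dist (C t) (segmentPath (C t) (C' t) s) < η := by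
    intro t ht s hs
    have e : C t - segmentPath (C t) (C' t) s = s * (C t - C' t) := by
      simp only [segmentPath]
      ring
    rw [dist_eq_norm, e, norm_mul, Complex.norm_real, Real.norm_of_nonneg hs.1]
    have h1 := hclose t ht
    rw [dist_comm, dist_eq_norm] at h1
    nlinarith [hs.2, norm_nonneg (C t - C' t)]
  refine ⟨glue (C 0) (C' 0) (linearHomotopy C C') (linearContraction F φ), isHomotopy_glue hA hB,
    isPiecewiseDifferentiable_glue hA hB hBd, fun x hx => ?_⟩
  have hfib : squareFiber (linearHomotopy C C') x = ∅ := by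
    refine eq_empty_of_forall_notMem fun q hq => ?_
    have h1 := hnear q.2 hq.1.2 q.1 hq.1.1
    rw [show segmentPath (C q.2) (C' q.2) q.1 = x from hq.2] at h1
    exact absurd (hx q.2 hq.1.2) (not_le.2 h1)
  have hseg : x ∉ segmentPath (C 0) (C' 0) '' Icc 0 1 := by
    rintro ⟨s, hs, rfl⟩
    exact absurd (hx 0 (by simp)) (not_le.2 (hnear 0 (by simp) s hs))
  have hx' : ∀ t ∈ Icc (0 : ℝ) 1, C' t ≠ x := by
    intro t ht h
    have h1 := hnear t ht 1 (by simp)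
    rw [segmentPath_one, h] at h1
    exact absurd (hx t ht) (not_le.2 h1)
  have hwn : windingNumber C' x = windingNumber C x :=
    windingNumber_eq_of_norm_sub_lt hC hC' fun t ht => by
      rw [sub_sub_sub_cancel_right, ← dist_eq_norm, ← dist_eq_norm]
      exact (hclose t ht).trans_le (hx t ht)
  have h := sweepCount_glue_le hA hB hseg
  rwa [hfib, encard_empty, zero_add, sweepCount_linearContraction hF hb hx', hwn] at h

/-! ### Collapsing the plane to a grid -/

theorem strictMonoOn_smoothTransition : StrictMonoOn Real.smoothTransition (Ioo 0 1) := by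
  rintro x ⟨hx0, hx1⟩ y ⟨hy0, hy1⟩ hxy
  have hmono : ∀ {u v : ℝ}, 0 < u → u < v → expNegInvGlue u < expNegInvGlue v := by
    intro u v hu huv
    rw [expNegInvGlue, expNegInvGlue, if_neg (not_le.2 hu), if_neg (not_le.2 (hu.trans huv))]
    exact Real.exp_lt_exp.2 (neg_lt_neg (inv_strictAnti₀ hu huv))
  have h1 := hmono hx0 hxy
  have h2 : expNegInvGlue (1 - y) < expNegInvGlue (1 - x) := hmono (by linarith) (by linarith)
  have h3 := expNegInvGlue.pos_of_pos hx0
  have h4 := expNegInvGlue.pos_of_pos (sub_pos.2 hy1)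
  rw [Real.smoothTransition, Real.smoothTransition,
    div_lt_div_iff₀ (Real.smoothTransition.pos_denom x) (Real.smoothTransition.pos_denom y)]
  nlinarith

/-- A smooth staircase with `N` steps of width and height `δ`.  It climbs from `n δ` to
`(n + 1) δ` between `n δ - r` and `n δ + r`. -/
noncomputable def staircase (δ r : ℝ) (N : ℕ) (x : ℝ) : ℝ :=
  ∑ n ∈ Finset.range N, δ * Real.smoothTransition ((x - n * δ + r) / (2 * r))

/-- The derivative of the staircase. -/
noncomputable def staircaseDeriv (δ r : ℝ) (N : ℕ) (x : ℝ) : ℝ :=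
  ∑ n ∈ Finset.range N,
    δ * (deriv Real.smoothTransition ((x - n * δ + r) / (2 * r)) * (1 / (2 * r)))

theorem hasDerivAt_staircase (δ r : ℝ) (N : ℕ) (x : ℝ) :
    HasDerivAt (staircase δ r N) (staircaseDeriv δ r N x) x := by
  refine HasDerivAt.fun_sum fun n _ => HasDerivAt.const_mul δ ?_
  have h1 : HasDerivAt (fun x : ℝ => (x - n * δ + r) / (2 * r)) (1 / (2 * r)) x :=
    (((hasDerivAt_id x).sub_const _).add_const _).div_const _
  have h2 : DifferentiableAt ℝ Real.smoothTransition ((x - n * δ + r) / (2 * r)) :=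
    (Real.smoothTransition.contDiff (n := 1)).differentiable one_ne_zero _
  exact h2.hasDerivAt.comp x h1

theorem continuous_staircaseDeriv (δ r : ℝ) (N : ℕ) : Continuous (staircaseDeriv δ r N) := by
  have h : Continuous (deriv Real.smoothTransition) :=
    (Real.smoothTransition.contDiff (n := 1)).continuous_deriv le_rfl
  unfold staircaseDeriv
  fun_prop

theorem staircaseDeriv_nonneg {δ r : ℝ} (hδ : 0 ≤ δ) (hr : 0 ≤ r) (N : ℕ) (x : ℝ) :
    0 ≤ staircaseDeriv δ r N x :=
  Finset.sum_nonneg fun _ _ => mul_nonneg hδ (mul_nonneg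
    Real.smoothTransition.monotone.deriv_nonneg (by positivity))

theorem differentiable_staircase (δ r : ℝ) (N : ℕ) : Differentiable ℝ (staircase δ r N) :=
  fun x => (hasDerivAt_staircase δ r N x).differentiableAt

/-- The staircase climbs at most one step over one period. -/
theorem staircase_sub_le {δ : ℝ} (hδ : 0 ≤ δ) (r : ℝ) (N : ℕ) (x : ℝ) :
    staircase δ r N x - staircase δ r N (x - δ) ≤ δ := by
  have h : staircase δ r N x - staircase δ r N (x - δ) =
      ∑ n ∈ Finset.range N, (δ * Real.smoothTransition ((x - (n : ℕ) * δ + r) / (2 * r)) -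
        δ * Real.smoothTransition ((x - ((n + 1 : ℕ) : ℝ) * δ + r) / (2 * r))) := by
    rw [staircase, staircase, ← Finset.sum_sub_distrib]
    refine Finset.sum_congr rfl fun n _ => ?_
    push_cast
    ring_nf
  rw [h, Finset.sum_range_sub' fun n : ℕ =>
    δ * Real.smoothTransition ((x - (n : ℝ) * δ + r) / (2 * r)), ← mul_sub]
  refine mul_le_of_le_one_right hδ ?_
  linarith [Real.smoothTransition.le_one ((x - ((0 : ℕ) : ℝ) * δ + r) / (2 * r)),
    Real.smoothTransition.nonneg ((x - (N : ℝ) * δ + r) / (2 * r))]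

/-- Every point lies either on a rising part of the staircase or on a step. -/
theorem staircase_cases {δ r : ℝ} (hr : 0 < r) (hδ : 2 * r ≤ δ) (N : ℕ) (x : ℝ) :
    (∃ m < N, |x - m * δ| < r ∧ staircase δ r N x =
      m * δ + δ * Real.smoothTransition ((x - m * δ + r) / (2 * r))) ∨
    ∃ m ≤ N, staircase δ r N x = m * δ ∧ (m = 0 ∨ (m - 1) * δ + r ≤ x) ∧
      (x ≤ m * δ - r ∨ m = N) := by
  have hδ0 : 0 < δ := by linarith
  induction N with
  | zero => exact Or.inr ⟨0, le_rfl, by simp [staircase], Or.inl rfl, Or.inr rfl⟩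
  | succ N ih =>
    have hsucc : staircase δ r (N + 1) x =
        staircase δ r N x + δ * Real.smoothTransition ((x - N * δ + r) / (2 * r)) :=
      Finset.sum_range_succ _ _
    have hzero : x ≤ N * δ - r → Real.smoothTransition ((x - N * δ + r) / (2 * r)) = 0 :=
      fun h => Real.smoothTransition.zero_of_nonpos
        (div_nonpos_of_nonpos_of_nonneg (by linarith) (by linarith))
    rcases ih with ⟨m, hm, hx, he⟩ | ⟨m, hm, he, h1, h2⟩
    · left
      have hmN : (m : ℝ) + 1 ≤ N := by exact_mod_cast hm
      refine ⟨m, by omega, hx, ?_⟩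
      rw [hsucc, hzero, he, mul_zero, add_zero]
      have := (abs_lt.1 hx).2
      nlinarith
    · rcases hm.lt_or_eq with hlt | rfl
      · right
        have hmN : (m : ℝ) + 1 ≤ N := by exact_mod_cast hlt
        have hx : x ≤ m * δ - r := h2.resolve_right hlt.ne
        refine ⟨m, by omega, ?_, h1, Or.inl hx⟩
        rw [hsucc, hzero, he, mul_zero, add_zero]
        nlinarith
      · rcases le_or_gt x (m * δ - r) with hx | hx
        · exact Or.inr ⟨m, by omega, by rw [hsucc, hzero hx, he, mul_zero, add_zero], h1,
            Or.inl hx⟩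
        · rcases lt_or_ge x (m * δ + r) with hx' | hx'
          · exact Or.inl ⟨m, by omega, abs_lt.2 ⟨by linarith, by linarith⟩, by rw [hsucc, he]⟩
          · refine Or.inr ⟨m + 1, le_rfl, ?_, Or.inr (by push_cast; linarith), Or.inr rfl⟩
            rw [hsucc, he, Real.smoothTransition.one_of_one_le
              ((one_le_div (by linarith)).2 (by linarith))]
            push_cast
            ring

theorem abs_staircase_sub_le {δ r : ℝ} (hr : 0 < r) (hδ : 2 * r ≤ δ) {N : ℕ} {x : ℝ} (hx0 : 0 ≤ x)
    (hxN : x ≤ N * δ) : |staircase δ r N x - x| ≤ 2 * δ := by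
  rcases staircase_cases hr hδ N x with ⟨m, -, hx, he⟩ | ⟨m, -, he, h1, h2⟩
  · obtain ⟨h3, h4⟩ := abs_lt.1 hx
    have h5 := mul_le_of_le_one_right (by linarith : 0 ≤ δ)
      (Real.smoothTransition.le_one ((x - m * δ + r) / (2 * r)))
    have h6 := mul_nonneg (by linarith : 0 ≤ δ)
      (Real.smoothTransition.nonneg ((x - m * δ + r) / (2 * r)))
    rw [he, abs_le]
    constructor <;> linarith
  · have hle : x ≤ m * δ := by
      rcases h2 with h | rfl
      · linarith
      · exact hxN
    have hge : m * δ - δ ≤ x := by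
      rcases h1 with rfl | h
      · simp only [CharP.cast_eq_zero, zero_mul]
        linarith
      · linarith
    rw [he, abs_le]
    constructor <;> linarith

/-- A value that is not the height of a step is taken on a rising part only. -/
theorem exists_of_staircase_eq {δ r : ℝ} (hr : 0 < r) (hδ : 2 * r ≤ δ) {N : ℕ} {x y : ℝ}
    (hxy : staircase δ r N x = y) (hy : ∀ m : ℕ, y ≠ m * δ) :
    ∃ m < N, |x - m * δ| < r ∧ y ∈ Ioo (m * δ) ((m + 1) * δ) ∧
      y = m * δ + δ * Real.smoothTransition ((x - m * δ + r) / (2 * r)) := by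
  rcases staircase_cases hr hδ N x with ⟨m, hm, hx, he⟩ | ⟨m, -, he, -, -⟩
  · have he' := hxy.symm.trans he
    refine ⟨m, hm, hx, ⟨?_, ?_⟩, he'⟩
    · have := Real.smoothTransition.pos_of_pos (x := (x - m * δ + r) / (2 * r))
        (div_pos (by linarith [(abs_lt.1 hx).1]) (by linarith))
      nlinarith
    · have := Real.smoothTransition.lt_one_of_lt_one (x := (x - m * δ + r) / (2 * r))
        ((div_lt_one (by linarith)).2 (by linarith [(abs_lt.1 hx).2]))
      nlinarith
  · exact absurd (hxy.symm.trans he) (hy m)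

theorem eq_of_staircase_eq {δ r : ℝ} (hr : 0 < r) (hδ : 2 * r ≤ δ) {N : ℕ} {x x' y : ℝ}
    (hxy : staircase δ r N x = y) (hxy' : staircase δ r N x' = y) (hy : ∀ m : ℕ, y ≠ m * δ) :
    x = x' := by
  have hδ0 : 0 < δ := by linarith
  obtain ⟨m, -, hx, ⟨h1, h2⟩, he⟩ := exists_of_staircase_eq hr hδ hxy hy
  obtain ⟨m', -, hx', ⟨h1', h2'⟩, he'⟩ := exists_of_staircase_eq hr hδ hxy' hy
  obtain rfl : m = m' := by
    have e1 : (m : ℝ) < m' + 1 := lt_of_mul_lt_mul_right (h1.trans h2') hδ0.le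
    have e2 : (m' : ℝ) < m + 1 := lt_of_mul_lt_mul_right (h1'.trans h2) hδ0.le
    have e1' : m < m' + 1 := by exact_mod_cast e1
    have e2' : m' < m + 1 := by exact_mod_cast e2
    omega
  have hmem : ∀ {u : ℝ}, |u - m * δ| < r → (u - m * δ + r) / (2 * r) ∈ Ioo (0 : ℝ) 1 := by
    intro u hu
    obtain ⟨h3, h4⟩ := abs_lt.1 hu
    exact ⟨div_pos (by linarith) (by linarith), (div_lt_one (by linarith)).2 (by linarith)⟩
  have hS : Real.smoothTransition ((x - m * δ + r) / (2 * r)) =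
      Real.smoothTransition ((x' - m * δ + r) / (2 * r)) :=
    mul_left_cancel₀ hδ0.ne' (by linarith)
  have h5 := strictMonoOn_smoothTransition.injOn (hmem hx) (hmem hx') hS
  rw [div_left_inj' (by linarith)] at h5
  linarith

/-- The staircase in both coordinates, with origin `o`.  It collapses the plane to the lines of a
square grid of mesh `δ`, except that it stretches the open squares of half-width `r` around the
points `o + (m + k i) δ` over the cells of the grid. -/
noncomputable def gridMap (δ r : ℝ) (N : ℕ) (o z : ℂ) : ℂ :=
  ((o.re + staircase δ r N (z.re - o.re) : ℝ) : ℂ) +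
    ((o.im + staircase δ r N (z.im - o.im) : ℝ) : ℂ) * Complex.I

theorem gridMap_re (δ r : ℝ) (N : ℕ) (o z : ℂ) :
    (gridMap δ r N o z).re = o.re + staircase δ r N (z.re - o.re) := by simp [gridMap]

theorem gridMap_im (δ r : ℝ) (N : ℕ) (o z : ℂ) :
    (gridMap δ r N o z).im = o.im + staircase δ r N (z.im - o.im) := by simp [gridMap]

theorem differentiable_gridMap (δ r : ℝ) (N : ℕ) (o : ℂ) : Differentiable ℝ (gridMap δ r N o) := by
  have h1 : Differentiable ℝ fun z : ℂ => o.re + staircase δ r N (z.re - o.re) :=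
    ((differentiable_staircase δ r N).comp
      (Complex.reCLM.differentiable.sub_const _)).const_add _
  have h2 : Differentiable ℝ fun z : ℂ => o.im + staircase δ r N (z.im - o.im) :=
    ((differentiable_staircase δ r N).comp
      (Complex.imCLM.differentiable.sub_const _)).const_add _
  exact (Complex.ofRealCLM.differentiable.comp h1).add
    ((Complex.ofRealCLM.differentiable.comp h2).mul_const _)

theorem norm_gridMap_sub_le {δ r : ℝ} (hr : 0 < r) (hδ : 2 * r ≤ δ) {N : ℕ} {o z : ℂ}
    (hre : z.re - o.re ∈ Icc 0 (N * δ)) (him : z.im - o.im ∈ Icc 0 (N * δ)) :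
    ‖z - gridMap δ r N o z‖ ≤ 4 * δ := by
  rw [norm_sub_rev]
  refine (Complex.norm_le_abs_re_add_abs_im _).trans ?_
  rw [Complex.sub_re, Complex.sub_im, gridMap_re, gridMap_im]
  have h1 := abs_staircase_sub_le hr hδ hre.1 hre.2
  have h2 := abs_staircase_sub_le hr hδ him.1 him.2
  rw [show staircase δ r N (z.re - o.re) - (z.re - o.re) =
    o.re + staircase δ r N (z.re - o.re) - z.re by ring] at h1
  rw [show staircase δ r N (z.im - o.im) - (z.im - o.im) =
    o.im + staircase δ r N (z.im - o.im) - z.im by ring] at h2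
  linarith

/-- The point `o + (m + k i) δ`. -/
noncomputable def latticePoint (δ : ℝ) (o : ℂ) (v : ℕ × ℕ) : ℂ :=
  o + (((v.1 : ℝ) * δ : ℝ) + ((v.2 : ℝ) * δ : ℝ) * Complex.I)

/-- The closed square of half-width `r` around a lattice point. -/
def latticeBox (δ r : ℝ) (o : ℂ) (v : ℕ × ℕ) : Set ℂ :=
  {z | |z.re - o.re - v.1 * δ| ≤ r ∧ |z.im - o.im - v.2 * δ| ≤ r}

/-- The open cell of the grid whose lower left corner is a lattice point. -/
def gridCell (δ : ℝ) (o : ℂ) (v : ℕ × ℕ) : Set ℂ :=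
  {z | z.re - o.re ∈ Ioo (v.1 * δ) ((v.1 + 1) * δ) ∧ z.im - o.im ∈ Ioo (v.2 * δ) ((v.2 + 1) * δ)}

theorem latticePoint_mem_latticeBox {δ r : ℝ} (hr : 0 ≤ r) (o : ℂ) (v : ℕ × ℕ) :
    latticePoint δ o v ∈ latticeBox δ r o v := by
  constructor <;> simp [latticePoint, hr]

theorem isPreconnected_latticeBox (δ r : ℝ) (o : ℂ) (v : ℕ × ℕ) :
    IsPreconnected (latticeBox δ r o v) := by
  refine Convex.isPreconnected ?_
  have h : latticeBox δ r o v =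
      Complex.reCLM ⁻¹' Icc (o.re + v.1 * δ - r) (o.re + v.1 * δ + r) ∩
        Complex.imCLM ⁻¹' Icc (o.im + v.2 * δ - r) (o.im + v.2 * δ + r) := by
    ext z
    simp only [latticeBox, mem_ofPred_eq, abs_le, mem_inter_iff, mem_preimage, mem_Icc,
      Complex.reCLM_apply, Complex.imCLM_apply]
    constructor
    · rintro ⟨⟨h1, h2⟩, h3, h4⟩
      exact ⟨⟨by linarith, by linarith⟩, by linarith, by linarith⟩
    · rintro ⟨⟨h1, h2⟩, h3, h4⟩
      exact ⟨⟨by linarith, by linarith⟩, by linarith, by linarith⟩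
  rw [h]
  exact ((convex_Icc _ _).linear_preimage Complex.reCLM.toLinearMap).inter
    ((convex_Icc _ _).linear_preimage Complex.imCLM.toLinearMap)

theorem isClosed_latticeBox (δ r : ℝ) (o : ℂ) (v : ℕ × ℕ) : IsClosed (latticeBox δ r o v) := by
  have h1 : IsClosed {z : ℂ | |z.re - o.re - v.1 * δ| ≤ r} :=
    isClosed_le ((Complex.continuous_re.sub continuous_const).sub continuous_const).abs
      continuous_const
  have h2 : IsClosed {z : ℂ | |z.im - o.im - v.2 * δ| ≤ r} :=
    isClosed_le ((Complex.continuous_im.sub continuous_const).sub continuous_const).abs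
      continuous_const
  exact h1.inter h2

theorem exists_of_gridMap_eq {δ r : ℝ} (hr : 0 < r) (hδ : 2 * r ≤ δ) {N : ℕ} {o z y : ℂ}
    (h : gridMap δ r N o z = y) (hre : ∀ m : ℕ, y.re - o.re ≠ m * δ)
    (him : ∀ m : ℕ, y.im - o.im ≠ m * δ) :
    ∃ v ∈ Finset.range N ×ˢ Finset.range N, z ∈ latticeBox δ r o v ∧ y ∈ gridCell δ o v := by
  have h1 : staircase δ r N (z.re - o.re) = y.re - o.re := by rw [← h, gridMap_re]; ring
  have h2 : staircase δ r N (z.im - o.im) = y.im - o.im := by rw [← h, gridMap_im]; ring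
  obtain ⟨m, hm, hx, hy, -⟩ := exists_of_staircase_eq hr hδ h1 hre
  obtain ⟨k, hk, hx', hy', -⟩ := exists_of_staircase_eq hr hδ h2 him
  exact ⟨(m, k), by simp [hm, hk], ⟨hx.le, hx'.le⟩, hy, hy'⟩

theorem eq_of_gridMap_eq {δ r : ℝ} (hr : 0 < r) (hδ : 2 * r ≤ δ) {N : ℕ} {o z z' y : ℂ}
    (h : gridMap δ r N o z = y) (h' : gridMap δ r N o z' = y)
    (hre : ∀ m : ℕ, y.re - o.re ≠ m * δ) (him : ∀ m : ℕ, y.im - o.im ≠ m * δ) : z = z' := by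
  have h1 : staircase δ r N (z.re - o.re) = y.re - o.re := by rw [← h, gridMap_re]; ring
  have h2 : staircase δ r N (z.im - o.im) = y.im - o.im := by rw [← h, gridMap_im]; ring
  have h1' : staircase δ r N (z'.re - o.re) = y.re - o.re := by rw [← h', gridMap_re]; ring
  have h2' : staircase δ r N (z'.im - o.im) = y.im - o.im := by rw [← h', gridMap_im]; ring
  exact Complex.ext (by linarith [eq_of_staircase_eq hr hδ h1 h1' hre])
    (by linarith [eq_of_staircase_eq hr hδ h2 h2' him])

theorem volume_setOf_re_mem_im_mem {s t : Set ℝ} (hs : MeasurableSet s) (ht : MeasurableSet t) :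
    volume {z : ℂ | z.re ∈ s ∧ z.im ∈ t} = volume s * volume t := by
  have h := Complex.volume_preserving_equiv_real_prod.measure_preimage
    (s := s ×ˢ t) (hs.prod ht).nullMeasurableSet
  rw [Measure.volume_eq_prod, Measure.prod_prod] at h
  exact h

theorem gridCell_eq (δ : ℝ) (o : ℂ) (v : ℕ × ℕ) : gridCell δ o v =
    {z : ℂ | z.re ∈ Ioo (o.re + v.1 * δ) (o.re + (v.1 + 1) * δ) ∧
      z.im ∈ Ioo (o.im + v.2 * δ) (o.im + (v.2 + 1) * δ)} := by
  ext z
  simp only [gridCell, mem_ofPred_eq, mem_Ioo, lt_sub_iff_add_lt', sub_lt_iff_lt_add']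

theorem measurableSet_gridCell (δ : ℝ) (o : ℂ) (v : ℕ × ℕ) : MeasurableSet (gridCell δ o v) := by
  rw [gridCell_eq]
  exact (Complex.measurable_re measurableSet_Ioo).inter (Complex.measurable_im measurableSet_Ioo)

theorem volume_gridCell (δ : ℝ) (o : ℂ) (v : ℕ × ℕ) :
    volume (gridCell δ o v) = ENNReal.ofReal δ ^ 2 := by
  rw [gridCell_eq, volume_setOf_re_mem_im_mem measurableSet_Ioo measurableSet_Ioo, Real.volume_Ioo,
    Real.volume_Ioo, sq]
  congr 2 <;> ring

theorem sweepCount_congr {H H' : ℝ × ℝ → ℂ} {x x' : ℂ}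
    (h : ∀ q ∈ square, H q = x ↔ H' q = x') : sweepCount H x = sweepCount H' x' := by
  have : (fun q : ℝ × ℝ => q ∈ square ∧ H q = x) = fun q => q ∈ square ∧ H' q = x' := by
    funext q
    exact propext (and_congr_right fun hq => h q hq)
  unfold sweepCount
  rw [this]

/-- The collapsed homotopy covers a cell of the grid as often as the homotopy covers the point that
is stretched over the cell. -/
theorem ae_sweepCount_gridMap_le {C : ℝ → ℂ} (hC : IsClosedCurve C) {H : ℝ × ℝ → ℂ} {δ r : ℝ}
    (hr : 0 < r) (hδ : 2 * r ≤ δ) {N : ℕ} {o : ℂ}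
    (havoid : ∀ v ∈ Finset.range N ×ˢ Finset.range N, ∀ t ∈ Icc (0 : ℝ) 1,
      C t ∉ latticeBox δ r o v)
    (hH : ∀ v ∈ Finset.range N ×ˢ Finset.range N, ∀ x ∈ latticeBox δ r o v,
      sweepCount H x ≤ ((windingNumber C x).natAbs : ℕ∞)) :
    ∀ᵐ y : ℂ, (sweepCount (fun q => gridMap δ r N o (H q)) y : ENNReal) ≤
      ∑ v ∈ Finset.range N ×ˢ Finset.range N, (gridCell δ o v).indicator
        (fun _ => ((windingNumber C (latticePoint δ o v)).natAbs : ENNReal)) y := by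
  have a1 : ∀ᵐ y : ℂ, ∀ m : ℕ, y.re - o.re ≠ m * δ := by
    refine ae_all_iff.2 fun m => ?_
    filter_upwards [measure_eq_zero_iff_ae_notMem.1 (volume_setOf_re_eq (o.re + m * δ))] with y hy h
    exact hy (show y.re = o.re + m * δ by linarith)
  have a2 : ∀ᵐ y : ℂ, ∀ m : ℕ, y.im - o.im ≠ m * δ := by
    refine ae_all_iff.2 fun m => ?_
    filter_upwards [measure_eq_zero_iff_ae_notMem.1 (volume_setOf_im_eq (o.im + m * δ))] with y hy h
    exact hy (show y.im = o.im + m * δ by linarith)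
  filter_upwards [a1, a2] with y h1 h2
  by_cases hex : ∃ q ∈ square, gridMap δ r N o (H q) = y
  · obtain ⟨q, hq, hqy⟩ := hex
    obtain ⟨v, hv, hbox, hcell⟩ := exists_of_gridMap_eq hr hδ hqy h1 h2
    have e1 : sweepCount (fun q => gridMap δ r N o (H q)) y = sweepCount H (H q) :=
      sweepCount_congr fun q' _ => ⟨fun h => eq_of_gridMap_eq hr hδ h hqy h1 h2,
        fun h => by rw [h, hqy]⟩
    have e2 : windingNumber C (H q) = windingNumber C (latticePoint δ o v) :=
      windingNumber_eq_of_isPreconnected hC (isPreconnected_latticeBox δ r o v) (havoid v hv) hbox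
        (latticePoint_mem_latticeBox hr.le o v)
    have e3 := hH v hv _ hbox
    rw [← e1, e2] at e3
    refine (ENat.toENNReal_mono e3).trans ?_
    refine le_trans (le_of_eq ?_) (Finset.single_le_sum (f := fun v => (gridCell δ o v).indicator
        (fun _ => ((windingNumber C (latticePoint δ o v)).natAbs : ENNReal)) y)
        (fun _ _ => bot_le) hv)
    simp only [indicator_of_mem hcell, ENat.toENNReal_coe]
  · have hempty : squareFiber (fun q => gridMap δ r N o (H q)) y = ∅ :=
      eq_empty_of_forall_notMem fun q hq => hex ⟨q, hq.1, hq.2⟩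
    have := sweepCount_le_encard (fun q => gridMap δ r N o (H q)) y
    rw [hempty, encard_empty] at this
    rw [le_antisymm this bot_le]
    simp

/-! ### Averaging over the origins of the grid -/

theorem setLIntegral_re_mul_im {s t : Set ℝ} (hs : MeasurableSet s) (ht : MeasurableSet t)
    {f g : ℝ → ENNReal} (hf : Measurable f) (hg : Measurable g) :
    ∫⁻ z in {z : ℂ | z.re ∈ s ∧ z.im ∈ t}, f z.re * g z.im =
      (∫⁻ x in s, f x) * ∫⁻ y in t, g y := by
  have h := Complex.volume_preserving_equiv_real_prod.setLIntegral_comp_preimage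
    (hs.prod ht) (f := fun p : ℝ × ℝ => f p.1 * g p.2)
    ((hf.comp measurable_fst).mul (hg.comp measurable_snd))
  rw [Measure.volume_eq_prod, ← Measure.prod_restrict,
    lintegral_prod_mul hf.aemeasurable hg.aemeasurable] at h
  exact h

/-- The square with lower left corner `a + a i` from which the origin of the grid is chosen. -/
def originSquare (a δ : ℝ) : Set ℂ := {o | o.re ∈ Ioc a (a + δ) ∧ o.im ∈ Ioc a (a + δ)}

theorem measurableSet_originSquare (a δ : ℝ) : MeasurableSet (originSquare a δ) :=
  (Complex.measurable_re measurableSet_Ioc).inter (Complex.measurable_im measurableSet_Ioc)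

theorem volume_originSquare (a δ : ℝ) : volume (originSquare a δ) = ENNReal.ofReal δ ^ 2 := by
  rw [originSquare, volume_setOf_re_mem_im_mem measurableSet_Ioc measurableSet_Ioc, Real.volume_Ioc,
    add_sub_cancel_left, sq]

theorem lintegral_staircaseDeriv_le {δ r : ℝ} (hδ : 0 < δ) (hr : 0 < r) (N : ℕ) (a x : ℝ) :
    ∫⁻ u in Ioc a (a + δ), ENNReal.ofReal (staircaseDeriv δ r N (x - u)) ≤ ENNReal.ofReal δ := by
  have hc : Continuous fun u => staircaseDeriv δ r N (x - u) :=
    (continuous_staircaseDeriv δ r N).comp (continuous_const.sub continuous_id)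
  rw [← ofReal_integral_eq_lintegral_ofReal
    (hc.integrableOn_Icc.mono_set Ioc_subset_Icc_self)
    (Eventually.of_forall fun u => staircaseDeriv_nonneg hδ.le hr.le N _),
    ← intervalIntegral.integral_of_le (by linarith),
    intervalIntegral.integral_comp_sub_left (staircaseDeriv δ r N) x,
    intervalIntegral.integral_eq_sub_of_hasDerivAt (fun y _ => hasDerivAt_staircase δ r N y)
      ((continuous_staircaseDeriv δ r N).intervalIntegrable _ _), ← sub_sub]
  exact ENNReal.ofReal_le_ofReal (staircase_sub_le hδ.le r N (x - a))

/-- A bound for the factor by which the grid map stretches the curve `D` at the time `t`. -/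
noncomputable def gridSpeed (δ r : ℝ) (N : ℕ) (D : ℝ → ℂ) (o : ℂ) (t : ℝ) : ℝ :=
  staircaseDeriv δ r N ((D t).re - o.re) + staircaseDeriv δ r N ((D t).im - o.im)

theorem gridSpeed_nonneg {δ r : ℝ} (hδ : 0 ≤ δ) (hr : 0 ≤ r) (N : ℕ) (D : ℝ → ℂ) (o : ℂ) (t : ℝ) :
    0 ≤ gridSpeed δ r N D o t :=
  add_nonneg (staircaseDeriv_nonneg hδ hr N _) (staircaseDeriv_nonneg hδ hr N _)

theorem continuous_gridSpeed_uncurry (δ r : ℝ) (N : ℕ) {D : ℝ → ℂ} (hD : Continuous D) :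
    Continuous fun p : ℂ × ℝ => gridSpeed δ r N D p.1 p.2 := by
  have h1 : Continuous fun p : ℂ × ℝ => (D p.2).re - p.1.re :=
    (Complex.continuous_re.comp (hD.comp continuous_snd)).sub
      (Complex.continuous_re.comp continuous_fst)
  have h2 : Continuous fun p : ℂ × ℝ => (D p.2).im - p.1.im :=
    (Complex.continuous_im.comp (hD.comp continuous_snd)).sub
      (Complex.continuous_im.comp continuous_fst)
  have h3 := (continuous_staircaseDeriv δ r N).comp h1
  have h4 := (continuous_staircaseDeriv δ r N).comp h2
  unfold gridSpeed
  exact h3.add h4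

theorem continuous_gridSpeed (δ r : ℝ) (N : ℕ) {D : ℝ → ℂ} (hD : Continuous D) (o : ℂ) :
    Continuous (gridSpeed δ r N D o) := by
  have h := (continuous_gridSpeed_uncurry δ r N hD).comp (Continuous.prodMk_right (Y := ℝ) o)
  simpa only [Function.comp_def] using h

/-- On average over the origin the grid map stretches a curve only by a bounded factor, although
it stretches small squares over whole cells. -/
theorem setLIntegral_gridSpeed_le {δ r : ℝ} (hδ : 0 < δ) (hr : 0 < r) (N : ℕ) (a : ℝ) {D : ℝ → ℂ}
    (hD : Continuous D) :
    ∫⁻ o in originSquare a δ, ∫⁻ t in Ioc (0 : ℝ) 1, ENNReal.ofReal (gridSpeed δ r N D o t) ≤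
      2 * ENNReal.ofReal δ ^ 2 := by
  have hpoint : ∀ z : ℂ, ∫⁻ o in originSquare a δ,
      ENNReal.ofReal (staircaseDeriv δ r N (z.re - o.re) + staircaseDeriv δ r N (z.im - o.im)) ≤
        2 * ENNReal.ofReal δ ^ 2 := by
    intro z
    have hm : ∀ x : ℝ, Measurable fun u : ℝ => ENNReal.ofReal (staircaseDeriv δ r N (x - u)) :=
      fun x => ((continuous_staircaseDeriv δ r N).comp
        (continuous_const.sub continuous_id)).measurable.ennreal_ofReal
    have h1 := setLIntegral_re_mul_im (s := Ioc a (a + δ)) (t := Ioc a (a + δ)) measurableSet_Ioc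
      measurableSet_Ioc (hm z.re) (measurable_const (a := 1))
    have h2 := setLIntegral_re_mul_im (s := Ioc a (a + δ)) (t := Ioc a (a + δ)) measurableSet_Ioc
      measurableSet_Ioc (measurable_const (a := 1)) (hm z.im)
    simp only [mul_one, one_mul, setLIntegral_one, Real.volume_Ioc, add_sub_cancel_left] at h1 h2
    simp_rw [ENNReal.ofReal_add (staircaseDeriv_nonneg hδ.le hr.le N _)
      (staircaseDeriv_nonneg hδ.le hr.le N _)]
    have h3 : Measurable fun o : ℂ => ENNReal.ofReal (staircaseDeriv δ r N (z.re - o.re)) :=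
      (hm z.re).comp Complex.measurable_re
    rw [lintegral_add_left h3, originSquare, h1, h2, two_mul, sq]
    gcongr <;> exact lintegral_staircaseDeriv_le hδ hr N a _
  rw [lintegral_lintegral_swap
    (continuous_gridSpeed_uncurry δ r N hD).measurable.ennreal_ofReal.aemeasurable]
  calc _ ≤ ∫⁻ _t in Ioc (0 : ℝ) 1, 2 * ENNReal.ofReal δ ^ 2 := lintegral_mono fun t => hpoint (D t)
    _ = _ := by simp

/-- The total winding of a curve around the lattice points, weighted with the area of a cell. -/
noncomputable def latticeWinding (δ : ℝ) (N : ℕ) (C : ℝ → ℂ) (o : ℂ) : ENNReal :=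
  ∑ v ∈ Finset.range N ×ˢ Finset.range N,
    ENNReal.ofReal δ ^ 2 * ((windingNumber C (latticePoint δ o v)).natAbs : ENNReal)

theorem measurable_natAbs_windingNumber {C : ℝ → ℂ} (hC : IsClosedCurve C) :
    Measurable fun x => ((windingNumber C x).natAbs : ENNReal) :=
  (measurable_from_top (f := fun n : ℤ => (n.natAbs : ENNReal))).comp (measurable_windingNumber hC)

theorem measurable_latticePoint (δ : ℝ) (v : ℕ × ℕ) : Measurable fun o => latticePoint δ o v :=
  measurable_id.add_const _

theorem measurable_latticeWinding (δ : ℝ) (N : ℕ) {C : ℝ → ℂ} (hC : IsClosedCurve C) :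
    Measurable (latticeWinding δ N C) :=
  Finset.measurable_fun_sum _ fun v _ =>
    ((measurable_natAbs_windingNumber hC).comp (measurable_latticePoint δ v)).const_mul _

/-- On average over the origin the weighted winding around the lattice points is at most the
winding area. -/
theorem setLIntegral_latticeWinding_le {δ : ℝ} (hδ : 0 < δ) (N : ℕ) (a : ℝ) {C : ℝ → ℂ}
    (hC : IsClosedCurve C) :
    ∫⁻ o in originSquare a δ, latticeWinding δ N C o ≤ ENNReal.ofReal δ ^ 2 * windingArea C := by
  have hm := measurable_natAbs_windingNumber hC
  set Q : ℕ × ℕ → Set ℂ := fun v => {z | z.re ∈ Ioc (a + v.1 * δ) (a + (v.1 + 1) * δ) ∧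
    z.im ∈ Ioc (a + v.2 * δ) (a + (v.2 + 1) * δ)} with hQ
  have hQm : ∀ v, MeasurableSet (Q v) := fun v =>
    (Complex.measurable_re measurableSet_Ioc).inter (Complex.measurable_im measurableSet_Ioc)
  have hshift : ∀ v, ∫⁻ o in originSquare a δ,
      ((windingNumber C (latticePoint δ o v)).natAbs : ENNReal) =
        ∫⁻ x in Q v, ((windingNumber C x).natAbs : ENNReal) := by
    intro v
    have h := (measurePreserving_add_right (volume : Measure ℂ)
      (((v.1 : ℝ) * δ : ℝ) + ((v.2 : ℝ) * δ : ℝ) * Complex.I)).setLIntegral_comp_preimage (hQm v) hm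
    rw [← h]
    refine congrArg (fun S => ∫⁻ o in S,
      ((windingNumber C (latticePoint δ o v)).natAbs : ENNReal)) ?_
    ext z
    simp only [originSquare, hQ, mem_preimage, mem_ofPred_eq, mem_Ioc, Complex.add_re,
      Complex.add_im, Complex.re_ofReal_mul, Complex.im_ofReal_mul, Complex.I_re, Complex.I_im,
      Complex.ofReal_re, Complex.ofReal_im, mul_zero, mul_one, add_zero, zero_add]
    constructor
    · rintro ⟨⟨h1, h2⟩, h3, h4⟩
      exact ⟨⟨by linarith, by linarith⟩, by linarith, by linarith⟩
    · rintro ⟨⟨h1, h2⟩, h3, h4⟩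
      exact ⟨⟨by linarith, by linarith⟩, by linarith, by linarith⟩
  have hdisj : Pairwise (Function.onFun Disjoint Q) := by
    have hlt : ∀ {x : ℝ} {m k : ℕ}, x ∈ Ioc (a + m * δ) (a + (m + 1) * δ) →
        x ∈ Ioc (a + k * δ) (a + (k + 1) * δ) → m = k := by
      intro x m k hm hk
      have e1 : (m : ℝ) < k + 1 := lt_of_mul_lt_mul_right (by linarith [hm.1, hk.2]) hδ.le
      have e2 : (k : ℝ) < m + 1 := lt_of_mul_lt_mul_right (by linarith [hk.1, hm.2]) hδ.le
      have e1' : m < k + 1 := by exact_mod_cast e1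
      have e2' : k < m + 1 := by exact_mod_cast e2
      omega
    intro v v' hne
    refine Set.disjoint_left.2 fun z hz hz' => hne ?_
    exact Prod.ext (hlt hz.1 hz'.1) (hlt hz.2 hz'.2)
  have hmv : ∀ v, Measurable fun o => ((windingNumber C (latticePoint δ o v)).natAbs : ENNReal) :=
    fun v => hm.comp (measurable_latticePoint δ v)
  unfold latticeWinding
  rw [lintegral_finsetSum _ fun v _ => (hmv v).const_mul _,
    Finset.sum_congr rfl fun v _ => lintegral_const_mul _ (hmv v), ← Finset.mul_sum]
  gcongr
  rw [Finset.sum_congr rfl fun v _ => hshift v,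
    ← lintegral_biUnion_finset (fun v _ v' _ h => hdisj h) fun v _ => hQm v]
  exact setLIntegral_le_lintegral _ _

/-- For almost every origin the curve avoids the lattice points. -/
theorem volume_setOf_exists_eq_latticePoint {C : ℝ → ℂ} (hC1 : IsPiecewiseC1 C) (δ : ℝ)
    (s : Finset (ℕ × ℕ)) :
    volume {o : ℂ | ∃ v ∈ s, ∃ t ∈ Icc (0 : ℝ) 1, C t = latticePoint δ o v} = 0 := by
  have : {o : ℂ | ∃ v ∈ s, ∃ t ∈ Icc (0 : ℝ) 1, C t = latticePoint δ o v} =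
      ⋃ v ∈ s, (fun o => o + (((v.1 : ℝ) * δ : ℝ) + ((v.2 : ℝ) * δ : ℝ) * Complex.I)) ⁻¹'
        (C '' Icc 0 1) := by
    ext o
    simp only [mem_ofPred_eq, mem_iUnion, mem_preimage, mem_image, exists_prop, latticePoint]
  rw [this]
  refine (measure_biUnion_null_iff s.countable_toSet).2 fun v _ => ?_
  rw [measure_preimage_add_right]
  exact hC1.volume_image

/-- Squares that shrink to points off the curve are eventually off the curve. -/
theorem eventually_forall_notMem_latticeBox {C : ℝ → ℂ} (hC : IsClosedCurve C) {δ : ℝ} {o : ℂ}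
    {s : Finset (ℕ × ℕ)} (h : ∀ v ∈ s, ∀ t ∈ Icc (0 : ℝ) 1, C t ≠ latticePoint δ o v)
    {r : ℕ → ℝ} (hr : Tendsto r atTop (𝓝 0)) :
    ∀ᶠ k in atTop, ∀ v ∈ s, ∀ t ∈ Icc (0 : ℝ) 1, C t ∉ latticeBox δ (r k) o v := by
  rw [Filter.eventually_all_finset]
  intro v hv
  have hcl : IsClosed (C '' Icc 0 1) := (isCompact_Icc.image_of_continuousOn hC.1).isClosed
  obtain ⟨ε, hε, hball⟩ := Metric.isOpen_iff.1 hcl.isOpen_compl (latticePoint δ o v) (by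
    rintro ⟨t, ht, hte⟩
    exact h v hv t ht hte)
  filter_upwards [hr.eventually_lt_const (half_pos hε)] with k hk t ht hbox
  refine hball (a := C t) ?_ ⟨t, ht, rfl⟩
  rw [Metric.mem_ball, dist_eq_norm]
  refine (Complex.norm_le_abs_re_add_abs_im _).trans_lt ?_
  have e1 : (C t - latticePoint δ o v).re = (C t).re - o.re - v.1 * δ := by
    simp [latticePoint]
    ring
  have e2 : (C t - latticePoint δ o v).im = (C t).im - o.im - v.2 * δ := by
    simp [latticePoint]
    ring
  rw [e1, e2]
  linarith [hbox.1, hbox.2]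

/-- Some origin is at least as good as the average, for infinitely many of the shrinking grid
maps. -/
theorem exists_origin {C : ℝ → ℂ} (hC1 : IsPiecewiseC1 C) (hC : IsClosedCurve C) {D : ℝ → ℂ}
    (hD : Continuous D) {δ : ℝ} (hδ : 0 < δ) {r : ℕ → ℝ} (hr : ∀ k, 0 < r k) (N : ℕ) (a : ℝ)
    {K : ENNReal} (hK : K ≠ ⊤) {ε : ENNReal} (hε : ε ≠ 0) :
    ∃ o ∈ originSquare a δ,
      (∀ v ∈ Finset.range N ×ˢ Finset.range N, ∀ t ∈ Icc (0 : ℝ) 1, C t ≠ latticePoint δ o v) ∧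
      ∃ᶠ k in atTop, latticeWinding δ N C o +
        K * (1 + ∫⁻ t in Ioc (0 : ℝ) 1, ENNReal.ofReal (gridSpeed δ (r k) N D o t)) <
          windingArea C + 3 * K + ε := by
  set S := Finset.range N ×ˢ Finset.range N
  set X : ℕ → ℂ → ENNReal := fun k o => latticeWinding δ N C o +
    K * (1 + ∫⁻ t in Ioc (0 : ℝ) 1, ENNReal.ofReal (gridSpeed δ (r k) N D o t)) with hX
  have hGm : ∀ k, Measurable fun o => ∫⁻ t in Ioc (0 : ℝ) 1,
      ENNReal.ofReal (gridSpeed δ (r k) N D o t) := fun k =>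
    (continuous_gridSpeed_uncurry δ (r k) N hD).measurable.ennreal_ofReal.lintegral_prod_right'
  have hXm : ∀ k, Measurable (X k) := fun k =>
    (measurable_latticeWinding δ N hC).add (((hGm k).const_add 1).const_mul K)
  set μ : Measure ℂ := volume.restrict (originSquare a δ) with hμ
  have hvol : μ univ = ENNReal.ofReal δ ^ 2 := by
    rw [hμ, Measure.restrict_apply_univ, volume_originSquare]
  have hδ0 : ENNReal.ofReal δ ^ 2 ≠ 0 := pow_ne_zero _ (by simpa using hδ)
  have hδt : ENNReal.ofReal δ ^ 2 ≠ ⊤ := ENNReal.pow_ne_top ENNReal.ofReal_ne_top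
  have hμ0 : μ ≠ 0 := by
    intro h
    rw [h] at hvol
    exact hδ0 hvol.symm
  have : IsFiniteMeasure μ := ⟨by rw [hvol]; exact hδt.lt_top⟩
  have hint : ∀ k, ∫⁻ o, X k o ∂μ ≤ ENNReal.ofReal δ ^ 2 * (windingArea C + 3 * K) := by
    intro k
    simp only [hX]
    rw [lintegral_add_left (measurable_latticeWinding δ N hC),
      lintegral_const_mul _ ((hGm k).const_add 1), lintegral_add_left measurable_const,
      lintegral_one, hvol]
    calc _ ≤ ENNReal.ofReal δ ^ 2 * windingArea C +
          K * (ENNReal.ofReal δ ^ 2 + 2 * ENNReal.ofReal δ ^ 2) := by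
          gcongr
          · exact setLIntegral_latticeWinding_le hδ N a hC
          · exact setLIntegral_gridSpeed_le hδ (hr k) N a hD
      _ = _ := by ring
  have hnull : μ ({o : ℂ | ∃ v ∈ S, ∃ t ∈ Icc (0 : ℝ) 1, C t = latticePoint δ o v} ∪
      (originSquare a δ)ᶜ) = 0 := by
    refine measure_union_null ?_ ?_
    · exact Measure.absolutelyContinuous_of_le Measure.restrict_le_self
        (volume_setOf_exists_eq_latticePoint hC1 δ S)
    · rw [hμ, Measure.restrict_apply (measurableSet_originSquare a δ).compl, compl_inter_self,
        measure_empty]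
  obtain ⟨o, ho, hle⟩ := exists_notMem_null_le_laverage hμ0 (Measurable.liminf hXm).aemeasurable
    hnull
  -- No single origin need be good for all `k`, so the lower limit is averaged, by Fatou's lemma.
  have hmean : ⨍⁻ o, liminf (fun k => X k o) atTop ∂μ ≤ windingArea C + 3 * K := by
    rw [laverage_eq, hvol]
    refine ENNReal.div_le_of_le_mul' ((lintegral_liminf_le hXm).trans ?_)
    exact (liminf_le_liminf (Eventually.of_forall hint)).trans (by simp)
  have hfin : windingArea C + 3 * K ≠ ⊤ :=
    ENNReal.add_ne_top.2 ⟨(windingArea_lt_top hC1 hC).ne, ENNReal.mul_ne_top (by simp) hK⟩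
  refine ⟨o, ?_, fun v hv t ht h => ho (Or.inl ⟨v, hv, t, ht, h⟩), ?_⟩
  · by_contra h
    exact ho (Or.inr h)
  · exact frequently_lt_of_liminf_lt
      (h := (hle.trans hmean).trans_lt (ENNReal.lt_add_right hfin hε))

/-! ### Contractions of limits with almost minimal area -/

theorem hasDerivWithinAt_gridMap {C : ℝ → ℂ} {c : ℂ} {s : Set ℝ} {t : ℝ}
    (hC : HasDerivWithinAt C c s t) (δ r : ℝ) (N : ℕ) (o : ℂ) :
    HasDerivWithinAt (fun t => gridMap δ r N o (C t))
      (((staircaseDeriv δ r N ((C t).re - o.re) * c.re : ℝ) : ℂ) +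
        ((staircaseDeriv δ r N ((C t).im - o.im) * c.im : ℝ) : ℂ) * Complex.I) s t := by
  have h1 : HasDerivWithinAt (fun t => (C t).re - o.re) c.re s t :=
    (Complex.reCLM.hasFDerivAt.comp_hasDerivWithinAt t hC).sub_const _
  have h2 : HasDerivWithinAt (fun t => (C t).im - o.im) c.im s t :=
    (Complex.imCLM.hasFDerivAt.comp_hasDerivWithinAt t hC).sub_const _
  have h3 :=
    (((hasDerivAt_staircase δ r N _).comp_hasDerivWithinAt t h1).const_add o.re).ofReal_comp
  have h4 :=
    (((hasDerivAt_staircase δ r N _).comp_hasDerivWithinAt t h2).const_add o.im).ofReal_comp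
  exact h3.add (h4.mul_const Complex.I)

theorem norm_sub_le_of_norm_rightDeriv_le {C C' : ℝ → ℂ} (hC : ContinuousOn C (Icc 0 1))
    (hC' : ∀ t ∈ Ico (0 : ℝ) 1, HasDerivWithinAt C (C' t) (Ici t) t) {w w' : ℝ → ℝ}
    (hw : ∀ t, HasDerivAt w (w' t) t) (h : ∀ t ∈ Ico (0 : ℝ) 1, ‖C' t‖ ≤ w' t) :
    ∀ s ∈ Icc (0 : ℝ) 1, ∀ t ∈ Icc (0 : ℝ) 1, s ≤ t → ‖C t - C s‖ ≤ w t - w s := by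
  intro s hs t ht hst
  have hsub : ∀ x ∈ Ico s t, x ∈ Ico (0 : ℝ) 1 := fun x hx =>
    ⟨hs.1.trans hx.1, hx.2.trans_le ht.2⟩
  exact image_norm_le_of_norm_deriv_right_le_deriv_boundary (f := fun x => C x - C s) (f' := C')
    (B := fun x => w x - w s) (B' := w')
    ((hC.mono (Icc_subset_Icc hs.1 ht.2)).sub continuousOn_const)
    (fun x hx => (hC' x (hsub x hx)).sub_const _) (by simp) (fun x => (hw x).sub_const _)
    (fun x hx => h x (hsub x hx)) ⟨hst, le_rfl⟩

/-- The straight-line homotopy from a curve to its image under the grid map sweeps little area. -/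
theorem exists_measurable_ge_encard_linearHomotopy_gridMap {C C' : ℝ → ℂ} (hC : IsClosedCurve C)
    {L : ℝ} (hL : 0 < L)
    (hC' : ∀ t ∈ Ico (0 : ℝ) 1, HasDerivWithinAt C (C' t) (Ici t) t ∧ ‖C' t‖ ≤ L) {D : ℝ → ℂ}
    (hD : Continuous D) (hCD : ∀ t ∈ Icc (0 : ℝ) 1, D t = C t) {δ r : ℝ} (hr : 0 < r)
    (hδ : 2 * r ≤ δ) {N : ℕ} {o : ℂ}
    (hN : ∀ t ∈ Icc (0 : ℝ) 1, (C t).re - o.re ∈ Icc 0 (N * δ) ∧ (C t).im - o.im ∈ Icc 0 (N * δ)) :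
    ∃ g : ℂ → ENNReal, Measurable g ∧
      (∀ x, ((squareFiber (linearHomotopy C fun t => gridMap δ r N o (C t)) x).encard : ENNReal) ≤
        g x) ∧
      ∫⁻ x, g x ≤ ENNReal.ofReal (64 * δ * L) *
        (1 + ∫⁻ t in Ioc (0 : ℝ) 1, ENNReal.ofReal (gridSpeed δ r N D o t)) := by
  have hδ0 : 0 < δ := by linarith
  have hgc := continuous_gridSpeed δ r N hD o
  have hg0 := gridSpeed_nonneg hδ0.le hr.le N D o
  set w : ℝ → ℝ := fun t => ∫ u in (0 : ℝ)..t, L * (1 + gridSpeed δ r N D o u) with hw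
  have hwc : Continuous fun u => L * (1 + gridSpeed δ r N D o u) :=
    continuous_const.mul (continuous_const.add hgc)
  have hwd : ∀ t, HasDerivAt w (L * (1 + gridSpeed δ r N D o t)) t := fun t =>
    intervalIntegral.integral_hasDerivAt_right (hwc.intervalIntegrable _ _)
      (hwc.stronglyMeasurableAtFilter _ _) hwc.continuousAt
  have hwm : StrictMonoOn w (Icc 0 1) := by
    refine (strictMono_of_deriv_pos fun t => ?_).strictMonoOn _
    rw [(hwd t).deriv]
    have := hg0 t
    positivity
  have hΦ : ContinuousOn (fun t => gridMap δ r N o (C t)) (Icc 0 1) :=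
    (differentiable_gridMap δ r N o).continuous.comp_continuousOn hC.1
  obtain ⟨g, hgm, hg, hgi⟩ := exists_measurable_ge_encard_linearHomotopy (δ := 4 * δ)
    (C' := fun t => gridMap δ r N o (C t)) (by linarith) hwm
    (norm_sub_le_of_norm_rightDeriv_le hC.1 (fun t ht => (hC' t ht).1) hwd fun t ht =>
      (hC' t ht).2.trans (le_mul_of_one_le_right hL.le (by linarith [hg0 t])))
    (norm_sub_le_of_norm_rightDeriv_le hΦ
      (fun t ht => hasDerivWithinAt_gridMap (hC' t ht).1 δ r N o) hwd fun t ht => by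
        have h1 := staircaseDeriv_nonneg hδ0.le hr.le N ((C t).re - o.re)
        have h2 := staircaseDeriv_nonneg hδ0.le hr.le N ((C t).im - o.im)
        have h3 := (Complex.abs_re_le_norm (C' t)).trans (hC' t ht).2
        have h4 := (Complex.abs_im_le_norm (C' t)).trans (hC' t ht).2
        rw [gridSpeed, hCD t (Ico_subset_Icc_self ht)]
        refine (norm_add_le _ _).trans ?_
        rw [norm_mul, Complex.norm_I, mul_one, Complex.norm_real, Complex.norm_real, norm_mul,
          norm_mul, Real.norm_of_nonneg h1, Real.norm_of_nonneg h2, Real.norm_eq_abs,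
          Real.norm_eq_abs]
        nlinarith)
    (fun t ht => norm_gridMap_sub_le hr hδ (hN t ht).1 (hN t ht).2)
  refine ⟨g, hgm, hg, hgi.trans (le_of_eq ?_)⟩
  have hw1 : w 1 - w 0 = L * (1 + ∫ t in Ioc (0 : ℝ) 1, gridSpeed δ r N D o t) := by
    simp only [hw, intervalIntegral.integral_same, sub_zero]
    rw [intervalIntegral.integral_const_mul, intervalIntegral.integral_add
      (continuous_const.intervalIntegrable _ _) (hgc.intervalIntegrable _ _),
      intervalIntegral.integral_const, intervalIntegral.integral_of_le zero_le_one]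
    simp
  rw [hw1, ← ofReal_integral_eq_lintegral_ofReal (hgc.integrableOn_Icc.mono_set Ioc_subset_Icc_self)
    (Eventually.of_forall hg0), ← ENNReal.ofReal_one, ← ENNReal.ofReal_add zero_le_one
      (integral_nonneg hg0), ← ENNReal.ofReal_mul (by positivity)]
  congr 1
  ring

/-- Collapsing a contraction to a grid removes the area that it sweeps in excess near the curve. -/
theorem exists_contraction_gridMap {C C' : ℝ → ℂ} (hC1 : IsPiecewiseC1 C) (hC : IsClosedCurve C)
    {L : ℝ} (hL : 0 < L)
    (hC' : ∀ t ∈ Ico (0 : ℝ) 1, HasDerivWithinAt C (C' t) (Ici t) t ∧ ‖C' t‖ ≤ L) {D : ℝ → ℂ}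
    (hD : Continuous D) (hCD : ∀ t ∈ Icc (0 : ℝ) 1, D t = C t)
    (hlim : ∀ ε > (0 : ℝ), ∃ C' : ℝ → ℂ, IsRegularSelfOverlapping C' ∧
      ∀ t ∈ Icc (0 : ℝ) 1, dist (C' t) (C t) < ε)
    {δ r : ℝ} (hr : 0 < r) (hδ : 2 * r ≤ δ) {N : ℕ} {o : ℂ}
    (hN : ∀ t ∈ Icc (0 : ℝ) 1, (C t).re - o.re ∈ Icc 0 (N * δ) ∧ (C t).im - o.im ∈ Icc 0 (N * δ))
    (havoid : ∀ v ∈ Finset.range N ×ˢ Finset.range N, ∀ t ∈ Icc (0 : ℝ) 1,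
      C t ∉ latticeBox δ r o v) :
    ∃ H : ℝ × ℝ → ℂ, IsHomotopy (C 0) C (fun _ => C 0) H ∧ IsPiecewiseDifferentiable H ∧
      homotopyArea H ≤ latticeWinding δ N C o + ENNReal.ofReal (64 * δ * L) *
        (1 + ∫⁻ t in Ioc (0 : ℝ) 1, ENNReal.ofReal (gridSpeed δ r N D o t)) := by
  set S := Finset.range N ×ˢ Finset.range N
  set Φ := gridMap δ r N o
  have hΦd : Differentiable ℝ Φ := differentiable_gridMap δ r N o
  have hcl : IsClosed (⋃ v ∈ S, latticeBox δ r o v) :=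
    S.finite_toSet.isClosed_biUnion fun v _ => isClosed_latticeBox δ r o v
  obtain ⟨η, hη, hηC⟩ := Metric.exists_pos_forall_lt_edist
    (isCompact_Icc.image_of_continuousOn hC.1) hcl (by
      rw [Set.disjoint_left]
      rintro _ ⟨t, ht, rfl⟩ h
      obtain ⟨v, hv, hb⟩ := mem_iUnion₂.1 h
      exact havoid v hv t ht hb)
  obtain ⟨H, hH, hHd, hHx⟩ := exists_contraction_of_limit hC1 hC hlim (η := η) hη
  have hB : IsHomotopy (Φ (C 0)) (fun t => Φ (C t)) (fun _ => Φ (C 0)) fun q => Φ (H q) :=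
    ⟨hΦd.continuous.comp_continuousOn hH.1,
      fun t ht => ⟨congrArg Φ (hH.2.1 t ht).1, congrArg Φ (hH.2.1 t ht).2⟩,
      fun s hs => ⟨congrArg Φ (hH.2.2 s hs).1, congrArg Φ (hH.2.2 s hs).2⟩⟩
  have hBd : IsPiecewiseDifferentiable fun q => Φ (H q) := by
    obtain ⟨n, P, h1, h2, h3⟩ := hHd
    exact ⟨n, P, h1, h2, fun i => hΦd.comp_differentiableOn (h3 i)⟩
  have hA : IsFreeHomotopy (C 0) (Φ (C 0)) C (fun t => Φ (C t))
      (linearHomotopy C fun t => Φ (C t)) :=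
    isFreeHomotopy_linearHomotopy (C' := fun t => Φ (C t)) hC1 hC
      ⟨hΦd.continuous.comp_continuousOn hC.1, by simp only [hC.2]⟩
      fun I _ hI => hΦd.comp_differentiableOn hI
  obtain ⟨g, hgm, hg, hgi⟩ := exists_measurable_ge_encard_linearHomotopy_gridMap hC hL hC' hD hCD
    hr hδ hN
  refine ⟨glue (C 0) (Φ (C 0)) (linearHomotopy C fun t => Φ (C t)) fun q => Φ (H q),
    isHomotopy_glue hA hB, isPiecewiseDifferentiable_glue hA hB hBd, ?_⟩
  have hseg : ∀ᵐ x : ℂ, x ∉ segmentPath (C 0) (Φ (C 0)) '' Icc 0 1 :=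
    measure_eq_zero_iff_ae_notMem.1
      (volume_image_eq_zero (differentiable_segmentPath _ _).differentiableOn)
  have hcell := ae_sweepCount_gridMap_le hC hr hδ havoid (H := H) fun v hv x hx =>
    hHx x fun t ht => by
      have h := hηC (C t) ⟨t, ht, rfl⟩ x (mem_biUnion hv hx)
      rw [edist_nndist, ENNReal.coe_lt_coe] at h
      exact_mod_cast h.le
  calc homotopyArea (glue (C 0) (Φ (C 0)) (linearHomotopy C fun t => Φ (C t)) fun q => Φ (H q))
      ≤ ∫⁻ x, (g x + ∑ v ∈ S, (gridCell δ o v).indicator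
        (fun _ => ((windingNumber C (latticePoint δ o v)).natAbs : ENNReal)) x) := by
        refine lintegral_mono_ae ?_
        filter_upwards [hseg, hcell] with x h1 h2
        refine (ENat.toENNReal_mono (sweepCount_glue_le hA hB h1)).trans ?_
        rw [ENat.toENNReal_add]
        exact add_le_add (hg x) h2
    _ = (∫⁻ x, g x) + latticeWinding δ N C o := by
        rw [lintegral_add_left hgm, lintegral_finsetSum _ fun v _ =>
          measurable_const.indicator (measurableSet_gridCell δ o v), latticeWinding]
        congr 1
        refine Finset.sum_congr rfl fun v _ => ?_
        rw [lintegral_indicator_const (measurableSet_gridCell δ o v), volume_gridCell, mul_comm]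
    _ ≤ _ := by
        rw [add_comm]
        gcongr

/-- The collapsed contractions have, for a suitable origin of the grid, an area that exceeds the
winding area by a multiple of the mesh. -/
theorem minHomotopyArea_le_of_limit {C : ℝ → ℂ} (hC1 : IsPiecewiseC1 C) (hC : IsClosedCurve C)
    (hlim : ∀ ε > (0 : ℝ), ∃ C' : ℝ → ℂ, IsRegularSelfOverlapping C' ∧
      ∀ t ∈ Icc (0 : ℝ) 1, dist (C' t) (C t) < ε) :
    minHomotopyArea (C 0) C (fun _ => C 0) ≤ windingArea C := by
  obtain ⟨L, hL, C', hC'⟩ := hC1.exists_rightDeriv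
  obtain ⟨R, hR⟩ := isCompact_Icc.exists_bound_of_continuousOn hC.1
  have hR0 : 0 ≤ R := (norm_nonneg _).trans (hR 0 (by simp))
  have hDc : Continuous (IccExtend zero_le_one ((Icc (0 : ℝ) 1).domRestrict C)) :=
    hC.1.domRestrict.Icc_extend'
  set D : ℝ → ℂ := IccExtend zero_le_one ((Icc (0 : ℝ) 1).domRestrict C)
  have hCD : ∀ t ∈ Icc (0 : ℝ) 1, D t = C t := fun t ht => IccExtend_of_mem _ _ ht
  refine ENNReal.le_of_forall_pos_le_add fun ε hε _ => ?_
  -- The mesh for which the straight-line homotopies to the grid sweep at most `ε / 2` on average.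
  obtain ⟨δ, hδ, hδε⟩ : ∃ δ : ℝ, 0 < δ ∧ 3 * (64 * δ * (L + 1)) = ε / 2 := by
    refine ⟨ε / (384 * (L + 1)), by positivity, ?_⟩
    field_simp
    norm_num
  obtain ⟨N, hN⟩ := exists_nat_ge ((2 * R + 2 * δ) / δ)
  rw [div_le_iff₀ hδ] at hN
  set r : ℕ → ℝ := fun k => δ / 2 * (1 / ((k : ℝ) + 1)) with hr
  have hr0 : ∀ k, 0 < r k := fun k => by positivity
  have hrδ : ∀ k, 2 * r k ≤ δ := fun k => by
    have h : 1 / ((k : ℝ) + 1) ≤ 1 := by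
      rw [div_le_one (by positivity)]
      linarith [(Nat.cast_nonneg k : (0 : ℝ) ≤ k)]
    simp only [hr]
    nlinarith
  have hrt : Tendsto r atTop (𝓝 0) := by
    have := (tendsto_one_div_add_atTop_nhds_zero_nat (𝕜 := ℝ)).const_mul (δ / 2)
    rwa [mul_zero] at this
  obtain ⟨o, ⟨⟨o1, o2⟩, o3, o4⟩, hav, hfreq⟩ := exists_origin hC1 hC hDc hδ hr0 N (-R - δ)
    (K := ENNReal.ofReal (64 * δ * (L + 1))) ENNReal.ofReal_ne_top
    (ε := ENNReal.ofReal (ε / 2)) (by simpa using hε)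
  obtain ⟨k, hk, hbox⟩ :=
    (hfreq.and_eventually (eventually_forall_notMem_latticeBox hC hav hrt)).exists
  obtain ⟨H, hH, hHd, hHa⟩ := exists_contraction_gridMap hC1 hC (by linarith : 0 < L + 1)
    (fun t ht => ⟨(hC' t ht).1, (hC' t ht).2.trans (by linarith)⟩) hDc hCD hlim (hr0 k) (hrδ k)
    (N := N) (o := o) (fun t ht => by
      obtain ⟨h1, h2⟩ := abs_le.1 ((Complex.abs_re_le_norm (C t)).trans (hR t ht))
      obtain ⟨h3, h4⟩ := abs_le.1 ((Complex.abs_im_le_norm (C t)).trans (hR t ht))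
      exact ⟨⟨by linarith, by linarith⟩, by linarith, by linarith⟩) hbox
  calc minHomotopyArea (C 0) C (fun _ => C 0) ≤ homotopyArea H := iInf₂_le H ⟨hH, hHd⟩
    _ ≤ _ := hHa
    _ ≤ _ := hk.le
    _ = windingArea C + ε := by
      have h3 : (3 : ENNReal) = ENNReal.ofReal 3 := by simp
      rw [add_assoc, h3, ← ENNReal.ofReal_mul (by norm_num), ← ENNReal.ofReal_add (by positivity)
        (by positivity), hδε, add_halves, ENNReal.ofReal_coe_nnreal]

/-! ### Contractions through an immersed disk -/

theorem homotopyArea_linearContraction {F : ℂ → ℂ} {φ : Circle ≃ₜ Circle} {C : ℝ → ℂ}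
    (hF : IsDiskImmersion F) (hC : IsBoundaryCurve F φ C) (hC1 : IsPiecewiseC1 C) :
    homotopyArea (linearContraction F φ) = windingArea C := by
  refine lintegral_congr_ae ?_
  filter_upwards [measure_eq_zero_iff_ae_notMem.1 hC1.volume_image] with x hx
  rw [sweepCount_linearContraction hF hC fun t ht h => hx ⟨t, ht, h⟩, ENat.toENNReal_coe]

end HomotopyArea

theorem mainTheorem2 (p₀ : ℂ) (C : ℝ → ℂ) (hC : C ∈ HomotopyArea.normalCurves p₀)
    (hso : HomotopyArea.IsSelfOverlapping C) :
    HomotopyArea.minHomotopyArea p₀ C (fun _ => p₀) = HomotopyArea.windingArea C ∧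
    HomotopyArea.windingArea C < ⊤ ∧
    ∀ (F : ℂ → ℂ) (φ : Circle ≃ₜ Circle),
      HomotopyArea.IsDiskImmersion F → HomotopyArea.IsBoundaryCurve F φ C →
        HomotopyArea.IsHomotopy p₀ C (fun _ => p₀) (HomotopyArea.linearContraction F φ) ∧
        HomotopyArea.IsPiecewiseDifferentiable (HomotopyArea.linearContraction F φ) ∧
        HomotopyArea.homotopyArea (HomotopyArea.linearContraction F φ) =
          HomotopyArea.windingArea C := by
  obtain ⟨hC1, hcl, rfl⟩ := HomotopyArea.IsPiecewiseC1.of_mem_normalCurves hC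
  have hdisk : ∀ (F : ℂ → ℂ) (φ : Circle ≃ₜ Circle),
      HomotopyArea.IsDiskImmersion F → HomotopyArea.IsBoundaryCurve F φ C →
        HomotopyArea.IsHomotopy (C 0) C (fun _ => C 0) (HomotopyArea.linearContraction F φ) ∧
        HomotopyArea.IsPiecewiseDifferentiable (HomotopyArea.linearContraction F φ) ∧
        HomotopyArea.homotopyArea (HomotopyArea.linearContraction F φ) =
          HomotopyArea.windingArea C := fun F φ hF hb =>
    ⟨HomotopyArea.isHomotopy_linearContraction hF hb,
      HomotopyArea.isPiecewiseDifferentiable_linearContraction hF hb hC1,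
      HomotopyArea.homotopyArea_linearContraction hF hb hC1⟩
  refine ⟨le_antisymm ?_ (le_iInf₂ fun H hH =>
    HomotopyArea.windingArea_le_homotopyArea hH.1 hH.2),
    HomotopyArea.windingArea_lt_top hC1 hcl, hdisk⟩
  rcases hso with ⟨-, -, F, φ, hF, hb⟩ | ⟨-, hlim⟩
  · obtain ⟨h1, h2, h3⟩ := hdisk F φ hF hb
    exact (iInf₂_le _ ⟨h1, h2⟩).trans h3.le
  · exact HomotopyArea.minHomotopyArea_le_of_limit hC1 hcl hlim
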